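/- Let $(\Omega,\mathcal F,\mathbb P)$ be a probability space with an ergodic group $(\tau_k)_{k\in\mathbb Z}$ of measure preserving transformations. Let $a:\mathbb R^n\times\mathbb R\times\Omega\to\mathbb R$ and $b:\mathbb R^n\times\mathbb R\times\Omega\to\mathbb R^n$ be jointly measurable, Lipschitz continuous in $(x,t)$ for each $\omega$ (the constant may depend on $\omega$), $\mathbb Z^n$-periodic in $x$ and stationary in $t$, that is, for all $x\in\mathbb R^n$, $l\in\mathbb Z^n$, $t\in\mathbb R$, $k\in\mathbb Z$, $\omega\in\Omega$, $$a(x+l,t,\tau_k\omega)=a(x,t+k,\omega),\qquad b(x+l,t,\tau_k\omega)=b(x,t+k,\omega).$$ Assume that there are constants $\alpha,\beta,\eta>0$ with $\alpha\le a\le\beta$ and $\alpha-|b|\ge\eta$ on $\mathbb R^n\times\mathbb R\times\Omega$. For $t>0$ and $x\in\mathbb R^n$ let $\mathcal R_t(x)(\omega)$ be the set of all $\gamma(t)$, where $\gamma:[0,t]\to\mathbb R^n$ is absolutely continuous, $\gamma(0)=x$ and $|\gamma'(r)-b(\gamma(r),r,\omega)|\le a(\gamma(r),r,\omega)$ for a.e.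 $r\in[0,t]$ (equivalently, $\gamma'=b+a\xi$ with a measurable control $|\xi|\le 1$). Let $Y=[0,1]^n$ and let $\rho$ be the Hausdorff distance. Then there exist a non-empty compact convex set $D\subset\mathbb R^n$ and an event $\widetilde\Omega\in\mathcal F$ with $\mathbb P(\widetilde\Omega)=1$ such that, for each $\omega\in\widetilde\Omega$: (i) $\displaystyle\lim_{t\to\infty}\ \sup_{x\in Y}\ \rho\Big(\frac{\mathcal R_t(x)(\omega)}{t},\,D\Big)=0.$ (ii) For every uniformly continuous $u_0:\mathbb R^n\to\mathbb R$: for each $\varepsilon>0$ the problem $$u^\varepsilon_t+a\big(\tfrac x\varepsilon,\tfrac t\varepsilon,\omega\big)|Du^\varepsilon|+b\big(\tfrac x\varepsilon,\tfrac t\varepsilon,\omega\big)\cdot Du^\varepsilon=0\ \text{ in }\mathbb R^n\times(0,\infty),\qquad u^\varepsilon(\cdot,0)=u_0,$$ has a unique continuous viscosity solution $u^\varepsilon$ on $\mathbb R^n\times[0,\infty)$; so does the problem $$\overline u_t+\overline H(D\overline u)=0\ \text{ in }\mathbb R^n\times(0,\infty),\qquad \overline u(\cdot,0)=u_0,\qquad\text{where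 }\ \overline H(p):=\sup_{q\in D}p\cdot q;$$ and, as $\varepsilon\to0^+$, $u^\varepsilon$ converges to $\overline u$ locally uniformly in $\mathbb R^n\times[0,\infty)$. -/

import Mathlib

open Set Filter Topology MeasureTheory
open scoped Pointwise ENNReal

/-- `ℝⁿ` with its Euclidean norm. -/
abbrev Space (n : ℕ) : Type := EuclideanSpace ℝ (Fin n)

/-- The point of `ℝⁿ` with the integer coordinates `l`. -/
noncomputable def latticePoint {n : ℕ} (l : Fin n → ℤ) : Space n :=
  WithLp.toLp 2 (fun i => (l i : ℝ))

/-- The closed unit cell `Y = [0,1]ⁿ`. -/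
def unitCell (n : ℕ) : Set (Space n) := {x | ∀ i, x i ∈ Icc (0 : ℝ) 1}

/-- `(τ_k)_{k ∈ ℤ}` is an ergodic group of measure preserving transformations of `(Ω, P)`. -/
structure IsErgodicGroup {Ω : Type*} [MeasurableSpace Ω] (P : Measure Ω) (τ : ℤ → Ω → Ω) :
    Prop where
  map_zero : ∀ ω, τ 0 ω = ω
  map_add : ∀ k k' ω, τ (k + k') ω = τ k (τ k' ω)
  measurePreserving : ∀ k, MeasurePreserving (τ k) P P
  ergodic : ∀ U : Set Ω, MeasurableSet U → (∀ k, τ k '' U = U) → P U = 1 ∨ P U = 0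

/-- A random field `f(x, t, ω)` on `ℝⁿ × ℝ` which is jointly measurable, `ℤⁿ`-periodic in `x`,
stationary in `t` with respect to `(τ_k)`, and Lipschitz continuous in `(x, t)` for each `ω`
(with a constant that may depend on `ω`). -/
structure IsPeriodicStationaryField {n : ℕ} {Ω : Type*} [MeasurableSpace Ω] (τ : ℤ → Ω → Ω)
    {F : Type*} [NormedAddCommGroup F] [MeasurableSpace F]
    (f : Space n → ℝ → Ω → F) : Prop where
  measurable : Measurable (fun z : (Space n × ℝ) × Ω => f z.1.1 z.1.2 z.2)
  stationary : ∀ (x : Space n) (l : Fin n → ℤ) (t : ℝ) (k : ℤ) (ω : Ω),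
    f (x + latticePoint l) t (τ k ω) = f x (t + k) ω
  lipschitz : ∀ ω, ∃ K, LipschitzWith K (fun z : Space n × ℝ => f z.1 z.2 ω)

/-- Assumption (A) on the velocity `a`, with bounds `0 < α ≤ a ≤ β`. -/
structure AssumptionA {n : ℕ} {Ω : Type*} [MeasurableSpace Ω] (τ : ℤ → Ω → Ω)
    (a : Space n → ℝ → Ω → ℝ) (α β : ℝ) : Prop where
  field : IsPeriodicStationaryField τ a
  alpha_pos : 0 < α
  beta_pos : 0 < β
  lower : ∀ x t ω, α ≤ a x t ω
  upper : ∀ x t ω, a x t ω ≤ β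

/-- Assumption (B) on the drift `b`: `α - |b| ≥ η > 0`, where `α` is the lower bound of `a`. -/
structure AssumptionB {n : ℕ} {Ω : Type*} [MeasurableSpace Ω] (τ : ℤ → Ω → Ω)
    (b : Space n → ℝ → Ω → Space n) (α η : ℝ) : Prop where
  field : IsPeriodicStationaryField τ b
  eta_pos : 0 < η
  small : ∀ x t ω, η ≤ α - ‖b x t ω‖

/-- `γ` is an admissible path on `[s,t]` of the control system `γ' = b(γ,r) + a(γ,r) ξ`, `|ξ| ≤ 1`:
it is absolutely continuous and `|γ'(r) - b(γ(r),r)| ≤ a(γ(r),r)` for almost every `r ∈ [s,t]`. -/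
def IsAdmissiblePath {n : ℕ} (a : Space n → ℝ → ℝ) (b : Space n → ℝ → Space n) (s t : ℝ)
    (γ : ℝ → Space n) : Prop :=
  AbsolutelyContinuousOnInterval γ s t ∧
    ∀ᵐ r ∂(volume.restrict (Icc s t)),
      ∃ v : Space n, HasDerivAt γ v r ∧ ‖v - b (γ r) r‖ ≤ a (γ r) r

/-- The reachable set `R_t(x)` at time `t` starting from `x` at time `0`. -/
def reachableSet {n : ℕ} (a : Space n → ℝ → ℝ) (b : Space n → ℝ → Space n) (t : ℝ)
    (x : Space n) : Set (Space n) :=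
  {y | ∃ γ : ℝ → Space n, IsAdmissiblePath a b 0 t γ ∧ γ 0 = x ∧ γ t = y}

/-- `u`, of which only the values on `ℝⁿ × [0,∞)` matter, is a continuous viscosity solution of
`u_t + H(x,t,Du) = 0` in `ℝⁿ × (0,∞)`, `u = u₀` on `ℝⁿ × {0}`. Test functions are `C¹` near the
point where they touch. -/
structure IsViscositySolution {n : ℕ} (H : Space n → ℝ → Space n → ℝ) (u₀ : Space n → ℝ)
    (u : Space n × ℝ → ℝ) : Prop where
  continuousOn : ContinuousOn u (univ ×ˢ Ici 0)
  initial : ∀ x, u (x, 0) = u₀ x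
  subsolution : ∀ (φ : Space n × ℝ → ℝ) (x : Space n) (t : ℝ), 0 < t →
    ContDiffAt ℝ 1 φ (x, t) → IsLocalMax (fun z => u z - φ z) (x, t) →
    deriv (fun s => φ (x, s)) t + H x t (gradient (fun y => φ (y, t)) x) ≤ 0
  supersolution : ∀ (φ : Space n × ℝ → ℝ) (x : Space n) (t : ℝ), 0 < t →
    ContDiffAt ℝ 1 φ (x, t) → IsLocalMin (fun z => u z - φ z) (x, t) →
    0 ≤ deriv (fun s => φ (x, s)) t + H x t (gradient (fun y => φ (y, t)) x)

/-- The Cauchy problem for `u_t + H(x,t,Du) = 0` with initial datum `u₀` has exactly one continuous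
viscosity solution on `ℝⁿ × [0,∞)`. -/
def IsWellPosed {n : ℕ} (H : Space n → ℝ → Space n → ℝ) (u₀ : Space n → ℝ) : Prop :=
  (∃ u, IsViscositySolution H u₀ u) ∧
    ∀ u v, IsViscositySolution H u₀ u → IsViscositySolution H u₀ v → EqOn u v (univ ×ˢ Ici 0)

/-- The oscillating Hamiltonian `a(x/ε,t/ε)|p| + b(x/ε,t/ε)·p`. -/
noncomputable def driftHamiltonian {n : ℕ} (a : Space n → ℝ → ℝ) (b : Space n → ℝ → Space n)
    (ε : ℝ) (x : Space n) (t : ℝ) (p : Space n) : ℝ :=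
  a (ε⁻¹ • x) (t / ε) * ‖p‖ + inner ℝ (b (ε⁻¹ • x) (t / ε)) p

/-- The effective Hamiltonian `H̄(p) = sup_{q ∈ D} p·q`. -/
noncomputable def effectiveHamiltonian {n : ℕ} (D : Set (Space n)) (p : Space n) : ℝ :=
  sSup ((fun q => inner ℝ p q) '' D)

/-! The large-scale motion is governed by `maxDisplacement`, the largest value of p·(γ(t) - γ(s))
over all admissible paths on [s,t]. Since α - |b| ≥ η, every velocity of norm at most η is
admissible, so any point is reached from any other at speed η. With periodicity, a path can
therefore be imitated from any other starting point with an error in displacement that does not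
depend on time (`exists_reach_norm_sub_le`). Hence displacements are subadditive in time, and
superadditive up to the constant `offsetBound`.

This makes a subadditive ergodic theorem unnecessary. Averaging over N phases compares N times the
displacement on [0,k] with the sum over j < k of the displacements on [j,j+N]; by stationarity this
is a Birkhoff sum for `τ 1`. Birkhoff's theorem on every scale N, followed by N → ∞, gives an almost
sure, nonrandom speed H(p). Measurability holds because paths can be replaced by broken lines with
vertices in a countable set: slowing a path down creates slack in the constraint
(`exists_slack_path`), and chords of a slack path are admissible.

The function H is sublinear, hence the support function of a compact convex set D, `supportedSet H`.
Reachable sets lie near x + tD because their support functions do. The converse is not automatic, as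
reachable sets need not be convex: to approach x + tq, time is cut into k blocks, and in each block
the path moves almost optimally against the current error. The squared error then grows slowly
enough (`exists_reach_sq_norm_le`).

For the equations, both the oscillating and the effective problem are instances of `IsReachSystem`,
for which the least initial value over the backward reachable set is a viscosity solution.
Comparison by doubling of variables, with a penalty adapted to finite propagation speed, gives
uniqueness without growth conditions. Every solution is thus a value function, and homogenization
reduces to convergence of rescaled backward reachable sets together with uniform continuity of u₀.
-/

/-- Pointwise bounds and a Lipschitz bound for a control system `γ' = b + a ξ`, `|ξ| ≤ 1`. -/
structure IsCoerciveField {n : ℕ} (a : Space n → ℝ → ℝ) (b : Space n → ℝ → Space n)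
    (α β η K : ℝ) : Prop where
  eta_pos : 0 < η
  lower : ∀ x t, α ≤ a x t
  upper : ∀ x t, a x t ≤ β
  small : ∀ x t, η ≤ α - ‖b x t‖
  K_nonneg : 0 ≤ K
  lip_a : ∀ x t y s, |a x t - a y s| ≤ K * (‖x - y‖ + |t - s|)
  lip_b : ∀ x t y s, ‖b x t - b y s‖ ≤ K * (‖x - y‖ + |t - s|)

/-- `y` can be reached at time `t` from `x` at time `s` by an admissible path. -/
def Reach {n : ℕ} (a : Space n → ℝ → ℝ) (b : Space n → ℝ → Space n) (s t : ℝ)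
    (x y : Space n) : Prop :=
  ∃ γ : ℝ → Space n, IsAdmissiblePath a b s t γ ∧ γ s = x ∧ γ t = y

/-! ### Mean value inequalities for absolutely continuous functions. -/

theorem AbsolutelyContinuousOnInterval.of_dist_le {X Y : Type*} [PseudoMetricSpace X]
    [PseudoMetricSpace Y] {f : ℝ → X} {g : ℝ → Y} {C s t : ℝ}
    (hf : AbsolutelyContinuousOnInterval f s t)
    (h : ∀ r r', dist (g r) (g r') ≤ C * dist (f r) (f r')) :
    AbsolutelyContinuousOnInterval g s t := by
  unfold AbsolutelyContinuousOnInterval at *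
  refine squeeze_zero (fun _ => Finset.sum_nonneg fun _ _ => dist_nonneg) (fun E => ?_)
    (by simpa using hf.const_mul C)
  rw [Finset.mul_sum]
  exact Finset.sum_le_sum fun i _ => h _ _

theorem AbsolutelyContinuousOnInterval.inner_left {E : Type*} [NormedAddCommGroup E]
    [InnerProductSpace ℝ E] {f : ℝ → E} {s t : ℝ}
    (hf : AbsolutelyContinuousOnInterval f s t) (p : E) :
    AbsolutelyContinuousOnInterval (fun r => inner ℝ p (f r)) s t := by
  refine hf.of_dist_le (C := ‖p‖) fun r r' => ?_
  rw [Real.dist_eq, ← inner_sub_right, dist_eq_norm]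
  exact abs_real_inner_le_norm _ _

/-- The mean value inequality for an absolutely continuous function. -/
theorem AbsolutelyContinuousOnInterval.sub_le_integral {f c : ℝ → ℝ} {s t : ℝ} (hst : s ≤ t)
    (hf : AbsolutelyContinuousOnInterval f s t) (hc : IntervalIntegrable c volume s t)
    (h : ∀ᵐ r ∂(volume.restrict (Icc s t)), ∃ v, HasDerivAt f v r ∧ v ≤ c r) :
    f t - f s ≤ ∫ r in s..t, c r := by
  rw [← hf.integral_deriv_eq_sub]
  refine intervalIntegral.integral_mono_ae_restrict hst hf.intervalIntegrable_deriv hc ?_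
  filter_upwards [h] with r ⟨v, hv, hvc⟩
  rwa [hv.deriv]

/-- The scalar inequality is applied to ⟨p, f⟩, where p is the very vector to be estimated; dividing
by ‖p‖ gives the bound without integrating a vector-valued derivative. -/
theorem AbsolutelyContinuousOnInterval.norm_sub_le_integral {E : Type*} [NormedAddCommGroup E]
    [InnerProductSpace ℝ E] {f : ℝ → E} {c : ℝ → ℝ} {s t : ℝ} (hst : s ≤ t)
    (hf : AbsolutelyContinuousOnInterval f s t) (hc : IntervalIntegrable c volume s t) (w : E)
    (h : ∀ᵐ r ∂(volume.restrict (Icc s t)), ∃ v, HasDerivAt f v r ∧ ‖v - w‖ ≤ c r) :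
    ‖f t - f s - (t - s) • w‖ ≤ ∫ r in s..t, c r := by
  set p := f t - f s - (t - s) • w with hp
  have h1 := (hf.inner_left p).sub_le_integral hst
    (c := fun r => inner ℝ p w + ‖p‖ * c r) (by
      exact (intervalIntegrable_const).add (hc.const_mul _)) (by
      filter_upwards [h] with r ⟨v, hv, hvc⟩
      refine ⟨inner ℝ p v, by simpa using (hasDerivAt_const r p).inner ℝ hv, ?_⟩
      have := real_inner_le_norm p (v - w)
      rw [inner_sub_right] at this
      have := mul_le_mul_of_nonneg_left hvc (norm_nonneg p)
      linarith)
  rw [intervalIntegral.integral_add intervalIntegrable_const (hc.const_mul _),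
    intervalIntegral.integral_const, intervalIntegral.integral_const_mul, smul_eq_mul] at h1
  have h2 : ‖p‖ * ‖p‖ ≤ ‖p‖ * ∫ r in s..t, c r := by
    have : inner ℝ p (f t) - inner ℝ p (f s) - (t - s) * inner ℝ p w = ‖p‖ * ‖p‖ := by
      rw [← real_inner_self_eq_norm_mul_norm, ← inner_sub_right, ← inner_smul_right,
        ← inner_sub_right]
    linarith
  rcases (norm_nonneg p).eq_or_lt with h0 | h0
  · rw [← h0]
    refine intervalIntegral.integral_nonneg_of_ae_restrict hst ?_
    filter_upwards [h] with r ⟨v, hv, hvc⟩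
    exact (norm_nonneg _).trans hvc
  · exact le_of_mul_le_mul_left h2 h0

/-! ### Admissible paths, local controllability and the Hamiltonian. -/

section Paths

variable {n : ℕ} {a : Space n → ℝ → ℝ} {b : Space n → ℝ → Space n} {α β η K : ℝ}

namespace IsCoerciveField

theorem norm_b_le (h : IsCoerciveField a b α β η K) (x : Space n) (t : ℝ) : ‖b x t‖ ≤ β := by
  have := h.small x t; have := h.eta_pos; have := h.lower x t; have := h.upper x t; linarith

theorem beta_pos (h : IsCoerciveField a b α β η K) : 0 < β := by
  have := h.small 0 0; have := h.eta_pos; have := h.lower 0 0; have := h.upper 0 0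
  have := norm_nonneg (b 0 0); linarith

theorem norm_velocity_le (h : IsCoerciveField a b α β η K) {x v : Space n} {t : ℝ}
    (hv : ‖v - b x t‖ ≤ a x t) : ‖v‖ ≤ 2 * β := by
  have := norm_le_norm_add_norm_sub (b x t) v
  rw [norm_sub_rev] at this
  have := h.norm_b_le x t; have := h.upper x t; linarith

theorem norm_path_sub_le (h : IsCoerciveField a b α β η K) {s t : ℝ} {γ : ℝ → Space n}
    (hγ : IsAdmissiblePath a b s t γ) {r r' : ℝ} (hr : r ∈ Icc s t) (hr' : r' ∈ Icc s t) :
    ‖γ r - γ r'‖ ≤ 2 * β * |r - r'| := by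
  wlog hle : r' ≤ r generalizing r r'
  · rw [norm_sub_rev, abs_sub_comm]; exact this hr' hr (le_of_not_ge hle)
  have hsub : Icc r' r ⊆ Icc s t := Icc_subset_Icc hr'.1 hr.2
  have := (hγ.1.mono (c := r') (d := r) (by
    rw [uIcc_of_le hle, uIcc_of_le (hr.1.trans hr.2)]; exact hsub)).norm_sub_le_integral hle
      (c := fun _ => 2 * β) intervalIntegrable_const 0 (by
      filter_upwards [ae_restrict_of_ae_restrict_of_subset hsub hγ.2] with q ⟨v, hv, hvb⟩
      exact ⟨v, hv, by simpa using h.norm_velocity_le hvb⟩)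
  rw [abs_of_nonneg (sub_nonneg.2 hle)]
  simpa [mul_comm, mul_left_comm] using this

end IsCoerciveField

theorem absolutelyContinuousOnInterval_of_norm_sub_le {γ : ℝ → Space n} {s t C : ℝ}
    (hst : s ≤ t) (hγ : ∀ r ∈ Icc s t, ∀ r' ∈ Icc s t, ‖γ r - γ r'‖ ≤ C * |r - r'|) :
    AbsolutelyContinuousOnInterval γ s t := by
  refine LipschitzOnWith.absolutelyContinuousOnInterval (K := C.toNNReal) ?_
  rw [uIcc_of_le hst]
  refine LipschitzOnWith.of_dist_le_mul fun r hr r' hr' => ?_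
  rw [dist_eq_norm, Real.dist_eq]
  exact (hγ r hr r' hr').trans (mul_le_mul_of_nonneg_right (Real.le_coe_toNNReal C) (abs_nonneg _))

theorem IsAdmissiblePath.mono {s t s' t' : ℝ} {γ : ℝ → Space n} (hγ : IsAdmissiblePath a b s t γ)
    (hs : s ≤ s') (hst : s' ≤ t') (ht : t' ≤ t) : IsAdmissiblePath a b s' t' γ := by
  refine ⟨hγ.1.mono ?_, ae_restrict_of_ae_restrict_of_subset (Icc_subset_Icc hs ht) hγ.2⟩
  rw [uIcc_of_le hst, uIcc_of_le (hs.trans (hst.trans ht))]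
  exact Icc_subset_Icc hs ht

theorem Reach.split {s m t : ℝ} {x y : Space n} (h : Reach a b s t x y) (hsm : s ≤ m)
    (hmt : m ≤ t) : ∃ z, Reach a b s m x z ∧ Reach a b m t z y := by
  obtain ⟨γ, hγ, rfl, rfl⟩ := h
  exact ⟨γ m, ⟨γ, hγ.mono le_rfl hsm hmt, rfl, rfl⟩, ⟨γ, hγ.mono hsm hmt le_rfl, rfl, rfl⟩⟩

theorem IsCoerciveField.norm_sub_le_of_reach (h : IsCoerciveField a b α β η K) {s t : ℝ}
    (hst : s ≤ t) {x y : Space n} (hr : Reach a b s t x y) : ‖y - x‖ ≤ 2 * β * (t - s) := by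
  obtain ⟨γ, hγ, rfl, rfl⟩ := hr
  simpa [abs_of_nonneg (sub_nonneg.2 hst)] using
    h.norm_path_sub_le hγ (right_mem_Icc.2 hst) (left_mem_Icc.2 hst)

/-- Paths are concatenated. Both pieces are Lipschitz with constant 2β, hence so is the whole, and
the junction time, where the derivative may fail to exist, is a null set. -/
theorem IsCoerciveField.reach_trans (h : IsCoerciveField a b α β η K) {s m t : ℝ} (hsm : s ≤ m)
    (hmt : m ≤ t) {x y z : Space n} (h₁ : Reach a b s m x y) (h₂ : Reach a b m t y z) :
    Reach a b s t x z := by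
  obtain ⟨γ₁, hγ₁, rfl, hm⟩ := h₁
  obtain ⟨γ₂, hγ₂, hm', rfl⟩ := h₂
  set γ : ℝ → Space n := fun r => if r ≤ m then γ₁ r else γ₂ r with hγ
  have e1 : ∀ r, r ≤ m → γ r = γ₁ r := fun r hr => by simp [hγ, hr]
  have e2 : ∀ r, m ≤ r → γ r = γ₂ r := fun r hr => by
    rcases hr.eq_or_lt with rfl | hr
    · simp [hγ, hm, hm']
    · simp [hγ, not_le.2 hr]
  have l1 : ∀ r ∈ Icc s m, ∀ r' ∈ Icc s m, ‖γ r - γ r'‖ ≤ 2 * β * |r - r'| := fun r hr r' hr' => by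
    rw [e1 r hr.2, e1 r' hr'.2]; exact h.norm_path_sub_le hγ₁ hr hr'
  have l2 : ∀ r ∈ Icc m t, ∀ r' ∈ Icc m t, ‖γ r - γ r'‖ ≤ 2 * β * |r - r'| := fun r hr r' hr' => by
    rw [e2 r hr.1, e2 r' hr'.1]; exact h.norm_path_sub_le hγ₂ hr hr'
  refine ⟨γ, ⟨absolutelyContinuousOnInterval_of_norm_sub_le (C := 2 * β) (hsm.trans hmt) ?_, ?_⟩,
    e1 s hsm, e2 t hmt⟩
  · intro r hr r' hr'
    wlog hle : r' ≤ r generalizing r r'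
    · rw [norm_sub_rev, abs_sub_comm]; exact this _ hr' _ hr (le_of_not_ge hle)
    rcases le_total r m with h1 | h1
    · exact l1 r ⟨hr.1, h1⟩ r' ⟨hr'.1, hle.trans h1⟩
    rcases le_total r' m with h2 | h2
    · have A := l2 r ⟨h1, hr.2⟩ m ⟨le_rfl, hmt⟩
      have B := l1 m ⟨hsm, le_rfl⟩ r' ⟨hr'.1, h2⟩
      have := norm_sub_le_norm_sub_add_norm_sub (γ r) (γ m) (γ r')
      rw [abs_of_nonneg (by linarith)] at *
      linarith
    · exact l2 r ⟨h1, hr.2⟩ r' ⟨h2, hr'.2⟩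
  · have A := hγ₁.2
    have B := hγ₂.2
    rw [ae_restrict_iff' measurableSet_Icc] at A B ⊢
    filter_upwards [A, B, (measure_eq_zero_iff_ae_notMem (s := {m})).1 Real.volume_singleton]
      with r hA hB hrm hr
    rcases lt_or_gt_of_ne (show r ≠ m from hrm) with h1 | h1
    · obtain ⟨v, hv, hvb⟩ := hA ⟨hr.1, h1.le⟩
      refine ⟨v, hv.congr_of_eventuallyEq ?_, by rwa [e1 r h1.le]⟩
      filter_upwards [Iio_mem_nhds h1] with q hq using e1 q (le_of_lt hq)
    · obtain ⟨v, hv, hvb⟩ := hB ⟨h1.le, hr.2⟩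
      refine ⟨v, hv.congr_of_eventuallyEq ?_, by rwa [e2 r h1.le]⟩
      filter_upwards [Ioi_mem_nhds h1] with q hq using e2 q (le_of_lt hq)

theorem reach_of_segment {s t : ℝ} (hst : s ≤ t) {x v : Space n}
    (hv : ∀ r ∈ Icc s t, ‖v - b (x + (r - s) • v) r‖ ≤ a (x + (r - s) • v) r) :
    Reach a b s t x (x + (t - s) • v) := by
  refine ⟨fun r => x + (r - s) • v, ⟨absolutelyContinuousOnInterval_of_norm_sub_le (C := ‖v‖) hst
    fun r _ r' _ => ?_, ?_⟩, by simp, rfl⟩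
  · rw [add_sub_add_left_eq_sub, ← sub_smul, norm_smul, Real.norm_eq_abs, mul_comm]
    simp
  · rw [ae_restrict_iff' measurableSet_Icc]
    refine Eventually.of_forall fun r hr => ⟨v, ?_, hv r hr⟩
    simpa using (((hasDerivAt_id r).sub_const s).smul_const v).const_add x

/-- This is where coercivity enters: if |v| ≤ η then |v - b| ≤ η + |b| ≤ α ≤ a everywhere, so slow
segments in any direction are admissible. -/
theorem IsCoerciveField.reach_of_norm_sub_le (h : IsCoerciveField a b α β η K) {s t : ℝ}
    (hst : s ≤ t) {x y : Space n} (hxy : ‖y - x‖ ≤ η * (t - s)) : Reach a b s t x y := by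
  have key : ∀ v : Space n, ‖v‖ ≤ η → Reach a b s t x (x + (t - s) • v) := fun v hv =>
    reach_of_segment hst fun r _ => by
      have h1 := norm_sub_le v (b (x + (r - s) • v) r)
      have := h.small (x + (r - s) • v) r; have := h.lower (x + (r - s) • v) r; linarith
  rcases hst.eq_or_lt with rfl | hlt
  · have : y = x := by
      rw [← sub_eq_zero, ← norm_le_zero_iff]; simpa using hxy
    simpa [this] using key 0 (by simpa using h.eta_pos.le)
  · have hp : 0 < t - s := sub_pos.2 hlt
    have := key ((t - s)⁻¹ • (y - x)) (by
      rw [norm_smul, norm_inv, Real.norm_of_nonneg hp.le, inv_mul_le_iff₀ hp]; linarith)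
    rwa [smul_inv_smul₀ hp.ne', add_sub_cancel] at this

theorem IsCoerciveField.reach_self (h : IsCoerciveField a b α β η K) {s t : ℝ} (hst : s ≤ t)
    (x : Space n) : Reach a b s t x x :=
  h.reach_of_norm_sub_le hst (by simpa using mul_nonneg h.eta_pos.le (sub_nonneg.2 hst))

/-- Space and time are scaled by the same factor, so velocities do not change. Lattice translations,
time shifts and the scaling by ε are all special cases. -/
theorem Reach.comp_affine {s t : ℝ} {x y : Space n} (h : Reach a b s t x y)
    {a' : Space n → ℝ → ℝ} {b' : Space n → ℝ → Space n} {c d : ℝ} {w : Space n} (hc : 0 < c)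
    (hst : s ≤ t)
    (ha : ∀ z r, a' (c • z + w) (c * r + d) = a z r)
    (hb : ∀ z r, b' (c • z + w) (c * r + d) = b z r) :
    Reach a' b' (c * s + d) (c * t + d) (c • x + w) (c • y + w) := by
  obtain ⟨γ, hγ, rfl, rfl⟩ := h
  have inv : ∀ r, c⁻¹ * (c * r + d - d) = r := fun r => by field_simp; ring
  refine ⟨fun r => c • γ (c⁻¹ * (r - d)) + w, ⟨?_, ?_⟩, by simp only [inv], by simp only [inv]⟩
  · have hac := hγ.1
    rw [absolutelyContinuousOnInterval_iff] at hac ⊢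
    intro ε hε
    obtain ⟨δ, hδ, H⟩ := hac (ε / c) (by positivity)
    refine ⟨c * δ, by positivity, fun E hE hEδ => ?_⟩
    have hle : c * s + d ≤ c * t + d := by gcongr
    have hmem : ∀ q, q ∈ uIcc (c * s + d) (c * t + d) → c⁻¹ * (q - d) ∈ uIcc s t := by
      intro q hq
      rw [uIcc_of_le hle] at hq
      rw [uIcc_of_le hst]
      exact ⟨by rw [le_inv_mul_iff₀ hc]; linarith [hq.1], by rw [inv_mul_le_iff₀ hc]; linarith [hq.2]⟩
    have hd : ∀ p q : ℝ, dist (c⁻¹ * (p - d)) (c⁻¹ * (q - d)) = c⁻¹ * dist p q := by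
      intro p q
      rw [Real.dist_eq, Real.dist_eq, ← mul_sub, abs_mul, abs_of_pos (inv_pos.2 hc)]; congr 2; ring
    have := H (E.1, fun i => (c⁻¹ * ((E.2 i).1 - d), c⁻¹ * ((E.2 i).2 - d))) ?_ ?_
    · rw [lt_div_iff₀' hc, Finset.mul_sum] at this
      refine lt_of_eq_of_lt (Finset.sum_congr rfl fun i _ => ?_) this
      rw [dist_add_right, dist_smul₀, Real.norm_of_nonneg hc.le]
    · refine ⟨fun i hi => ⟨hmem _ (hE.1 i hi).1, hmem _ (hE.1 i hi).2⟩, fun i hi j hj hij => ?_⟩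
      have hD := hE.2 hi hj hij
      rw [Function.onFun, Set.disjoint_left] at hD ⊢
      have tr : ∀ p q z : ℝ, z ∈ uIoc (c⁻¹ * (p - d)) (c⁻¹ * (q - d)) → c * z + d ∈ uIoc p q := by
        intro p q z hz
        rw [mem_uIoc] at hz ⊢
        simp only [inv_mul_lt_iff₀ hc, le_inv_mul_iff₀ hc] at hz
        rcases hz with hz | hz
        · left; constructor <;> linarith [hz.1, hz.2]
        · right; constructor <;> linarith [hz.1, hz.2]
      exact fun z hz hz' => hD (tr _ _ z hz) (tr _ _ z hz')
    · simp only [hd]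
      rw [← Finset.mul_sum, inv_mul_lt_iff₀ hc]; exact hEδ
  · have hA := hγ.2
    rw [ae_restrict_iff' measurableSet_Icc] at hA ⊢
    have hq : Measure.QuasiMeasurePreserving (fun r : ℝ => c⁻¹ * (r - d)) volume volume := by
      have h1 : Measure.QuasiMeasurePreserving (fun r : ℝ => c⁻¹ * r) volume volume := by
        refine ⟨by fun_prop, ?_⟩
        rw [Real.map_volume_mul_left (inv_pos.2 hc).ne']
        exact Measure.smul_absolutelyContinuous
      exact h1.comp (measurePreserving_sub_right volume d).quasiMeasurePreserving
    filter_upwards [hq.ae hA] with r hr hrm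
    obtain ⟨v, hv, hvb⟩ := hr ⟨by rw [le_inv_mul_iff₀ hc]; linarith [hrm.1],
      by rw [inv_mul_le_iff₀ hc]; linarith [hrm.2]⟩
    refine ⟨v, ?_, ?_⟩
    · have h1 : HasDerivAt (fun r : ℝ => c⁻¹ * (r - d)) c⁻¹ r := by
        simpa using ((hasDerivAt_id r).sub_const d).const_mul c⁻¹
      have := ((hv.scomp r h1).const_smul c).add_const w
      simpa [smul_smul, hc.ne'] using this
    · have e : r = c * (c⁻¹ * (r - d)) + d := by field_simp; ring
      conv_lhs => rw [e]
      conv_rhs => rw [e]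
      simpa only [inv, ha, hb] using hvb

/-- The Hamiltonian `a(x,t)|p| + b(x,t)·p`. -/
noncomputable def controlHamiltonian (a : Space n → ℝ → ℝ) (b : Space n → ℝ → Space n)
    (x : Space n) (t : ℝ) (p : Space n) : ℝ :=
  a x t * ‖p‖ + inner ℝ (b x t) p

namespace IsCoerciveField

theorem alpha_pos (h : IsCoerciveField a b α β η K) : 0 < α := by
  have := h.small 0 0; have := h.eta_pos; have := norm_nonneg (b 0 0); linarith

theorem a_nonneg (h : IsCoerciveField a b α β η K) (x : Space n) (t : ℝ) : 0 ≤ a x t :=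
  h.alpha_pos.le.trans (h.lower x t)

theorem controlHamiltonian_sub_le (h : IsCoerciveField a b α β η K) (x : Space n) (t : ℝ)
    (p q : Space n) :
    controlHamiltonian a b x t p - controlHamiltonian a b x t q ≤ 2 * β * ‖p - q‖ := by
  have h1 : a x t * ‖p‖ - a x t * ‖q‖ ≤ β * ‖p - q‖ := by
    rw [← mul_sub]
    exact (mul_le_mul_of_nonneg_left (norm_sub_norm_le p q) (h.a_nonneg x t)).trans
      (mul_le_mul_of_nonneg_right (h.upper x t) (norm_nonneg (p - q)))
  have h2 : inner ℝ (b x t) p - inner ℝ (b x t) q ≤ β * ‖p - q‖ := by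
    rw [← inner_sub_right]
    exact (real_inner_le_norm _ _).trans
      (mul_le_mul_of_nonneg_right (h.norm_b_le x t) (norm_nonneg _))
  unfold controlHamiltonian
  linarith

theorem controlHamiltonian_sub_le' (h : IsCoerciveField a b α β η K) (x y : Space n) (t s : ℝ)
    (p : Space n) :
    controlHamiltonian a b x t p - controlHamiltonian a b y s p
      ≤ 2 * K * (‖x - y‖ + |t - s|) * ‖p‖ := by
  have h1 := mul_le_mul_of_nonneg_right ((le_abs_self _).trans (h.lip_a x t y s)) (norm_nonneg p)
  have h2 := mul_le_mul_of_nonneg_right (h.lip_b x t y s) (norm_nonneg p)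
  have h3 := real_inner_le_norm (b x t - b y s) p
  rw [inner_sub_left] at h3
  unfold controlHamiltonian
  linarith

theorem inner_le_controlHamiltonian {x v : Space n} {t : ℝ}
    (hv : ‖v - b x t‖ ≤ a x t) (p : Space n) : inner ℝ p v ≤ controlHamiltonian a b x t p := by
  have h1 := real_inner_le_norm p (v - b x t)
  have h2 := mul_le_mul_of_nonneg_left hv (norm_nonneg p)
  rw [inner_sub_right, real_inner_comm (b x t) p] at h1
  unfold controlHamiltonian
  linarith

/-- The speed in direction `p` of admissible paths that end near `(x,t)` is at most `H(x,t,p)`, up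
to an error. -/
theorem inner_sub_le_of_reach (h : IsCoerciveField a b α β η K) {s t : ℝ} (hst : s ≤ t)
    {x y : Space n} (hr : Reach a b s t y x) (p : Space n) :
    inner ℝ p (x - y) ≤ (t - s) *
      (controlHamiltonian a b x t p + 2 * K * (2 * β + 1) * (t - s) * ‖p‖) := by
  obtain ⟨γ, hγ, rfl, rfl⟩ := hr
  set c := controlHamiltonian a b (γ t) t p + 2 * K * (2 * β + 1) * (t - s) * ‖p‖ with hc
  have h1 := (hγ.1.inner_left p).sub_le_integral hst (c := fun _ => c) intervalIntegrable_const (by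
    have A := hγ.2
    rw [ae_restrict_iff' measurableSet_Icc] at A ⊢
    filter_upwards [A] with r hr hrm
    obtain ⟨v, hv, hvb⟩ := hr hrm
    refine ⟨inner ℝ p v, by simpa using (hasDerivAt_const r p).inner ℝ hv,
      (inner_le_controlHamiltonian hvb p).trans ?_⟩
    have e1 := h.controlHamiltonian_sub_le' (γ r) (γ t) r t p
    have e2 := h.norm_path_sub_le hγ hrm (right_mem_Icc.2 hst)
    have e3 : |r - t| ≤ t - s := by rw [abs_le]; constructor <;> linarith [hrm.1, hrm.2]
    have e4 : ‖γ r - γ t‖ + |r - t| ≤ (2 * β + 1) * (t - s) := by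
      have := mul_le_mul_of_nonneg_left e3 (mul_pos two_pos h.beta_pos).le
      linarith
    have e5 := mul_le_mul_of_nonneg_right (mul_le_mul_of_nonneg_left e4
      (mul_nonneg two_pos.le h.K_nonneg)) (norm_nonneg p)
    have e6 : 2 * K * ((2 * β + 1) * (t - s)) * ‖p‖ = 2 * K * (2 * β + 1) * (t - s) * ‖p‖ := by ring
    rw [hc]
    linarith)
  rw [inner_sub_right]
  simpa using h1

theorem exists_inner_eq_controlHamiltonian (h : IsCoerciveField a b α β η K) (x : Space n)
    (t : ℝ) (p : Space n) :
    ∃ v, ‖v - b x t‖ ≤ a x t ∧ inner ℝ p v = controlHamiltonian a b x t p := by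
  rcases eq_or_ne p 0 with rfl | hp
  · exact ⟨b x t, by simpa using h.a_nonneg x t, by simp [controlHamiltonian]⟩
  · have hp' : ‖p‖ ≠ 0 := norm_ne_zero_iff.2 hp
    refine ⟨b x t + (a x t * ‖p‖⁻¹) • p, ?_, ?_⟩
    · rw [add_sub_cancel_left, norm_smul, norm_mul, norm_inv, norm_norm, mul_assoc,
        inv_mul_cancel₀ hp', mul_one, Real.norm_of_nonneg (h.a_nonneg x t)]
    · rw [inner_add_right, inner_smul_right, real_inner_self_eq_norm_mul_norm, controlHamiltonian,
        real_inner_comm]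
      field_simp
      ring

/-- Almost every velocity admissible at `(x,t)` is that of a straight path ending there. -/
theorem exists_reach_of_segment (h : IsCoerciveField a b α β η K) (x : Space n) (t : ℝ)
    (p : Space n) {θ : ℝ} (hθ : 0 < θ) :
    ∃ v : Space n, controlHamiltonian a b x t p - θ ≤ inner ℝ p v ∧
      ∃ h₀ > 0, ∀ d, 0 ≤ d → d ≤ h₀ → Reach a b (t - d) t (x - d • v) x := by
  obtain ⟨v₀, hv₀, hp⟩ := h.exists_inner_eq_controlHamiltonian x t p
  -- Shrinking the optimal velocity by 1 - μ costs at most θ in the Hamiltonian and leaves slack μη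
  -- at (x,t), since |(1-μ)v₀ - b| ≤ (1-μ)a + μ|b| ≤ a - μη. The slack absorbs the variation of a
  -- and b along a short segment.
  obtain ⟨μ, hμ0, hμ1, hμ⟩ : ∃ μ > 0, μ ≤ 1 ∧ μ * |controlHamiltonian a b x t p| ≤ θ := by
    set c := |controlHamiltonian a b x t p|
    have hc : 0 ≤ c := abs_nonneg _
    refine ⟨min 1 (θ / (c + 1)), by positivity, min_le_left _ _, ?_⟩
    calc min 1 (θ / (c + 1)) * c ≤ θ / (c + 1) * (c + 1) := by
          gcongr
          · exact min_le_right _ _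
          · linarith
      _ = θ := by field_simp
  have hv0n := h.norm_velocity_le hv₀
  refine ⟨(1 - μ) • v₀, ?_, ?_⟩
  · rw [inner_smul_right, hp]
    have := mul_le_mul_of_nonneg_left (le_abs_self (controlHamiltonian a b x t p)) hμ0.le
    linarith
  · have hK := h.K_nonneg
    have hη := h.eta_pos
    have hβ := h.beta_pos
    -- The added 1 keeps the denominator positive when K = 0.
    refine ⟨μ * η / (2 * K * (2 * β + 1) + 1), by positivity, fun d hd hdh => ?_⟩
    have key := reach_of_segment (a := a) (b := b) (s := t - d) (t := t) (by linarith)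
      (x := x - d • ((1 - μ) • v₀)) (v := (1 - μ) • v₀) ?_
    · simpa using key
    · intro r hr
      set z := x - d • ((1 - μ) • v₀) + (r - (t - d)) • ((1 - μ) • v₀) with hz
      have hzx : z - x = (r - t) • ((1 - μ) • v₀) := by rw [hz]; module
      have hrt : |r - t| ≤ d := by rw [abs_le]; constructor <;> linarith [hr.1, hr.2]
      have hw : ‖(1 - μ) • v₀‖ ≤ 2 * β := by
        rw [norm_smul, Real.norm_of_nonneg (by linarith)]
        nlinarith [norm_nonneg v₀]
      have hd1 : ‖z - x‖ + |r - t| ≤ (2 * β + 1) * d := by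
        rw [hzx, norm_smul, Real.norm_eq_abs]
        have := mul_le_mul hrt hw (norm_nonneg _) hd
        linarith
      have hd2 : 2 * (K * (‖z - x‖ + |r - t|)) ≤ μ * η := by
        have := mul_le_mul_of_nonneg_left hd1 hK
        rw [le_div_iff₀ (by positivity)] at hdh
        nlinarith
      have e1 := h.lip_a z r x t
      have e2 := h.lip_b z r x t
      have e3 : ‖(1 - μ) • v₀ - b x t‖ ≤ (1 - μ) * a x t + μ * ‖b x t‖ := by
        have : (1 - μ) • v₀ - b x t = (1 - μ) • (v₀ - b x t) + (-μ) • b x t := by module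
        rw [this]
        refine (norm_add_le _ _).trans ?_
        rw [norm_smul, norm_smul, norm_neg, Real.norm_of_nonneg hμ0.le,
          Real.norm_of_nonneg (by linarith : 0 ≤ 1 - μ)]
        gcongr
      have e4 : ‖(1 - μ) • v₀ - b z r‖ ≤ ‖(1 - μ) • v₀ - b x t‖ + ‖b z r - b x t‖ := by
        have := norm_sub_le_norm_sub_add_norm_sub ((1 - μ) • v₀) (b x t) (b z r)
        rwa [norm_sub_rev (b x t)] at this
      have e5 : ‖b x t‖ ≤ a x t - η := by linarith [h.small x t, h.lower x t]
      have e6 := mul_le_mul_of_nonneg_left e5 hμ0.le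
      have e7 := (abs_le.1 e1).1
      linarith

end IsCoerciveField

end Paths

/-! ### Paths with slack, perturbation of end points, and broken lines. -/

section Perturbation

variable {n : ℕ} {a : Space n → ℝ → ℝ} {b : Space n → ℝ → Space n} {α β η K : ℝ}

theorem IsAdmissiblePath.mono_field {a' : Space n → ℝ → ℝ} {s t : ℝ} {γ : ℝ → Space n}
    (hγ : IsAdmissiblePath a b s t γ) (h : ∀ x r, a x r ≤ a' x r) :
    IsAdmissiblePath a' b s t γ := by
  refine ⟨hγ.1, ?_⟩
  filter_upwards [hγ.2] with r ⟨v, hv, hvb⟩ using ⟨v, hv, hvb.trans (h _ _)⟩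

namespace IsCoerciveField

/-- A Gronwall-type estimate: slowing down an admissible path by a factor `1 - μ(r)`, where `μ` is
an exponential, leaves room in the constraint for moving its end point. -/
theorem exists_slack_path (h : IsCoerciveField a b α β η K) {s t : ℝ} (hst : s ≤ t)
    {γ : ℝ → Space n} (hγ : IsAdmissiblePath a b s t γ) {μ₀ : ℝ} (hμ₀ : 0 < μ₀)
    (hμ₁ : μ₀ * Real.exp (4 * (K + 1) * (2 * β) / η * (t - s)) ≤ 1) {x' : Space n}
    (hx' : ‖x' - γ t‖ ≤ η / (4 * (K + 1)) * μ₀) :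
    ∃ γ' : ℝ → Space n, IsAdmissiblePath (fun x r => a x r - μ₀ * η / 2) b s t γ' ∧ γ' t = x' ∧
      ∀ r ∈ Icc s t, ‖γ' r - γ r‖ ≤
        η / (4 * (K + 1)) * (μ₀ * Real.exp (4 * (K + 1) * (2 * β) / η * (t - s))) := by
  have hK := h.K_nonneg
  have hη := h.eta_pos
  have hβ := h.beta_pos
  set c := 4 * (K + 1) * (2 * β) / η with hc
  have hc0 : 0 < c := by positivity
  set κ := η / (4 * (K + 1)) with hκ
  have hκ0 : 0 < κ := by positivity
  have hκc : 2 * β = κ * c := by rw [hκ, hc]; field_simp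
  -- As μ' = -cμ and κc = 2β, the integral of 2βμ over [r,t] is κ(μ(r) - μ(t)). So the displacement
  -- caused by slowing down and by moving the end point is at most κμ, and its Lipschitz cost 2Kκμ ≤
  -- μη/2 uses no more than half of the slack μη.
  set μ : ℝ → ℝ := fun r => μ₀ * Real.exp (c * (t - r)) with hμ
  have hμd : ∀ r, HasDerivAt μ (-c * μ r) r := fun r => by
    have h1 : HasDerivAt (fun r => c * (t - r)) (c * (-1)) r :=
      ((hasDerivAt_id r).const_sub t).const_mul c
    have := (h1.exp).const_mul μ₀
    exact this.congr_deriv (by simp only [hμ]; ring)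
  have hμc : Continuous μ := continuous_iff_continuousAt.2 fun r => (hμd r).continuousAt
  have hμsmooth : ContDiff ℝ 1 μ := by simp only [hμ]; fun_prop
  have hμpos : ∀ r, 0 < μ r := fun r => by simp only [hμ]; positivity
  have hμt : μ t = μ₀ := by simp [hμ]
  have hμle : ∀ r ∈ Icc s t, μ r ≤ μ s := fun r hr => by
    simp only [hμ]; gcongr; exact hr.1
  have hμge : ∀ r ∈ Icc s t, μ₀ ≤ μ r := fun r hr => by
    rw [← hμt]; simp only [hμ]; gcongr; exact hr.2
  -- The projection onto [s,t] makes the integrand continuous on the whole line, since γ is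
  -- controlled only on [s,t].
  set g : ℝ → Space n := fun r => (-c * μ r) • γ (projIcc s t hst r) with hg
  have hγc : ContinuousOn γ (Icc s t) := by
    have := hγ.1.continuousOn; rwa [uIcc_of_le hst] at this
  have hgc : Continuous g := by
    refine (continuous_const.mul hμc).smul ?_
    exact hγc.comp_continuous (continuous_subtype_val.comp continuous_projIcc) fun r => by
      exact (projIcc s t hst r).2
  set J : ℝ → Space n := fun r => ∫ q in s..r, g q with hJ
  have hJd : ∀ r, HasDerivAt J (g r) r := fun r =>
    (hgc.integral_hasStrictDerivAt s r).hasDerivAt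
  have hJs : ContDiff ℝ 1 J := by
    rw [contDiff_one_iff_deriv]
    refine ⟨fun r => (hJd r).differentiableAt, ?_⟩
    rwa [show deriv J = g from funext fun r => (hJd r).deriv]
  -- Integration by parts: J' = μ'γ, so f' = -μγ' almost everywhere and γ + f moves with velocity
  -- (1-μ)γ'. The constant is chosen so that γ + f ends at x'.
  set f : ℝ → Space n := fun r => J r - μ r • γ r + (x' - γ t - J t + μ t • γ t) with hf
  have hfac : AbsolutelyContinuousOnInterval f s t := by
    have h1 : AbsolutelyContinuousOnInterval (fun r => J r - μ r • γ r) s t :=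
      (hJs.contDiffOn.absolutelyContinuousOnInterval).fun_sub
        ((hμsmooth.contDiffOn.absolutelyContinuousOnInterval).fun_smul hγ.1)
    exact h1.of_dist_le (C := 1) fun r r' => by simp [hf]
  have hft : f t = x' - γ t := by simp only [hf]; abel
  have hfd : ∀ᵐ r ∂(volume.restrict (Icc s t)), ∃ v, HasDerivAt γ v r ∧
      ‖v - b (γ r) r‖ ≤ a (γ r) r ∧ HasDerivAt f (-(μ r • v)) r := by
    have A := hγ.2
    rw [ae_restrict_iff' measurableSet_Icc] at A ⊢
    filter_upwards [A] with r hr hrm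
    obtain ⟨v, hv, hvb⟩ := hr hrm
    refine ⟨v, hv, hvb, ?_⟩
    have := ((hJd r).sub ((hμd r).smul hv)).add_const (x' - γ t - J t + μ t • γ t)
    refine HasDerivAt.congr_deriv (f := f) this ?_
    simp only [hg, projIcc_of_mem hst hrm]
    module
  have hfb : ∀ r ∈ Icc s t, ‖f r‖ ≤ κ * μ r := by
    intro r hr
    have hsub : Icc r t ⊆ Icc s t := Icc_subset_Icc hr.1 le_rfl
    have h1 := (hfac.mono (c := r) (d := t) (by
      rw [uIcc_of_le hr.2, uIcc_of_le hst]; exact hsub)).norm_sub_le_integral hr.2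
      (c := fun q => 2 * β * μ q) ((continuous_const.mul hμc).intervalIntegrable _ _) 0 (by
        filter_upwards [ae_restrict_of_ae_restrict_of_subset hsub hfd] with q ⟨v, _, hvb, hfv⟩
        refine ⟨_, hfv, ?_⟩
        rw [sub_zero, norm_neg, norm_smul, Real.norm_of_nonneg (hμpos q).le, mul_comm]
        exact mul_le_mul_of_nonneg_right (h.norm_velocity_le hvb) (hμpos q).le)
    have h2 : ∫ q in r..t, 2 * β * μ q = κ * μ r - κ * μ t := by
      rw [intervalIntegral.integral_eq_sub_of_hasDerivAt (f := fun q => -(κ * μ q))]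
      · ring
      · intro q _
        exact ((hμd q).const_mul κ).neg.congr_deriv (by rw [hκc]; ring)
      · exact (continuous_const.mul hμc).intervalIntegrable _ _
    rw [h2, smul_zero, sub_zero, hft, hμt] at h1
    have h3 := norm_le_norm_add_norm_sub (x' - γ t) (f r)
    linarith
  refine ⟨fun r => γ r + f r, ⟨hγ.1.fun_add hfac, ?_⟩, by simp [hft], fun r hr => ?_⟩
  · rw [ae_restrict_iff' measurableSet_Icc] at hfd ⊢
    filter_upwards [hfd] with r hr hrm
    obtain ⟨v, hv, hvb, hfv⟩ := hr hrm
    refine ⟨_, hv.add hfv, ?_⟩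
    have hm1 : μ r ≤ 1 := (hμle r hrm).trans hμ₁
    have e1 := h.lip_a (γ r + f r) r (γ r) r
    have e2 := h.lip_b (γ r + f r) r (γ r) r
    simp only [add_sub_cancel_left, sub_self, abs_zero, add_zero] at e1 e2
    have e3 : ‖v + -(μ r • v) - b (γ r + f r) r‖ ≤
        (1 - μ r) * ‖v - b (γ r) r‖ + μ r * ‖b (γ r) r‖ + ‖b (γ r + f r) r - b (γ r) r‖ := by
      have : v + -(μ r • v) - b (γ r + f r) r = (1 - μ r) • (v - b (γ r) r)
          + (-μ r) • b (γ r) r - (b (γ r + f r) r - b (γ r) r) := by module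
      rw [this]
      refine (norm_sub_le _ _).trans (add_le_add ((norm_add_le _ _).trans ?_) le_rfl)
      rw [norm_smul, norm_smul, norm_neg, Real.norm_of_nonneg (hμpos r).le,
        Real.norm_of_nonneg (by linarith : 0 ≤ 1 - μ r)]
    have e4 := mul_le_mul_of_nonneg_left hvb (by linarith : 0 ≤ 1 - μ r)
    have e5 : ‖b (γ r) r‖ ≤ a (γ r) r - η := by linarith [h.small (γ r) r, h.lower (γ r) r]
    have e6 := mul_le_mul_of_nonneg_left e5 (hμpos r).le
    have e7 := (abs_le.1 e1).1
    have e8 : 2 * (K * ‖f r‖) ≤ μ r * η / 2 := by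
      have h1 := mul_le_mul_of_nonneg_left (hfb r hrm) hK
      have h2 : K * (κ * μ r) ≤ (K + 1) * (κ * μ r) := by
        have := mul_pos hκ0 (hμpos r); nlinarith
      have h3 : (K + 1) * (κ * μ r) = μ r * η / 4 := by rw [hκ]; field_simp
      linarith
    have e9 := mul_le_mul_of_nonneg_right (hμge r hrm) hη.le
    linarith
  · rw [add_sub_cancel_left]
    exact (hfb r hr).trans (mul_le_mul_of_nonneg_left (hμle r hr) hκ0.le)

/-- Moving the end point of an admissible path, by moving its starting point. -/
theorem exists_reach_of_norm_sub_le (h : IsCoerciveField a b α β η K) (T : ℝ) {δ : ℝ}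
    (hδ : 0 < δ) : ∃ ρ > 0, ∀ s t, s ≤ t → t - s ≤ T → ∀ x y x' : Space n, Reach a b s t y x →
      ‖x' - x‖ ≤ ρ → ∃ y', ‖y' - y‖ ≤ δ ∧ Reach a b s t y' x' := by
  have hK := h.K_nonneg
  have hη := h.eta_pos
  have hβ := h.beta_pos
  set c := 4 * (K + 1) * (2 * β) / η with hc
  have hc0 : 0 < c := by positivity
  set κ := η / (4 * (K + 1)) with hκ
  have hκ0 : 0 < κ := by positivity
  -- The exponential offsets the growth of μ over a time at most T, so that μ ≤ 1 and κμ ≤ δ on the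
  -- whole interval.
  set μ₀ := min 1 (δ / κ) * Real.exp (-(c * T)) with hμ
  have hμ0 : 0 < μ₀ := by positivity
  refine ⟨κ * μ₀, by positivity, fun s t hst htT x y x' hr hx => ?_⟩
  obtain ⟨γ, hγ, rfl, rfl⟩ := hr
  have h1 : μ₀ * Real.exp (c * (t - s)) ≤ min 1 (δ / κ) := by
    rw [hμ, mul_assoc, ← Real.exp_add]
    refine mul_le_of_le_one_right (by positivity) (Real.exp_le_one_iff.2 ?_)
    have := mul_le_mul_of_nonneg_left htT hc0.le
    linarith
  obtain ⟨γ', hγ', hx', hd⟩ := h.exists_slack_path hst hγ hμ0 (h1.trans (min_le_left _ _)) hx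
  refine ⟨γ' s, ?_, γ', hγ'.mono_field fun x r => ?_, rfl, hx'⟩
  · refine (hd s (left_mem_Icc.2 hst)).trans ?_
    calc κ * (μ₀ * Real.exp (c * (t - s))) ≤ κ * (δ / κ) := by
          gcongr; exact h1.trans (min_le_right _ _)
      _ = δ := by field_simp
  · have := mul_pos hμ0 hη; linarith

end IsCoerciveField

/-- The segment from `x` to `y`, traversed during `[s,t]` with constant velocity, obeys the
constraint. -/
def IsAdmissibleSegment (a : Space n → ℝ → ℝ) (b : Space n → ℝ → Space n) (s t : ℝ)
    (x y : Space n) : Prop :=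
  ∀ r ∈ Icc s t, ‖(t - s)⁻¹ • (y - x) - b (x + (r - s) • (t - s)⁻¹ • (y - x)) r‖ ≤
    a (x + (r - s) • (t - s)⁻¹ • (y - x)) r

theorem IsAdmissibleSegment.reach {s t : ℝ} (hst : s < t) {x y : Space n}
    (h : IsAdmissibleSegment a b s t x y) : Reach a b s t x y := by
  have := reach_of_segment hst.le h
  rwa [smul_inv_smul₀ (sub_pos.2 hst).ne', add_sub_cancel] at this

/-- A short chord between points close to a path with slack `σ` is admissible. -/
theorem IsCoerciveField.isAdmissibleSegment (h : IsCoerciveField a b α β η K) {s t σ δ : ℝ}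
    (hst : s < t) {γ : ℝ → Space n}
    (hγ : IsAdmissiblePath (fun x r => a x r - σ) b s t γ) (hσ : 0 < σ)
    (hts : 2 * K * (4 * β + 4) * (t - s) ≤ σ / 2) (hδ : δ ≤ t - s) (hδσ : δ ≤ (t - s) * (σ / 4))
    {x y : Space n} (hx : ‖x - γ s‖ ≤ δ) (hy : ‖y - γ t‖ ≤ δ) :
    IsAdmissibleSegment a b s t x y := by
  intro r hr
  have hK := h.K_nonneg
  have hβ := h.beta_pos
  have hd : 0 < t - s := sub_pos.2 hst
  have hγ0 : IsAdmissiblePath a b s t γ := hγ.mono_field fun x r => by linarith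
  set v := (t - s)⁻¹ • (y - x) with hv
  have hdv : (t - s) • v = y - x := by rw [hv, smul_inv_smul₀ hd.ne']
  have hnv : ‖y - x‖ = (t - s) * ‖v‖ := by rw [← hdv, norm_smul, Real.norm_of_nonneg hd.le]
  have hyx : ‖y - x‖ ≤ 2 * β * (t - s) + 2 * δ := by
    have h1 := h.norm_path_sub_le hγ0 (right_mem_Icc.2 hst.le) (left_mem_Icc.2 hst.le)
    rw [abs_of_pos hd] at h1
    have : y - x = (y - γ t) + (γ t - γ s) - (x - γ s) := by abel
    rw [this]
    have h2 := norm_sub_le ((y - γ t) + (γ t - γ s)) (x - γ s)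
    have h3 := norm_add_le (y - γ t) (γ t - γ s)
    linarith
  set z := x + (r - s) • v with hz
  have hzx : ‖z - x‖ ≤ 2 * β * (t - s) + 2 * δ := by
    rw [hz, add_sub_cancel_left, norm_smul, Real.norm_of_nonneg (sub_nonneg.2 hr.1)]
    refine le_trans ?_ hyx
    rw [hnv]
    exact mul_le_mul_of_nonneg_right (by linarith [hr.2]) (norm_nonneg _)
  set A := a z r with hA
  set B := b z r with hB
  -- The chord velocity is nearly the mean of γ', and the constraint with coefficients frozen at
  -- (z,r) is a ball, hence stable under averaging. Half of σ pays for freezing the coefficients,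
  -- the other half for the end point errors 2δ.
  have h1 := hγ.1.norm_sub_le_integral hst.le
    (c := fun _ => A - σ + 2 * K * (4 * β + 4) * (t - s)) intervalIntegrable_const B (by
      have H := hγ.2
      rw [ae_restrict_iff' measurableSet_Icc] at H ⊢
      filter_upwards [H] with q hq hqm
      obtain ⟨w, hw, hwb⟩ := hq hqm
      refine ⟨w, hw, ?_⟩
      have e1 := h.lip_a (γ q) q z r
      have e2 := h.lip_b (γ q) q z r
      have e3 := norm_sub_le_norm_sub_add_norm_sub w (b (γ q) q) B
      have e4 : ‖γ q - z‖ ≤ 2 * (2 * β * (t - s)) + 3 * δ := by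
        have f1 := h.norm_path_sub_le hγ0 hqm (left_mem_Icc.2 hst.le)
        have f2 : |q - s| ≤ t - s := by rw [abs_le]; constructor <;> linarith [hqm.1, hqm.2]
        have f3 := mul_le_mul_of_nonneg_left f2 (mul_pos two_pos hβ).le
        have : γ q - z = (γ q - γ s) - (x - γ s) - (z - x) := by abel
        rw [this]
        have f4 := norm_sub_le ((γ q - γ s) - (x - γ s)) (z - x)
        have f5 := norm_sub_le (γ q - γ s) (x - γ s)
        linarith
      have e5 : |q - r| ≤ t - s := by
        rw [abs_le]; constructor <;> linarith [hqm.1, hqm.2, hr.1, hr.2]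
      have e6 : ‖γ q - z‖ + |q - r| ≤ (4 * β + 4) * (t - s) := by linarith
      have e7 := mul_le_mul_of_nonneg_left e6 hK
      have e8 := (le_abs_self _).trans e1
      linarith)
  rw [intervalIntegral.integral_const, smul_eq_mul] at h1
  have h2 : (t - s) * ‖v - B‖ ≤ (t - s) * A := by
    have e : (t - s) * ‖v - B‖ = ‖(t - s) • v - (t - s) • B‖ := by
      rw [← smul_sub, norm_smul, Real.norm_of_nonneg hd.le]
    have e' : (t - s) • v - (t - s) • B =
        (γ t - γ s - (t - s) • B) + (y - γ t) - (x - γ s) := by rw [hdv]; abel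
    rw [e, e']
    have f1 := norm_sub_le ((γ t - γ s - (t - s) • B) + (y - γ t)) (x - γ s)
    have f2 := norm_add_le (γ t - γ s - (t - s) • B) (y - γ t)
    have f3 := mul_le_mul_of_nonneg_left hts hd.le
    linarith
  exact le_of_mul_le_mul_left h2 hd

/-- Only countably many broken lines are needed to decide how far one can get in direction `p`. -/
theorem IsCoerciveField.exists_reach_lt_inner_iff (h : IsCoerciveField a b α β η K) {T : ℝ}
    (hT : 0 < T) (p : Space n) (c : ℝ) :
    (∃ x y, Reach a b 0 T x y ∧ c < inner ℝ p (y - x)) ↔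
      ∃ (M : ℕ) (z : Fin (M + 1) → ℕ),
        (0 < M ∧ c < inner ℝ p (TopologicalSpace.denseSeq (Space n) (z (Fin.last M))
          - TopologicalSpace.denseSeq (Space n) (z 0))) ∧
        ∀ i : Fin M, IsAdmissibleSegment a b (i * (T / M)) ((i + 1) * (T / M))
          (TopologicalSpace.denseSeq (Space n) (z i.castSucc))
          (TopologicalSpace.denseSeq (Space n) (z i.succ)) := by
  constructor
  · rintro ⟨x, y, ⟨γ, hγ, rfl, rfl⟩, hc⟩
    have hK := h.K_nonneg
    have hη := h.eta_pos
    have hβ := h.beta_pos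
    -- The factor 4 counts two end points, each moved once to the slack path and once more to the
    -- dense sequence.
    obtain ⟨δ₀, hδ₀, hδc⟩ : ∃ δ₀ > 0, c < inner ℝ p (γ T - γ 0) - ‖p‖ * (4 * δ₀) := by
      refine ⟨(inner ℝ p (γ T - γ 0) - c) / (4 * (‖p‖ + 1)), by
        have := norm_nonneg p; have := sub_pos.2 hc; positivity, ?_⟩
      have hp := norm_nonneg p
      have : ‖p‖ * (4 * ((inner ℝ p (γ T - γ 0) - c) / (4 * (‖p‖ + 1)))) <
          inner ℝ p (γ T - γ 0) - c := by
        have e : ‖p‖ * (4 * ((inner ℝ p (γ T - γ 0) - c) / (4 * (‖p‖ + 1)))) =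
          (‖p‖ / (‖p‖ + 1)) * (inner ℝ p (γ T - γ 0) - c) := by field_simp
        rw [e]
        refine mul_lt_of_lt_one_left (sub_pos.2 hc) ?_
        rw [div_lt_one (by positivity)]; linarith
      linarith
    set c' := 4 * (K + 1) * (2 * β) / η with hc'
    set κ := η / (4 * (K + 1)) with hκ
    have hκ0 : 0 < κ := by positivity
    set μ₀ := min 1 (δ₀ / κ) * Real.exp (-(c' * T)) with hμ
    have hμ0 : 0 < μ₀ := by positivity
    have h1 : μ₀ * Real.exp (c' * (T - 0)) = min 1 (δ₀ / κ) := by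
      rw [hμ, mul_assoc, ← Real.exp_add]; simp
    -- The end point stays where it is; only the slack is wanted.
    obtain ⟨γ', hγ', hx', hd⟩ := h.exists_slack_path hT.le hγ hμ0
      (h1.le.trans (min_le_left _ _)) (x' := γ T) (by simp; positivity)
    have hd' : ∀ r ∈ Icc 0 T, ‖γ' r - γ r‖ ≤ δ₀ := fun r hr => by
      refine (hd r hr).trans ?_
      rw [h1]
      calc κ * min 1 (δ₀ / κ) ≤ κ * (δ₀ / κ) := by gcongr; exact min_le_right _ _
        _ = δ₀ := by field_simp
    set σ := μ₀ * η / 2 with hσ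
    have hσ0 : 0 < σ := by positivity
    obtain ⟨M, hM⟩ := exists_nat_gt (2 * K * (4 * β + 4) * T / (σ / 2))
    have hM0 : 0 < M := by
      have : (0 : ℝ) < M := lt_of_le_of_lt (by positivity) hM
      exact_mod_cast this
    have hMr : (0 : ℝ) < M := by exact_mod_cast hM0
    set d := T / M with hdd
    have hd0 : 0 < d := by positivity
    have hdM : M * d = T := by rw [hdd]; field_simp
    set δ := min δ₀ (min d (d * (σ / 4))) with hδ
    have hδ0 : 0 < δ := by positivity
    have hz : ∀ i : Fin (M + 1), ∃ k, ‖TopologicalSpace.denseSeq (Space n) k - γ' (i * d)‖ ≤ δ := by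
      intro i
      obtain ⟨_, hk, k, rfl⟩ := Metric.dense_iff.1
        (TopologicalSpace.denseRange_denseSeq (Space n)) (γ' (i * d)) δ hδ0
      exact ⟨k, by rw [← dist_eq_norm]; exact (Metric.mem_ball.1 hk).le⟩
    choose z hz using hz
    refine ⟨M, z, ⟨hM0, ?_⟩, fun i => ?_⟩
    · have e1 := hz (Fin.last M)
      have e2 := hz 0
      have e3 := hd' T (right_mem_Icc.2 hT.le)
      have e4 := hd' 0 (left_mem_Icc.2 hT.le)
      rw [Fin.val_last, hdM] at e1
      simp only [Fin.val_zero, Nat.cast_zero, zero_mul] at e2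
      set u := TopologicalSpace.denseSeq (Space n) (z (Fin.last M))
      set w := TopologicalSpace.denseSeq (Space n) (z 0)
      have e5 : ‖(γ T - γ 0) - (u - w)‖ ≤ 4 * δ₀ := by
        have : (γ T - γ 0) - (u - w) = (w - γ' 0) + (γ' 0 - γ 0) - (u - γ' T) - (γ' T - γ T) := by
          abel
        rw [this]
        have f1 := norm_sub_le ((w - γ' 0) + (γ' 0 - γ 0) - (u - γ' T)) (γ' T - γ T)
        have f2 := norm_sub_le ((w - γ' 0) + (γ' 0 - γ 0)) (u - γ' T)
        have f3 := norm_add_le (w - γ' 0) (γ' 0 - γ 0)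
        have f4 : δ ≤ δ₀ := min_le_left _ _
        linarith
      have e6 := real_inner_le_norm p ((γ T - γ 0) - (u - w))
      rw [inner_sub_right] at e6
      have e7 := mul_le_mul_of_nonneg_left e5 (norm_nonneg p)
      linarith
    · have hi : (i : ℝ) + 1 ≤ M := by exact_mod_cast i.2
      have ei : ((i : ℝ) + 1) * d - i * d = d := by ring
      have hlt : (i : ℝ) * d < (i + 1) * d := by linarith
      refine h.isAdmissibleSegment hlt (hγ'.mono (by positivity) hlt.le (by
        rw [← hdM]; gcongr)) hσ0 ?_ (δ := δ) ?_ ?_ ?_ ?_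
      · rw [ei, hdd, mul_div_assoc', div_le_iff₀ hMr]
        rw [div_lt_iff₀ (by positivity)] at hM
        linarith
      · rw [ei]; exact (min_le_right _ _).trans (min_le_left _ _)
      · rw [ei]; exact (min_le_right _ _).trans (min_le_right _ _)
      · exact hz i.castSucc
      · have := hz i.succ
        rwa [Fin.val_succ, Nat.cast_add, Nat.cast_one] at this
  · rintro ⟨M, z, ⟨hM0, hc⟩, hz⟩
    have hMr : (0 : ℝ) < M := by exact_mod_cast hM0
    refine ⟨_, _, ?_, hc⟩
    have key : ∀ k : ℕ, (hk : k < M + 1) → Reach a b 0 (k * (T / M))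
        (TopologicalSpace.denseSeq (Space n) (z 0))
        (TopologicalSpace.denseSeq (Space n) (z ⟨k, hk⟩)) := by
      intro k
      induction k with
      | zero => intro hk; simpa using h.reach_self le_rfl _
      | succ k ih =>
        intro hk
        have h1 := ih (by omega)
        have hlt : (k : ℝ) * (T / M) < (k + 1) * (T / M) := by
          have : 0 < T / M := by positivity
          linarith
        have h2 := (hz ⟨k, by omega⟩).reach hlt
        rw [Nat.cast_add, Nat.cast_one]
        exact h.reach_trans (by positivity) hlt.le h1 h2
    have := key M (by omega)
    rwa [mul_div_cancel₀ _ hMr.ne'] at this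

/-- By continuity the constraint is a closed condition on the time, so it need only be tested at a
countable dense set of times, projected onto [s,t]. -/
theorem measurableSet_isAdmissibleSegment {Ω : Type*} [MeasurableSpace Ω]
    {a : Space n → ℝ → Ω → ℝ} {b : Space n → ℝ → Ω → Space n}
    (ha : ∀ x t, Measurable (a x t)) (hb : ∀ x t, Measurable (b x t))
    (hac : ∀ ω, Continuous fun z : Space n × ℝ => a z.1 z.2 ω)
    (hbc : ∀ ω, Continuous fun z : Space n × ℝ => b z.1 z.2 ω) {s t : ℝ} (hst : s ≤ t)
    (x y : Space n) :
    MeasurableSet {ω | IsAdmissibleSegment (fun x r => a x r ω) (fun x r => b x r ω) s t x y} := by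
  set v := (t - s)⁻¹ • (y - x) with hv
  have : {ω | IsAdmissibleSegment (fun x r => a x r ω) (fun x r => b x r ω) s t x y} =
      ⋂ k : ℕ, {ω | ‖v - b (x + ((projIcc s t hst (TopologicalSpace.denseSeq ℝ k) : ℝ) - s) • v)
          (projIcc s t hst (TopologicalSpace.denseSeq ℝ k)) ω‖ ≤
        a (x + ((projIcc s t hst (TopologicalSpace.denseSeq ℝ k) : ℝ) - s) • v)
          (projIcc s t hst (TopologicalSpace.denseSeq ℝ k)) ω} := by
    ext ω
    simp only [mem_iInter, mem_ofPred_eq]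
    refine ⟨fun H k => H _ (projIcc s t hst _).2, fun H r hr => ?_⟩
    have hcl : IsClosed {q : ℝ | ‖v - b (x + ((projIcc s t hst q : ℝ) - s) • v)
          (projIcc s t hst q) ω‖ ≤
        a (x + ((projIcc s t hst q : ℝ) - s) • v) (projIcc s t hst q) ω} := by
      have hp : Continuous fun q : ℝ => ((x + ((projIcc s t hst q : ℝ) - s) • v,
          (projIcc s t hst q : ℝ)) : Space n × ℝ) := by fun_prop
      exact isClosed_le (continuous_const.sub ((hbc ω).comp hp)).norm ((hac ω).comp hp)
    have := closure_minimal (s := range (TopologicalSpace.denseSeq ℝ))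
      (by rintro _ ⟨k, rfl⟩; exact H k) hcl
      (TopologicalSpace.denseRange_denseSeq ℝ r)
    simpa only [mem_ofPred_eq, projIcc_of_mem hst hr] using this
  rw [this]
  exact MeasurableSet.iInter fun k => measurableSet_le (measurable_const.sub (hb _ _)).norm (ha _ _)

end Perturbation

/-! ### Birkhoff's ergodic theorem for bounded functions. -/

section Birkhoff

variable {Ω : Type*} {T : Ω → Ω} {f : Ω → ℝ}

theorem abs_birkhoffSum_le {C : ℝ} (hC : ∀ ω, |f ω| ≤ C) (k : ℕ) (ω : Ω) :
    |birkhoffSum T f k ω| ≤ k * C := by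
  unfold birkhoffSum
  refine (Finset.abs_sum_le_sum_abs _ _).trans ?_
  simpa using Finset.sum_le_sum fun i (_ : i ∈ Finset.range k) => hC (T^[i] ω)

theorem birkhoffSum_sub_const (c : ℝ) (k : ℕ) (ω : Ω) :
    birkhoffSum T (fun ω => f ω - c) k ω = birkhoffSum T f k ω - k * c := by
  simp [birkhoffSum, Finset.sum_sub_distrib]

variable [MeasurableSpace Ω] {P : Measure Ω}

theorem measurable_birkhoffSum (hT : Measurable T) (hf : Measurable f) (k : ℕ) :
    Measurable (birkhoffSum T f k) := by
  unfold birkhoffSum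
  exact Finset.measurable_fun_sum _ fun i _ => hf.comp (hT.iterate i)

theorem integrable_of_abs_le [IsProbabilityMeasure P] (hf : Measurable f) {C : ℝ}
    (hC : ∀ ω, |f ω| ≤ C) : Integrable f P :=
  Integrable.of_bound hf.aestronglyMeasurable C (Eventually.of_forall hC)

/-- The maximal ergodic inequality. -/
theorem setIntegral_nonneg_of_maximal [IsProbabilityMeasure P] (hT : MeasurePreserving T P P)
    (hf : Measurable f) {C : ℝ} (hC : ∀ ω, |f ω| ≤ C) (N : ℕ) :
    0 ≤ ∫ ω in {ω | ∃ k ≤ N, 0 < birkhoffSum T f k ω}, f ω ∂P := by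
  set A := {ω | ∃ k ≤ N, 0 < birkhoffSum T f k ω} with hA
  have hAm : MeasurableSet A := by
    have : A = ⋃ k : ℕ, ⋃ _ : k ≤ N, {ω | 0 < birkhoffSum T f k ω} := by
      ext ω; simp [hA]
    rw [this]
    exact MeasurableSet.iUnion fun k => MeasurableSet.iUnion fun _ =>
      measurableSet_lt measurable_const (measurable_birkhoffSum hT.measurable hf k)
  have hne : (Finset.range (N + 1)).Nonempty := ⟨0, by simp⟩
  set M : Ω → ℝ := fun ω => (Finset.range (N + 1)).sup' hne fun k => birkhoffSum T f k ω with hM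
  have hle : ∀ k ≤ N, ∀ ω, birkhoffSum T f k ω ≤ M ω := fun k hk ω =>
    Finset.le_sup' (fun k => birkhoffSum T f k ω) (Finset.mem_range.2 (Nat.lt_succ_of_le hk))
  have hex : ∀ ω, ∃ k ≤ N, M ω = birkhoffSum T f k ω := fun ω => by
    obtain ⟨k, hk, hk'⟩ := Finset.exists_mem_eq_sup' hne fun k => birkhoffSum T f k ω
    exact ⟨k, Nat.lt_succ_iff.1 (Finset.mem_range.1 hk), hk'⟩
  have hM0 : ∀ ω, 0 ≤ M ω := fun ω => by simpa using hle 0 (Nat.zero_le N) ω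
  have hMm : Measurable M := by
    have := Finset.measurable_sup' hne fun k (_ : k ∈ Finset.range (N + 1)) =>
      measurable_birkhoffSum hT.measurable hf k
    convert this using 1
    ext ω
    simp [hM, Finset.sup'_apply]
  have hC0 : ∀ ω : Ω, 0 ≤ C := fun ω => (abs_nonneg _).trans (hC ω)
  have hMb : ∀ ω, |M ω| ≤ N * C := fun ω => by
    obtain ⟨k, hk, h⟩ := hex ω
    rw [h]
    refine (abs_birkhoffSum_le hC k ω).trans ?_
    have := hC0 ω
    gcongr
  have hMi : Integrable M P := integrable_of_abs_le hMm hMb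
  have hMTi : Integrable (fun ω => M (T ω)) P :=
    integrable_of_abs_le (hMm.comp hT.measurable) fun ω => hMb (T ω)
  -- On A the maximum M is positive, hence attained at some k + 1, and S_{k+1} = f + S_k ∘ T ≤ f + M
  -- ∘ T. Off A one has M = 0 ≤ M ∘ T. In the integral M and M ∘ T cancel.
  have key : ∀ ω, M ω - M (T ω) ≤ A.indicator f ω := by
    intro ω
    by_cases hω : ω ∈ A
    · rw [indicator_of_mem hω]
      obtain ⟨k, hk, h⟩ := hex ω
      obtain ⟨j, hj, hj'⟩ := hω
      have hpos : 0 < birkhoffSum T f k ω := h ▸ hj'.trans_le (hle j hj ω)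
      cases k with
      | zero => simp at hpos
      | succ k =>
        rw [h, birkhoffSum_succ']
        have := hle k (by omega) (T ω)
        linarith
    · rw [indicator_of_notMem hω]
      obtain ⟨k, hk, h⟩ := hex ω
      have : M ω ≤ 0 := by
        rw [h]; by_contra hcon; exact hω ⟨k, hk, not_le.1 hcon⟩
      have := hM0 (T ω)
      linarith
  have hint := integral_mono (hMi.sub hMTi)
    ((integrable_of_abs_le hf hC).indicator hAm) key
  simp only [Pi.sub_apply] at hint
  rw [integral_indicator hAm, integral_sub hMi hMTi] at hint
  have : ∫ ω, M (T ω) ∂P = ∫ ω, M ω ∂P := by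
    have := integral_map (μ := P) (φ := T) hT.measurable.aemeasurable
      (f := M) (by rw [hT.map_eq]; exact hMm.aestronglyMeasurable)
    rw [hT.map_eq] at this
    exact this.symm
  linarith

/-- The sets in the maximal inequality increase with N to a set of full measure. -/
theorem integral_nonneg_of_exists_birkhoffSum_pos [IsProbabilityMeasure P]
    (hT : MeasurePreserving T P P) (hf : Measurable f) {C : ℝ} (hC : ∀ ω, |f ω| ≤ C)
    (hpos : ∀ᵐ ω ∂P, ∃ k, 0 < birkhoffSum T f k ω) : 0 ≤ ∫ ω, f ω ∂P := by
  have hm : ∀ k, MeasurableSet {ω | 0 < birkhoffSum T f k ω} := fun k =>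
    measurableSet_lt measurable_const (measurable_birkhoffSum hT.measurable hf k)
  have hlim := tendsto_setIntegral_of_monotone (μ := P) (f := f)
    (s := fun N : ℕ => {ω | ∃ k ≤ N, 0 < birkhoffSum T f k ω}) (fun N => by
      have : {ω | ∃ k ≤ N, 0 < birkhoffSum T f k ω} =
          ⋃ k : ℕ, ⋃ _ : k ≤ N, {ω | 0 < birkhoffSum T f k ω} := by ext ω; simp
      rw [this]
      exact MeasurableSet.iUnion fun k => MeasurableSet.iUnion fun _ => hm k)
    (fun N N' hN ω ⟨k, hk, h⟩ => ⟨k, hk.trans hN, h⟩)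
    (integrable_of_abs_le hf hC).integrableOn
  have huniv : ∫ ω in ⋃ N : ℕ, {ω | ∃ k ≤ N, 0 < birkhoffSum T f k ω}, f ω ∂P = ∫ ω, f ω ∂P := by
    conv_rhs => rw [← setIntegral_univ]
    refine setIntegral_congr_set ?_
    rw [eventuallyEq_univ]
    filter_upwards [hpos] with ω ⟨k, hk⟩
    exact mem_iUnion.2 ⟨k, k, le_rfl, hk⟩
  rw [huniv] at hlim
  exact ge_of_tendsto' hlim fun N => setIntegral_nonneg_of_maximal hT hf hC N

/-- The event that limsup S_k/k ≥ c is invariant. If it had probability one, then for q between ∫ f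
and c the function f - q would almost surely have a positive Birkhoff sum, and the maximal
inequality would give ∫ f ≥ q. -/
theorem ae_eventually_birkhoffSum_le [IsProbabilityMeasure P] (hT : Ergodic T P)
    (hf : Measurable f) {C : ℝ} (hC : ∀ ω, |f ω| ≤ C) {c : ℝ} (hc : ∫ ω, f ω ∂P < c) :
    ∀ᵐ ω ∂P, ∀ᶠ k : ℕ in atTop, birkhoffSum T f k ω ≤ c * k := by
  -- Rational thresholds keep G measurable. Passing from q to a larger q' < c absorbs the one term
  -- by which the sums at ω and T ω differ, so G is strictly invariant.
  set G := {ω | ∀ q : ℚ, (q : ℝ) < c → ∃ᶠ k : ℕ in atTop, (q : ℝ) * k < birkhoffSum T f k ω}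
    with hG
  have hGm : MeasurableSet G := by
    have : G = ⋂ q : ℚ, ⋂ _ : (q : ℝ) < c, ⋂ N : ℕ, ⋃ k : ℕ, ⋃ _ : N ≤ k,
        {ω | (q : ℝ) * k < birkhoffSum T f k ω} := by
      ext ω; simp [hG, frequently_atTop]
    rw [this]
    exact MeasurableSet.iInter fun q => MeasurableSet.iInter fun _ => MeasurableSet.iInter fun N =>
      MeasurableSet.iUnion fun k => MeasurableSet.iUnion fun _ =>
        measurableSet_lt measurable_const (measurable_birkhoffSum hT.measurable hf k)
  have hev : ∀ q q' : ℚ, q < q' → ∀ᶠ k : ℕ in atTop, (q : ℝ) * k + |(q : ℝ)| + |(q' : ℝ)| + C ≤ q' * k := by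
    intro q q' hq
    have hq' : (0 : ℝ) < q' - q := by
      have : (q : ℝ) < q' := by exact_mod_cast hq
      linarith
    filter_upwards [tendsto_natCast_atTop_atTop.eventually_ge_atTop
      ((|(q : ℝ)| + |(q' : ℝ)| + C) / (q' - q))] with k hk
    rw [div_le_iff₀ hq'] at hk
    linarith
  have hGT : T ⁻¹' G = G := by
    ext ω
    have hfω := abs_le.1 (hC ω)
    constructor
    · intro h q hq
      obtain ⟨q', hqq', hq'⟩ := exists_rat_btwn hq
      have h1 := (h q' hq').and_eventually (hev q q' (by exact_mod_cast hqq'))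
      refine (tendsto_add_atTop_nat 1).frequently (h1.mono fun k ⟨hk, hk'⟩ => ?_)
      rw [birkhoffSum_succ', Nat.cast_add, Nat.cast_one]
      have := le_abs_self (q' : ℝ)
      have := abs_nonneg (q : ℝ)
      have : (q : ℝ) < q' := hqq'
      linarith [hfω.1]
    · intro h q hq
      obtain ⟨q', hqq', hq'⟩ := exists_rat_btwn hq
      have h1 := (h q' hq').and_eventually ((hev q q' (by exact_mod_cast hqq')).and
        (eventually_ge_atTop 1))
      refine (tendsto_sub_atTop_nat 1).frequently (h1.mono fun k ⟨hk, hk', hk1⟩ => ?_)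
      obtain ⟨j, rfl⟩ : ∃ j, k = j + 1 := ⟨k - 1, by omega⟩
      rw [birkhoffSum_succ'] at hk
      simp only [Nat.add_sub_cancel]
      rw [Nat.cast_add, Nat.cast_one] at hk hk'
      have := neg_abs_le (q : ℝ)
      have := abs_nonneg (q' : ℝ)
      have : (q : ℝ) < q' := hqq'
      linarith [hfω.2]
  have hG0 : P G = 0 := by
    rcases hT.toPreErgodic.prob_eq_zero_or_one hGm hGT with h | h
    · exact h
    · exfalso
      obtain ⟨q, hq, hqc⟩ := exists_rat_btwn hc
      have hae : ∀ᵐ ω ∂P, ω ∈ G := (prob_compl_eq_zero_iff hGm).2 h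
      have := integral_nonneg_of_exists_birkhoffSum_pos (f := fun ω => f ω - q)
        hT.toMeasurePreserving (hf.sub_const _) (C := C + |(q : ℝ)|)
        (fun ω => (abs_sub _ _).trans (by have := hC ω; gcongr)) (by
          filter_upwards [hae] with ω hω
          obtain ⟨k, hk⟩ := (hω q hqc).exists
          refine ⟨k, ?_⟩
          rw [birkhoffSum_sub_const]
          linarith)
      rw [integral_sub (integrable_of_abs_le hf hC) (integrable_const _)] at this
      simp at this
      linarith
  filter_upwards [measure_eq_zero_iff_ae_notMem.1 hG0] with ω hω
  simp only [hG, mem_ofPred_eq, not_forall, not_frequently, not_lt] at hω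
  obtain ⟨q, hq, h⟩ := hω
  filter_upwards [h] with k hk
  exact hk.trans (mul_le_mul_of_nonneg_right hq.le (Nat.cast_nonneg k))

/-- **Birkhoff's pointwise ergodic theorem** for a bounded function. -/
theorem ae_tendsto_birkhoffSum_div [IsProbabilityMeasure P] (hT : Ergodic T P)
    (hf : Measurable f) {C : ℝ} (hC : ∀ ω, |f ω| ≤ C) :
    ∀ᵐ ω ∂P, ∀ δ > 0, ∀ᶠ k : ℕ in atTop, |birkhoffSum T f k ω - k * ∫ ω, f ω ∂P| ≤ δ * k := by
  have h1 : ∀ᵐ ω ∂P, ∀ i : ℕ, ∀ᶠ k : ℕ in atTop,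
      birkhoffSum T f k ω ≤ (∫ ω, f ω ∂P + 1 / ((i : ℝ) + 1)) * k :=
    ae_all_iff.2 fun i => ae_eventually_birkhoffSum_le hT hf hC (by
      have : (0 : ℝ) < 1 / ((i : ℝ) + 1) := by positivity
      linarith)
  have h2 : ∀ᵐ ω ∂P, ∀ i : ℕ, ∀ᶠ k : ℕ in atTop,
      birkhoffSum T (fun ω => -f ω) k ω ≤ (∫ ω, -f ω ∂P + 1 / ((i : ℝ) + 1)) * k :=
    ae_all_iff.2 fun i => ae_eventually_birkhoffSum_le (f := fun ω => -f ω) hT hf.neg (C := C)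
      (fun ω => by rw [abs_neg]; exact hC ω) (by
      have : (0 : ℝ) < 1 / ((i : ℝ) + 1) := by positivity
      linarith)
  filter_upwards [h1, h2] with ω h1 h2 δ hδ
  obtain ⟨i, hi⟩ := exists_nat_one_div_lt hδ
  filter_upwards [h1 i, h2 i] with k hk1 hk2
  rw [integral_neg] at hk2
  have e : birkhoffSum T (fun ω => -f ω) k ω = -birkhoffSum T f k ω := by
    simp [birkhoffSum, Finset.sum_neg_distrib]
  rw [e] at hk2
  have := mul_le_mul_of_nonneg_right hi.le (Nat.cast_nonneg (α := ℝ) k)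
  rw [abs_le]
  constructor <;> linarith

end Birkhoff

/-! ### Nearly additive displacements and their asymptotic speed. -/

section Displacement

variable {n : ℕ} {a : Space n → ℝ → ℝ} {b : Space n → ℝ → Space n} {α β η K : ℝ}

/-- The largest displacement in direction `p` during `[s,t]`, over all starting points. -/
noncomputable def maxDisplacement (a : Space n → ℝ → ℝ) (b : Space n → ℝ → Space n) (s t : ℝ)
    (p : Space n) : ℝ :=
  sSup {c | ∃ x y, Reach a b s t x y ∧ inner ℝ p (y - x) = c}

/-- Periodicity of a control system under integer translations. -/
def IsLatticePeriodic (a : Space n → ℝ → ℝ) (b : Space n → ℝ → Space n) : Prop :=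
  ∀ (x : Space n) (l : Fin n → ℤ) (t : ℝ),
    a (x + latticePoint l) t = a x t ∧ b (x + latticePoint l) t = b x t

theorem Reach.add_latticePoint (hper : IsLatticePeriodic a b) {s t : ℝ} (hst : s ≤ t)
    {x y : Space n} (h : Reach a b s t x y) (l : Fin n → ℤ) :
    Reach a b s t (x + latticePoint l) (y + latticePoint l) := by
  simpa using h.comp_affine (a' := a) (b' := b) (c := 1) (d := 0) (w := latticePoint l) one_pos hst
    (fun z r => by simpa using (hper z l r).1) (fun z r => by simpa using (hper z l r).2)

theorem exists_norm_add_latticePoint_sub_le (x y : Space n) :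
    ∃ l : Fin n → ℤ, ‖x + latticePoint l - y‖ ≤ √n := by
  refine ⟨fun i => ⌊y i - x i⌋, ?_⟩
  rw [EuclideanSpace.norm_eq]
  refine Real.sqrt_le_sqrt ?_
  have : ∀ i : Fin n, ‖(x + latticePoint (fun i => ⌊y i - x i⌋) - y) i‖ ^ 2 ≤ 1 := by
    intro i
    have e : (x + latticePoint (fun i => ⌊y i - x i⌋) - y) i = -Int.fract (y i - x i) := by
      have := Int.self_sub_floor (y i - x i)
      simp only [latticePoint, PiLp.sub_apply, PiLp.add_apply]
      linarith
    rw [e, norm_neg, Real.norm_of_nonneg (Int.fract_nonneg _)]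
    have h0 := Int.fract_nonneg (y i - x i)
    have h1 := (Int.fract_lt_one (y i - x i)).le
    nlinarith
  simpa using Finset.sum_le_sum fun i (_ : i ∈ Finset.univ) => this i

/-- The constant by which displacements from different starting points may differ. -/
noncomputable def offsetBound (n : ℕ) (β η : ℝ) : ℝ := √n + 2 * β * (√n / η)

namespace IsCoerciveField

theorem offsetBound_nonneg (h : IsCoerciveField a b α β η K) : 0 ≤ offsetBound n β η := by
  have := h.eta_pos; have := h.beta_pos
  unfold offsetBound; positivity

/-- Within time √n/η, controllability leads from x to a lattice translate of the point that the
given path has reached by then; afterwards the translated path is followed. Only the initial stretch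
contributes to the error. On shorter intervals standing still suffices. -/
theorem exists_reach_norm_sub_le (h : IsCoerciveField a b α β η K) (hper : IsLatticePeriodic a b)
    {s t : ℝ} (hst : s ≤ t) {x₁ y₁ : Space n} (hr : Reach a b s t x₁ y₁) (x : Space n) :
    ∃ y, Reach a b s t x y ∧ ‖(y - x) - (y₁ - x₁)‖ ≤ offsetBound n β η := by
  have hη := h.eta_pos
  have hβ := h.beta_pos
  set T := √n / η with hT
  have hT0 : 0 ≤ T := by positivity
  have hηT : η * T = √n := by rw [hT]; field_simp
  have hn : 0 ≤ √(n : ℝ) := Real.sqrt_nonneg _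
  unfold offsetBound
  rcases le_total (t - s) T with hle | hle
  · refine ⟨x, h.reach_self hst x, ?_⟩
    have h1 := h.norm_sub_le_of_reach hst hr
    have h2 := mul_le_mul_of_nonneg_left hle (mul_pos two_pos hβ).le
    rw [sub_self, zero_sub, norm_neg]
    linarith
  · obtain ⟨z, h1, h2⟩ := hr.split (m := s + T) (by linarith) (by linarith)
    obtain ⟨l, hl⟩ := exists_norm_add_latticePoint_sub_le z x
    have h3 : Reach a b s (s + T) x (z + latticePoint l) :=
      h.reach_of_norm_sub_le (by linarith) (by rw [add_sub_cancel_left, hηT]; exact hl)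
    refine ⟨y₁ + latticePoint l, h.reach_trans (by linarith) (by linarith) h3
      (h2.add_latticePoint hper (by linarith) l), ?_⟩
    have h4 := h.norm_sub_le_of_reach (by linarith) h1
    have e : y₁ + latticePoint l - x - (y₁ - x₁) = (z + latticePoint l - x) - (z - x₁) := by abel
    rw [e]
    have := norm_sub_le (z + latticePoint l - x) (z - x₁)
    rw [add_sub_cancel_left] at h4
    linarith

theorem bddAbove_displacement (h : IsCoerciveField a b α β η K) {s t : ℝ} (hst : s ≤ t)
    (p : Space n) :
    2 * β * (t - s) * ‖p‖ ∈ upperBounds {c | ∃ x y, Reach a b s t x y ∧ inner ℝ p (y - x) = c} := by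
  rintro _ ⟨x, y, hr, rfl⟩
  have h1 := real_inner_le_norm p (y - x)
  have h2 := mul_le_mul_of_nonneg_left (h.norm_sub_le_of_reach hst hr) (norm_nonneg p)
  linarith

theorem inner_le_maxDisplacement (h : IsCoerciveField a b α β η K) {s t : ℝ} (hst : s ≤ t)
    {x y : Space n} (hr : Reach a b s t x y) (p : Space n) :
    inner ℝ p (y - x) ≤ maxDisplacement a b s t p :=
  le_csSup ⟨_, h.bddAbove_displacement hst p⟩ ⟨x, y, hr, rfl⟩

theorem maxDisplacement_le (h : IsCoerciveField a b α β η K) {s t c : ℝ} (hst : s ≤ t)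
    {p : Space n} (hc : ∀ x y, Reach a b s t x y → inner ℝ p (y - x) ≤ c) :
    maxDisplacement a b s t p ≤ c :=
  csSup_le ⟨_, 0, 0, h.reach_self hst 0, rfl⟩ fun _ ⟨x, y, hr, e⟩ => e ▸ hc x y hr

theorem maxDisplacement_nonneg (h : IsCoerciveField a b α β η K) {s t : ℝ} (hst : s ≤ t)
    (p : Space n) : 0 ≤ maxDisplacement a b s t p := by
  simpa using h.inner_le_maxDisplacement hst (h.reach_self hst 0) p

theorem maxDisplacement_le_mul (h : IsCoerciveField a b α β η K) {s t : ℝ} (hst : s ≤ t)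
    (p : Space n) : maxDisplacement a b s t p ≤ 2 * β * (t - s) * ‖p‖ :=
  h.maxDisplacement_le hst fun x y hr => h.bddAbove_displacement hst p ⟨x, y, hr, rfl⟩

theorem maxDisplacement_add_le (h : IsCoerciveField a b α β η K) {s t : ℝ} (hst : s ≤ t)
    (p q : Space n) :
    maxDisplacement a b s t (p + q) ≤ maxDisplacement a b s t p + maxDisplacement a b s t q :=
  h.maxDisplacement_le hst fun x y hr => by
    rw [inner_add_left]
    exact add_le_add (h.inner_le_maxDisplacement hst hr p) (h.inner_le_maxDisplacement hst hr q)

theorem maxDisplacement_smul_le (h : IsCoerciveField a b α β η K) {s t : ℝ} (hst : s ≤ t)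
    {c : ℝ} (hc : 0 ≤ c) (p : Space n) :
    maxDisplacement a b s t (c • p) ≤ c * maxDisplacement a b s t p :=
  h.maxDisplacement_le hst fun x y hr => by
    rw [real_inner_smul_left]
    exact mul_le_mul_of_nonneg_left (h.inner_le_maxDisplacement hst hr p) hc

theorem maxDisplacement_le_add (h : IsCoerciveField a b α β η K) {s m t : ℝ} (hsm : s ≤ m)
    (hmt : m ≤ t) (p : Space n) :
    maxDisplacement a b s t p ≤ maxDisplacement a b s m p + maxDisplacement a b m t p :=
  h.maxDisplacement_le (hsm.trans hmt) fun x y hr => by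
    obtain ⟨z, h1, h2⟩ := hr.split hsm hmt
    have e : y - x = (z - x) + (y - z) := by abel
    rw [e, inner_add_right]
    exact add_le_add (h.inner_le_maxDisplacement hsm h1 p) (h.inner_le_maxDisplacement hmt h2 p)

theorem exists_reach_inner_gt (h : IsCoerciveField a b α β η K) (hper : IsLatticePeriodic a b)
    {s t : ℝ} (hst : s ≤ t) (p x : Space n) {κ : ℝ} (hκ : 0 < κ) :
    ∃ y, Reach a b s t x y ∧
      maxDisplacement a b s t p - offsetBound n β η * ‖p‖ - κ < inner ℝ p (y - x) := by
  obtain ⟨_, ⟨x₁, y₁, hr, rfl⟩, hc⟩ := exists_lt_of_lt_csSup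
    (s := {c | ∃ x y, Reach a b s t x y ∧ inner ℝ p (y - x) = c})
    ⟨_, 0, 0, h.reach_self hst 0, rfl⟩ (sub_lt_self (maxDisplacement a b s t p) hκ)
  obtain ⟨y, hy, hd⟩ := h.exists_reach_norm_sub_le hper hst hr x
  refine ⟨y, hy, ?_⟩
  have h1 := real_inner_le_norm p ((y₁ - x₁) - (y - x))
  rw [norm_sub_rev, inner_sub_right] at h1
  have h2 := mul_le_mul_of_nonneg_left hd (norm_nonneg p)
  linarith

/-- From the end of any path on [s,m] one can continue with a nearly optimal displacement on [m,t],
losing only the price of the changed starting point. -/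
theorem add_le_maxDisplacement (h : IsCoerciveField a b α β η K) (hper : IsLatticePeriodic a b)
    {s m t : ℝ} (hsm : s ≤ m) (hmt : m ≤ t) (p : Space n) :
    maxDisplacement a b s m p + maxDisplacement a b m t p - offsetBound n β η * ‖p‖
      ≤ maxDisplacement a b s t p := by
  rw [sub_le_iff_le_add, ← le_sub_iff_add_le]
  refine h.maxDisplacement_le hsm fun x y hr => ?_
  refine le_of_forall_pos_le_add fun κ hκ => ?_
  obtain ⟨z, hz, hz'⟩ := h.exists_reach_inner_gt hper hmt p y hκ
  have h1 := h.inner_le_maxDisplacement (hsm.trans hmt) (h.reach_trans hsm hmt hr hz) p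
  have e : z - x = (y - x) + (z - y) := by abel
  rw [e, inner_add_right] at h1
  linarith

/-- Near-additivity of displacements, averaged over `N` phases. -/
theorem abs_mul_maxDisplacement_sub_sum_le (h : IsCoerciveField a b α β η K)
    (hper : IsLatticePeriodic a b) (p : Space n) (N k : ℕ) :
    |N * maxDisplacement a b 0 k p
        - ∑ j ∈ Finset.range k, maxDisplacement a b j (j + N) p| ≤
      k * (offsetBound n β η * ‖p‖) + N * (offsetBound n β η * ‖p‖ + 4 * β * N * ‖p‖) := by
  set C := offsetBound n β η * ‖p‖ with hC
  have hC0 : 0 ≤ C := mul_nonneg h.offsetBound_nonneg (norm_nonneg p)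
  have hβ := h.beta_pos
  set M : ℕ → ℝ := fun j => maxDisplacement a b 0 j p with hM
  have hstep : ∀ j i : ℕ, |maxDisplacement a b j (j + i) p - (M (j + i) - M j)| ≤ C := by
    intro j i
    have h1 := h.maxDisplacement_le_add (s := 0) (m := j) (t := j + i) (by positivity) (by simp) p
    have h2 := h.add_le_maxDisplacement hper (s := 0) (m := j) (t := j + i) (by positivity)
      (by simp) p
    simp only [hM, Nat.cast_add]
    rw [abs_le]; constructor <;> linarith
  have hMi : ∀ j i : ℕ, |M (j + i) - M j| ≤ C + 2 * β * i * ‖p‖ := by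
    intro j i
    have h1 := abs_le.1 (hstep j i)
    have h2 := h.maxDisplacement_nonneg (s := j) (t := j + i) (by simp) p
    have h3 := h.maxDisplacement_le_mul (s := j) (t := j + i) (by simp) p
    have h4 : 0 ≤ 2 * β * i * ‖p‖ := by positivity
    rw [add_sub_cancel_left] at h3
    rw [abs_le]; constructor <;> linarith [h1.1, h1.2]
  -- The sum telescopes with step N: only N terms at each end survive. Those near k are each close
  -- to M k, which produces N * M k up to an error independent of k.
  have htel : ∑ j ∈ Finset.range k, (M (j + N) - M j) =
      ∑ i ∈ Finset.range N, (M (k + i) - M i) := by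
    have e1 := Finset.sum_range_add M k N
    have e2 := Finset.sum_range_add M N k
    rw [add_comm N k] at e2
    simp only [Finset.sum_sub_distrib]
    have e3 : ∑ j ∈ Finset.range k, M (j + N) = ∑ j ∈ Finset.range k, M (N + j) :=
      Finset.sum_congr rfl fun j _ => by rw [add_comm]
    linarith
  have hA : |∑ j ∈ Finset.range k, maxDisplacement a b j (j + N) p -
      ∑ j ∈ Finset.range k, (M (j + N) - M j)| ≤ k * C := by
    rw [← Finset.sum_sub_distrib]
    refine (Finset.abs_sum_le_sum_abs _ _).trans ?_
    simpa using Finset.sum_le_sum fun j (_ : j ∈ Finset.range k) => hstep j N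
  have hB : |N * M k - ∑ i ∈ Finset.range N, (M (k + i) - M i)| ≤
      N * (C + 4 * β * N * ‖p‖) := by
    have e : N * M k - ∑ i ∈ Finset.range N, (M (k + i) - M i) =
        ∑ i ∈ Finset.range N, (M i - (M (k + i) - M k)) := by
      simp only [Finset.sum_sub_distrib, Finset.sum_const, Finset.card_range, nsmul_eq_mul]; ring
    rw [e]
    refine (Finset.abs_sum_le_sum_abs _ _).trans ?_
    have := Finset.sum_le_sum fun i (hi : i ∈ Finset.range N) =>
      show |M i - (M (k + i) - M k)| ≤ C + 4 * β * N * ‖p‖ by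
        have hiN : (i : ℝ) ≤ N := by exact_mod_cast (Finset.mem_range.1 hi).le
        have h1 := abs_le.1 (hMi k i)
        have h2 := h.maxDisplacement_nonneg (s := 0) (t := i) (by positivity) p
        have h3 := h.maxDisplacement_le_mul (s := 0) (t := i) (by positivity) p
        rw [sub_zero] at h3
        have h4 : 2 * β * i * ‖p‖ ≤ 2 * β * N * ‖p‖ := by gcongr
        have h5 : 0 ≤ 2 * β * N * ‖p‖ := by positivity
        simp only [hM] at h1 ⊢
        rw [abs_le]; constructor <;> linarith [h1.1, h1.2]
    simpa [← mul_add] using this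
  rw [htel] at hA
  have := abs_sub_le (N * M k) (∑ i ∈ Finset.range N, (M (k + i) - M i))
    (∑ j ∈ Finset.range k, maxDisplacement a b j (j + N) p)
  rw [abs_sub_comm (∑ i ∈ Finset.range N, (M (k + i) - M i))] at this
  linarith

end IsCoerciveField

/-- `c` is the asymptotic speed of displacement in direction `p`. -/
def HasAsymptoticSpeed (a : Space n → ℝ → ℝ) (b : Space n → ℝ → Space n) (p : Space n) (c : ℝ) :
    Prop :=
  Tendsto (fun k : ℕ => maxDisplacement a b 0 k p / k) atTop (𝓝 c)

/-- Existence of the limit of a sequence that is nearly additive on every scale. -/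
theorem exists_forall_tendsto_div {E : ℕ → ℝ} {C : ℝ}
    (hE : ∃ M : ℕ → ℝ, ∀ N : ℕ, ∀ᶠ k : ℕ in atTop, |N * M k - k * E N| ≤ C * k) :
    ∃ H, ∀ M : ℕ → ℝ, (∀ N : ℕ, ∀ᶠ k : ℕ in atTop, |N * M k - k * E N| ≤ C * k) →
      Tendsto (fun k : ℕ => M k / k) atTop (𝓝 H) := by
  obtain ⟨M₀, hM₀⟩ := hE
  have hC : 0 ≤ C := by
    obtain ⟨k, hk, hk'⟩ := ((hM₀ 0).and (eventually_gt_atTop 0)).exists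
    have : (0 : ℝ) < k := by exact_mod_cast hk'
    exact nonneg_of_mul_nonneg_left ((abs_nonneg _).trans hk) this
  -- Two scales are compared through the same M₀ at one large k. Dividing by N N' shows that E N / N
  -- is a Cauchy sequence.
  have hEE : ∀ N N' : ℕ, |N' * E N - N * E N'| ≤ C * (N + N') := by
    intro N N'
    obtain ⟨k, h1, h2, h3⟩ := ((hM₀ N).and ((hM₀ N').and (eventually_gt_atTop 0))).exists
    have hk : (0 : ℝ) < k := by exact_mod_cast h3
    have e1 := mul_le_mul_of_nonneg_left h1 (Nat.cast_nonneg (α := ℝ) N')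
    have e2 := mul_le_mul_of_nonneg_left h2 (Nat.cast_nonneg (α := ℝ) N)
    rw [← abs_of_nonneg (Nat.cast_nonneg (α := ℝ) N'), ← abs_mul] at e1
    rw [← abs_of_nonneg (Nat.cast_nonneg (α := ℝ) N), ← abs_mul] at e2
    simp only [Nat.abs_cast] at e1 e2
    refine le_of_mul_le_mul_left (a := (k : ℝ)) ?_ hk
    rw [← abs_of_pos hk, ← abs_mul, abs_of_pos hk]
    rw [abs_le] at e1 e2 ⊢
    constructor <;> nlinarith [e1.1, e1.2, e2.1, e2.2]
  have hcau : CauchySeq fun N : ℕ => E (N + 1) / ((N : ℝ) + 1) := by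
    refine cauchySeq_of_le_tendsto_0 (fun N : ℕ => 2 * C * (1 / ((N : ℝ) + 1))) ?_ ?_
    · intro i j N hi hj
      have hi' : (N : ℝ) ≤ i := by exact_mod_cast hi
      have hj' : (N : ℝ) ≤ j := by exact_mod_cast hj
      have := hEE (i + 1) (j + 1)
      push_cast at this
      rw [Real.dist_eq, div_sub_div _ _ (by positivity) (by positivity), abs_div,
        abs_of_pos (by positivity : (0 : ℝ) < ((i : ℝ) + 1) * (j + 1)), div_le_iff₀ (by positivity)]
      have e : C * ((i : ℝ) + 1 + (j + 1)) =
        (C * (1 / ((j : ℝ) + 1)) + C * (1 / ((i : ℝ) + 1))) * ((i + 1) * (j + 1)) := by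
        field_simp
      rw [mul_comm (E (i + 1))]
      rw [e] at this
      refine this.trans (mul_le_mul_of_nonneg_right ?_ (by positivity))
      have f1 : 1 / ((j : ℝ) + 1) ≤ 1 / ((N : ℝ) + 1) := by gcongr
      have f2 : 1 / ((i : ℝ) + 1) ≤ 1 / ((N : ℝ) + 1) := by gcongr
      have f3 := mul_le_mul_of_nonneg_left f1 hC
      have f4 := mul_le_mul_of_nonneg_left f2 hC
      linarith
    · simpa using tendsto_one_div_add_atTop_nhds_zero_nat.const_mul (2 * C)
  obtain ⟨H, hH⟩ := cauchySeq_tendsto_of_complete hcau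
  -- `H` depends on `E` alone. When `E N` is an expectation and `M` is a random sequence, this makes
  -- the limit nonrandom.
  refine ⟨H, fun M hM => ?_⟩
  suffices key : ∀ δ > 0, ∀ᶠ k : ℕ in atTop, |M k - k * H| ≤ δ * k by
    rw [Metric.tendsto_nhds]
    intro δ hδ
    filter_upwards [key (δ / 2) (half_pos hδ), eventually_gt_atTop 0] with k hk hk0
    have hk0 : (0 : ℝ) < k := by exact_mod_cast hk0
    have e : M k / k - H = (M k - k * H) / k := by field_simp
    rw [Real.dist_eq, e, abs_div, abs_of_pos hk0, div_lt_iff₀ hk0]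
    refine hk.trans_lt ?_
    have := mul_pos hδ hk0
    linarith
  intro δ hδ
  have h1 : ∀ᶠ N : ℕ in atTop, |E (N + 1) / ((N : ℝ) + 1) - H| ≤ δ / 2 := by
    have := hH (Metric.closedBall_mem_nhds H (half_pos hδ))
    simpa [Real.dist_eq] using this
  have h2 : ∀ᶠ N : ℕ in atTop, C * (1 / ((N : ℝ) + 1)) ≤ δ / 2 := by
    have := (tendsto_one_div_add_atTop_nhds_zero_nat (𝕜 := ℝ)).const_mul C
    rw [mul_zero] at this
    exact this.eventually_le_const (half_pos hδ)
  obtain ⟨N, h1, h2⟩ := (h1.and h2).exists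
  filter_upwards [hM (N + 1)] with k hk
  push_cast at hk
  have hN : (0 : ℝ) < (N : ℝ) + 1 := by positivity
  have e : M k - k * H = (((N : ℝ) + 1) * M k - k * E (N + 1)) / (N + 1)
      + k * (E (N + 1) / ((N : ℝ) + 1) - H) := by field_simp; ring
  rw [e]
  refine (abs_add_le _ _).trans ?_
  rw [abs_div, abs_of_pos hN, abs_mul, Nat.abs_cast]
  have f1 : |((N : ℝ) + 1) * M k - k * E (N + 1)| / (N + 1) ≤ k * (δ / 2) := by
    rw [div_le_iff₀ hN]
    refine hk.trans ?_
    have := mul_le_mul_of_nonneg_right h2 (by positivity : (0 : ℝ) ≤ k * (N + 1))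
    have e : C * (1 / ((N : ℝ) + 1)) * (k * (N + 1)) = C * k := by field_simp
    rw [e] at this
    linarith
  have f2 := mul_le_mul_of_nonneg_left h1 (Nat.cast_nonneg (α := ℝ) k)
  linarith

end Displacement

/-! ### The effective set and the asymptotics of reachable sets. -/

section EffectiveSet

variable {n : ℕ} {a : Space n → ℝ → ℝ} {b : Space n → ℝ → Space n} {α β η K : ℝ}
  {H : Space n → ℝ}

namespace IsCoerciveField

theorem maxDisplacement_sub_le (h : IsCoerciveField a b α β η K) {s t : ℝ} (hst : s ≤ t)
    (p q : Space n) :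
    |maxDisplacement a b s t p - maxDisplacement a b s t q| ≤ 2 * β * (t - s) * ‖p - q‖ := by
  have key : ∀ p q, maxDisplacement a b s t p - maxDisplacement a b s t q
      ≤ 2 * β * (t - s) * ‖p - q‖ := fun p q => by
    have h1 := h.maxDisplacement_add_le hst (p - q) q
    have h2 := h.maxDisplacement_le_mul hst (p - q)
    rw [sub_add_cancel] at h1
    linarith
  rw [abs_le]
  have h1 := key p q
  have h2 := key q p
  rw [norm_sub_rev] at h2
  constructor <;> linarith

theorem abs_speed_sub_le (h : IsCoerciveField a b α β η K) {p q : Space n} {c d : ℝ}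
    (hp : HasAsymptoticSpeed a b p c) (hq : HasAsymptoticSpeed a b q d) :
    |c - d| ≤ 2 * β * ‖p - q‖ := by
  refine le_of_tendsto (hp.sub hq).abs ?_
  filter_upwards [eventually_gt_atTop 0] with k hk
  have hk : (0 : ℝ) < k := by exact_mod_cast hk
  rw [← sub_div, abs_div, abs_of_pos hk, div_le_iff₀ hk]
  have := h.maxDisplacement_sub_le hk.le p q
  rw [sub_zero] at this
  linarith

/-- The quotients are Lipschitz in p with constant 2β, uniformly in k. Countably many directions
therefore suffice, and with them countably many null sets. -/
theorem hasAsymptoticSpeed_of_dense (h : IsCoerciveField a b α β η K) {u : ℕ → Space n}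
    (hu : DenseRange u) (hH : ∀ p q, |H p - H q| ≤ 2 * β * ‖p - q‖)
    (hs : ∀ i, HasAsymptoticSpeed a b (u i) (H (u i))) (p : Space n) :
    HasAsymptoticSpeed a b p (H p) := by
  have hβ := h.beta_pos
  rw [HasAsymptoticSpeed, Metric.tendsto_nhds]
  intro δ hδ
  obtain ⟨_, hk, i, rfl⟩ := Metric.dense_iff.1 hu p (δ / (8 * β)) (by positivity)
  rw [Metric.mem_ball, dist_comm, dist_eq_norm, lt_div_iff₀ (by positivity)] at hk
  filter_upwards [Metric.tendsto_nhds.1 (hs i) (δ / 2) (half_pos hδ), eventually_gt_atTop 0]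
    with k hk1 hk0
  have hk0 : (0 : ℝ) < k := by exact_mod_cast hk0
  rw [Real.dist_eq] at hk1 ⊢
  have h1 := hH p (u i)
  have h2 : |maxDisplacement a b 0 k p / k - maxDisplacement a b 0 k (u i) / k| ≤
      2 * β * ‖p - u i‖ := by
    rw [← sub_div, abs_div, abs_of_pos hk0, div_le_iff₀ hk0]
    have := h.maxDisplacement_sub_le hk0.le p (u i)
    rw [sub_zero] at this
    linarith
  rw [abs_le] at h1 h2
  rw [abs_lt] at hk1 ⊢
  constructor <;> linarith [h1.1, h1.2, h2.1, h2.2, hk1.1, hk1.2]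

theorem speed_nonneg (h : IsCoerciveField a b α β η K) {p : Space n} {c : ℝ}
    (hp : HasAsymptoticSpeed a b p c) : 0 ≤ c :=
  ge_of_tendsto' hp fun k =>
    div_nonneg (h.maxDisplacement_nonneg (Nat.cast_nonneg k) p) (Nat.cast_nonneg k)

theorem speed_le_mul (h : IsCoerciveField a b α β η K) {p : Space n} {c : ℝ}
    (hp : HasAsymptoticSpeed a b p c) : c ≤ 2 * β * ‖p‖ := by
  refine le_of_tendsto hp ?_
  filter_upwards [eventually_gt_atTop 0] with k hk
  have hk : (0 : ℝ) < k := by exact_mod_cast hk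
  rw [div_le_iff₀ hk]
  have := h.maxDisplacement_le_mul hk.le p
  rw [sub_zero] at this
  linarith

theorem speed_add_le (h : IsCoerciveField a b α β η K) {p q : Space n} {c d e : ℝ}
    (hp : HasAsymptoticSpeed a b p c) (hq : HasAsymptoticSpeed a b q d)
    (hpq : HasAsymptoticSpeed a b (p + q) e) : e ≤ c + d := by
  refine le_of_tendsto_of_tendsto' hpq (hp.add hq) fun k => ?_
  rw [← add_div]
  exact div_le_div_of_nonneg_right (h.maxDisplacement_add_le (Nat.cast_nonneg k) p q)
    (Nat.cast_nonneg k)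

theorem speed_smul_le (h : IsCoerciveField a b α β η K) {p : Space n} {c d r : ℝ} (hr : 0 ≤ r)
    (hp : HasAsymptoticSpeed a b p c) (hrp : HasAsymptoticSpeed a b (r • p) d) : d ≤ r * c := by
  refine le_of_tendsto_of_tendsto' hrp (hp.const_mul r) fun k => ?_
  rw [← mul_div_assoc]
  exact div_le_div_of_nonneg_right (h.maxDisplacement_smul_le (Nat.cast_nonneg k) hr p)
    (Nat.cast_nonneg k)

theorem speed_smul (h : IsCoerciveField a b α β η K) (hH : ∀ p, HasAsymptoticSpeed a b p (H p))
    {r : ℝ} (hr : 0 < r) (p : Space n) : H (r • p) = r * H p := by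
  refine le_antisymm (h.speed_smul_le hr.le (hH p) (hH _)) ?_
  have := h.speed_smul_le (inv_pos.2 hr).le (hH (r • p)) (d := H p) (by
    rw [inv_smul_smul₀ hr.ne']; exact hH p)
  rwa [le_inv_mul_iff₀ hr] at this

/-- The convergence of the displacements, uniformly in the direction. -/
theorem exists_abs_maxDisplacement_sub_le (h : IsCoerciveField a b α β η K)
    (hper : IsLatticePeriodic a b) (hH : ∀ p, HasAsymptoticSpeed a b p (H p)) {δ : ℝ}
    (hδ : 0 < δ) :
    ∃ B ≥ 0, ∀ p : Space n, ‖p‖ ≤ 1 → ∀ s, 0 ≤ s →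
      |maxDisplacement a b 0 s p - s * H p| ≤ δ * s + B := by
  have hβ := h.beta_pos
  have hC := h.offsetBound_nonneg
  -- A finite net of the unit ball and the common Lipschitz bound make the convergence uniform in p.
  obtain ⟨S, hS, hcov⟩ := Metric.totallyBounded_iff.1
    (isCompact_closedBall (0 : Space n) 1).totallyBounded (δ / (8 * β)) (by positivity)
  have hev : ∀ᶠ k : ℕ in atTop, ∀ y ∈ S, |maxDisplacement a b 0 k y - k * H y| ≤ δ / 2 * k := by
    rw [eventually_all_finite hS]
    intro y _
    filter_upwards [Metric.tendsto_nhds.1 (hH y) (δ / 2) (half_pos hδ), eventually_gt_atTop 0]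
      with k hk hk0
    have hk0 : (0 : ℝ) < k := by exact_mod_cast hk0
    have e : maxDisplacement a b 0 k y / k - H y = (maxDisplacement a b 0 k y - k * H y) / k := by
      field_simp
    rw [Real.dist_eq, e, abs_div, abs_of_pos hk0, div_lt_iff₀ hk0] at hk
    exact hk.le
  obtain ⟨k₀, hk₀⟩ := eventually_atTop.1 hev
  -- The three terms pay for times before k₀, for the fractional part of s, and for the defect of
  -- additivity at the integer part of s.
  refine ⟨2 * β * k₀ + 2 * β + offsetBound n β η, by positivity, fun p hp s hs => ?_⟩
  have hH0 := h.speed_nonneg (hH p)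
  have hH1 : H p ≤ 2 * β := (h.speed_le_mul (hH p)).trans (by nlinarith)
  have hnat : ∀ k : ℕ, |maxDisplacement a b 0 k p - k * H p| ≤ δ * k + 2 * β * k₀ := by
    intro k
    have hk : (0 : ℝ) ≤ k := Nat.cast_nonneg k
    rcases le_total k₀ k with hle | hle
    · obtain ⟨y, hy, hpy⟩ := mem_iUnion₂.1 (hcov (mem_closedBall_zero_iff.2 hp))
      rw [Metric.mem_ball, dist_eq_norm, lt_div_iff₀ (by positivity)] at hpy
      have h1 := h.maxDisplacement_sub_le hk p y
      have h2 := mul_le_mul_of_nonneg_left (h.abs_speed_sub_le (hH p) (hH y)) hk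
      have h3 := hk₀ k hle y hy
      rw [sub_zero] at h1
      have h4 : k * (2 * β * ‖p - y‖) ≤ k * (δ / 4) := by gcongr; linarith
      have e : maxDisplacement a b 0 k p - k * H p =
        (maxDisplacement a b 0 k p - maxDisplacement a b 0 k y) +
          (maxDisplacement a b 0 k y - k * H y) - k * (H p - H y) := by ring
      rw [e]
      have f1 := abs_sub ((maxDisplacement a b 0 k p - maxDisplacement a b 0 k y) +
          (maxDisplacement a b 0 k y - k * H y)) (k * (H p - H y))
      have f2 := abs_add_le (maxDisplacement a b 0 k p - maxDisplacement a b 0 k y)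
          (maxDisplacement a b 0 k y - k * H y)
      rw [abs_mul, abs_of_nonneg hk] at f1
      have f3 : 0 ≤ 2 * β * k₀ := by positivity
      linarith
    · have hle' : (k : ℝ) ≤ k₀ := by exact_mod_cast hle
      have h1 := h.maxDisplacement_nonneg hk p
      have h2 := h.maxDisplacement_le_mul hk p
      have h3 : 2 * β * (k - 0) * ‖p‖ ≤ 2 * β * k₀ * 1 := by rw [sub_zero]; gcongr
      have h4 : k * H p ≤ k₀ * (2 * β) := by gcongr
      have h5 : 0 ≤ k * H p := by positivity
      have h6 : 0 ≤ δ * k := by positivity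
      rw [abs_le]; constructor <;> linarith
  have hfl := Nat.floor_le hs
  have hfl' := (Nat.lt_floor_add_one s).le
  set k := ⌊s⌋₊
  have hk : (0 : ℝ) ≤ k := Nat.cast_nonneg k
  have h1 := abs_le.1 (hnat k)
  have h2 := h.maxDisplacement_le_add hk hfl p
  have h3 := h.add_le_maxDisplacement hper hk hfl p
  have h4 := h.maxDisplacement_nonneg hfl p
  have h5 := h.maxDisplacement_le_mul hfl p
  have h6 : 2 * β * (s - k) * ‖p‖ ≤ 2 * β * 1 * 1 := by gcongr; linarith
  have h7 : offsetBound n β η * ‖p‖ ≤ offsetBound n β η := mul_le_of_le_one_right hC hp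
  have h8 : δ * k ≤ δ * s := by gcongr
  have h9 : (s - k) * H p ≤ 1 * (2 * β) := by gcongr; linarith
  have h10 : 0 ≤ (s - k) * H p := mul_nonneg (sub_nonneg.2 hfl) hH0
  rw [abs_le]; constructor <;> linarith [h1.1, h1.2]

end IsCoerciveField

/-- The closed convex set with support function `H`. -/
def supportedSet (H : Space n → ℝ) : Set (Space n) := {q | ∀ p, inner ℝ p q ≤ H p}

theorem convex_supportedSet (H : Space n → ℝ) : Convex ℝ (supportedSet H) := by
  have : supportedSet H = ⋂ p, {q | inner ℝ p q ≤ H p} := by ext; simp [supportedSet]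
  rw [this]
  exact convex_iInter fun p => convex_halfSpace_le (f := fun q => inner ℝ p q)
    ⟨fun x y => inner_add_right p x y, fun c x => by
      simp [inner_smul_right]⟩ _

theorem isClosed_supportedSet (H : Space n → ℝ) : IsClosed (supportedSet H) := by
  have : supportedSet H = ⋂ p, {q | inner ℝ p q ≤ H p} := by ext; simp [supportedSet]
  rw [this]
  exact isClosed_iInter fun p => isClosed_le (by fun_prop) continuous_const

theorem norm_le_of_mem_supportedSet {C : ℝ} (hC : 0 ≤ C) (hH : ∀ p, H p ≤ C * ‖p‖) {q : Space n}
    (hq : q ∈ supportedSet H) : ‖q‖ ≤ C := by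
  have h1 := (hq q).trans (hH q)
  rw [real_inner_self_eq_norm_mul_norm] at h1
  rcases (norm_nonneg q).eq_or_lt with h0 | h0
  · rwa [← h0]
  · exact le_of_mul_le_mul_right h1 h0

theorem isCompact_supportedSet {C : ℝ} (hC : 0 ≤ C) (hH : ∀ p, H p ≤ C * ‖p‖) :
    IsCompact (supportedSet H) :=
  Metric.isCompact_of_isClosed_isBounded (isClosed_supportedSet H)
    (isBounded_iff_forall_norm_le.2 ⟨C, fun _ hq => norm_le_of_mem_supportedSet hC hH hq⟩)

/-- A sublinear function is the support function of its `supportedSet`. -/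
theorem exists_mem_supportedSet_inner_eq (hadd : ∀ p q, H (p + q) ≤ H p + H q)
    (hsmul : ∀ r : ℝ, 0 < r → ∀ p, H (r • p) = r * H p) (p : Space n) :
    ∃ q ∈ supportedSet H, inner ℝ p q = H p := by
  have h0 : H 0 = 0 := by
    have := hsmul 2 two_pos 0
    rw [smul_zero] at this; linarith
  have hwd : ∀ c : ℝ, c • p = 0 → RingHom.id ℝ c • H p = 0 := fun c hc => by
    rcases smul_eq_zero.1 hc with rfl | rfl <;> simp [h0]
  -- Hahn–Banach: the functional r p ↦ r H(p) on the line through p is extended below H and then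
  -- represented by a vector. For r < 0 it lies below H because 0 = H(0) ≤ H(rp) + H(-rp).
  obtain ⟨g, hg', hg⟩ := exists_extension_of_le_sublinear
    (LinearPMap.mkSpanSingleton' p (H p) hwd) H (fun r hr x => hsmul r hr x) hadd (by
      rintro ⟨x, hx⟩
      obtain ⟨r, rfl⟩ := Submodule.mem_span_singleton.1 hx
      rw [LinearPMap.mkSpanSingleton'_apply]
      change r * H p ≤ H (r • p)
      rcases lt_trichotomy r 0 with hr | rfl | hr
      · have h1 := hsmul (-r) (neg_pos.2 hr) p
        have h2 := hadd (r • p) ((-r) • p)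
        rw [← add_smul, add_neg_cancel, zero_smul, h0] at h2
        linarith
      · rw [zero_mul, zero_smul, h0]
      · exact (hsmul r hr p).ge)
  refine ⟨(InnerProductSpace.toDual ℝ (Space n)).symm g.toContinuousLinearMap, fun x => ?_, ?_⟩
  · rw [real_inner_comm, InnerProductSpace.toDual_symm_apply]
    exact hg x
  · rw [real_inner_comm, InnerProductSpace.toDual_symm_apply]
    refine (hg' ⟨p, Submodule.mem_span_singleton_self p⟩).trans ?_
    exact LinearPMap.mkSpanSingleton'_apply_self _ _ hwd _

/-- A point not far beyond each supporting hyperplane of a closed convex set is close to it. -/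
theorem exists_mem_supportedSet_norm_sub_le (hadd : ∀ p q, H (p + q) ≤ H p + H q)
    (hsmul : ∀ r : ℝ, 0 < r → ∀ p, H (r • p) = r * H p) {z : Space n} {ε : ℝ} (hε : 0 ≤ ε)
    (hz : ∀ p, ‖p‖ ≤ 1 → inner ℝ p z ≤ H p + ε) : ∃ q ∈ supportedSet H, ‖z - q‖ ≤ ε := by
  obtain ⟨q₀, hq₀, -⟩ := exists_mem_supportedSet_inner_eq hadd hsmul 0
  obtain ⟨q, hq, hmin⟩ := exists_norm_eq_iInf_of_complete_convex ⟨q₀, hq₀⟩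
    (isClosed_supportedSet H).isComplete (convex_supportedSet H) z
  have hproj := (norm_eq_iInf_iff_real_inner_le_zero (convex_supportedSet H) hq).1 hmin
  refine ⟨q, hq, ?_⟩
  rcases (norm_nonneg (z - q)).eq_or_lt with h0 | h0
  · rwa [← h0]
  -- The nearest point q maximizes the inner product with z - q over the set, so the distance is
  -- exactly the excess of z over the support function in the unit direction z - q.
  · obtain ⟨q', hq', he⟩ := exists_mem_supportedSet_inner_eq hadd hsmul (z - q)
    have h1 := hproj q' hq'
    have h2 := hz (‖z - q‖⁻¹ • (z - q)) (by
      rw [norm_smul, norm_inv, norm_norm, inv_mul_cancel₀ h0.ne'])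
    rw [hsmul _ (inv_pos.2 h0), ← he, real_inner_smul_left] at h2
    rw [inner_sub_right] at h1
    have h3 : inner ℝ (z - q) z - inner ℝ (z - q) q = ‖z - q‖ * ‖z - q‖ := by
      rw [← inner_sub_right, real_inner_self_eq_norm_mul_norm]
    have h4 : ‖z - q‖⁻¹ * (‖z - q‖ * ‖z - q‖) ≤ ε := by
      rw [← h3, mul_sub]
      have := mul_le_mul_of_nonneg_left h1 (inv_pos.2 h0).le
      linarith
    rwa [inv_mul_cancel_left₀ h0.ne'] at h4

/-- The reachable sets from `x` after a long time `t` are close to `x + tD`, uniformly in `x`. -/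
def ReachApproximates (a : Space n → ℝ → ℝ) (b : Space n → ℝ → Space n) (D : Set (Space n)) :
    Prop :=
  ∀ δ > 0, ∃ T > 0, ∀ t ≥ T, ∀ x : Space n,
    (∀ y, Reach a b 0 t x y → ∃ q ∈ D, ‖y - x - t • q‖ ≤ δ * t) ∧
    ∀ q ∈ D, ∃ y, Reach a b 0 t x y ∧ ‖y - x - t • q‖ ≤ δ * t

namespace IsCoerciveField

theorem exists_mem_norm_sub_le_of_reach (h : IsCoerciveField a b α β η K)
    (hH : ∀ p, HasAsymptoticSpeed a b p (H p)) {δ B t : ℝ} (hδ : 0 ≤ δ) (hB : 0 ≤ B) (ht : 0 < t)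
    (hb : ∀ p : Space n, ‖p‖ ≤ 1 → |maxDisplacement a b 0 t p - t * H p| ≤ δ * t + B)
    {x y : Space n} (hr : Reach a b 0 t x y) :
    ∃ q ∈ supportedSet H, ‖y - x - t • q‖ ≤ δ * t + B := by
  obtain ⟨q, hq, hqz⟩ := exists_mem_supportedSet_norm_sub_le
    (fun p q => h.speed_add_le (hH p) (hH q) (hH (p + q))) (fun r hr p => h.speed_smul hH hr p)
    (z := t⁻¹ • (y - x)) (ε := t⁻¹ * (δ * t + B)) (by positivity) (fun p hp => by
      have h1 := h.inner_le_maxDisplacement ht.le hr p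
      have h2 := (abs_le.1 (hb p hp)).2
      rw [inner_smul_right, inv_mul_le_iff₀ ht, mul_add, mul_inv_cancel_left₀ ht.ne']
      linarith)
  refine ⟨q, hq, ?_⟩
  have e : y - x - t • q = t • (t⁻¹ • (y - x) - q) := by
    rw [smul_sub, smul_inv_smul₀ ht.ne']
  rw [e, norm_smul, Real.norm_of_nonneg ht.le]
  rwa [le_inv_mul_iff₀ ht] at hqz

/-- Steering towards `tq` in blocks, each time in the direction that reduces the error. -/
theorem exists_reach_sq_norm_le (h : IsCoerciveField a b α β η K) (hper : IsLatticePeriodic a b)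
    (hH : ∀ p, HasAsymptoticSpeed a b p (H p)) {R T : ℝ} (hT : 0 ≤ T) (hR0 : 0 ≤ R)
    (hR : ∀ p : Space n, ‖p‖ ≤ 1 → ∀ s t, 0 ≤ s → s ≤ t → t ≤ T →
      (t - s) * H p ≤ maxDisplacement a b s t p + R) {k : ℕ} (hk : 0 < k) (x : Space n)
    {q : Space n} (hq : q ∈ supportedSet H) :
    ∃ y, Reach a b 0 T x y ∧ ‖y - x - T • q‖ ^ 2 ≤
      k * (8 * β * T * (R + offsetBound n β η + 1) + (4 * β * (T / k)) ^ 2) := by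
  have hβ := h.beta_pos
  have hkr : (0 : ℝ) < k := by exact_mod_cast hk
  have hqn : ‖q‖ ≤ 2 * β :=
    norm_le_of_mem_supportedSet (by positivity) (fun p => h.speed_le_mul (hH p)) hq
  have hC := h.offsetBound_nonneg
  set d := T / k with hd
  have hd0 : 0 ≤ d := by positivity
  have hkd : k * d = T := by rw [hd]; field_simp
  -- In |e + w|² = |e|² + 2⟨e,w⟩ + |w|², with e the error so far and w that of the next block, the
  -- two terms bound 2⟨e,w⟩, using |e| ≤ 4βT, and |w|².
  set A := 8 * β * T * (R + offsetBound n β η + 1) + (4 * β * d) ^ 2 with hA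
  have key : ∀ i : ℕ, i ≤ k → ∃ y, Reach a b 0 (i * d) x y ∧
      ‖y - x - (i * d) • q‖ ^ 2 ≤ i * A := by
    intro i
    induction i with
    | zero => intro _; exact ⟨x, by simpa using h.reach_self le_rfl x, by simp⟩
    | succ i ih =>
      intro hi
      obtain ⟨y, hy, hyA⟩ := ih (by omega)
      set e := y - x - (i * d) • q with he
      -- The direction opposite to the error. A nearly maximal displacement in it is almost at least
      -- that of velocity q, because p·q ≤ H(p); hence ⟨e,w⟩ is at most |e| times a small quantity.
      -- If e = 0 then p = 0, which is harmless.
      set p := -(‖e‖⁻¹ • e) with hp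
      have hp1 : ‖p‖ ≤ 1 := by
        rw [hp, norm_neg, norm_smul, norm_inv, norm_norm]
        exact inv_mul_le_one
      have hid : (i : ℝ) * d ≤ (i + 1) * d := by linarith
      have hiT : ((i : ℝ) + 1) * d ≤ T := by
        rw [← hkd]; gcongr; exact_mod_cast hi
      obtain ⟨y', hy', hpy⟩ := h.exists_reach_inner_gt hper hid p y one_pos
      have h1 := hR p hp1 (i * d) ((i + 1) * d) (by positivity) hid hiT
      have e1 : ((i : ℝ) + 1) * d - i * d = d := by ring
      rw [e1] at h1
      have h2 := mul_le_mul_of_nonneg_left (hq p) hd0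
      have h3 : offsetBound n β η * ‖p‖ ≤ offsetBound n β η := mul_le_of_le_one_right hC hp1
      set w := y' - y - d • q with hw
      have h4 : -(R + offsetBound n β η + 1) ≤ inner ℝ p w := by
        rw [hw, inner_sub_right, inner_smul_right]; linarith
      have h5 : inner ℝ e w ≤ ‖e‖ * (R + offsetBound n β η + 1) := by
        have e2 : inner ℝ e w = -(‖e‖ * inner ℝ p w) := by
          rw [hp, inner_neg_left, real_inner_smul_left]
          rcases eq_or_ne ‖e‖ 0 with h0 | h0
          · rw [h0, norm_eq_zero.1 h0]; simp
          · field_simp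
        rw [e2]
        have := mul_le_mul_of_nonneg_left h4 (norm_nonneg e)
        linarith
      have h6 := h.norm_sub_le_of_reach hid hy'
      rw [e1] at h6
      have h7 : ‖w‖ ≤ 4 * β * d := by
        have := norm_sub_le (y' - y) (d • q)
        rw [norm_smul, Real.norm_of_nonneg hd0] at this
        have := mul_le_mul_of_nonneg_left hqn hd0
        linarith
      have h8 : ‖e‖ ≤ 4 * β * T := by
        have f1 := h.norm_sub_le_of_reach (by positivity) hy
        have f2 := norm_sub_le (y - x) ((i * d) • q)
        rw [norm_smul, Real.norm_of_nonneg (by positivity)] at f2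
        have f3 : (i * d) * ‖q‖ ≤ T * (2 * β) :=
          mul_le_mul (hid.trans hiT) hqn (norm_nonneg _) hT
        have f4 : 2 * β * (i * d - 0) ≤ 2 * β * T := by
          rw [sub_zero]; exact mul_le_mul_of_nonneg_left (hid.trans hiT) (by positivity)
        linarith
      refine ⟨y', ?_, ?_⟩
      · rw [Nat.cast_add, Nat.cast_one]
        exact h.reach_trans (by positivity) hid hy hy'
      · have e3 : y' - x - (((i + 1 : ℕ) : ℝ) * d) • q = e + w := by
          rw [he, hw]; push_cast; module
        rw [e3, norm_add_sq_real]
        have h9 : ‖w‖ ^ 2 ≤ (4 * β * d) ^ 2 := by gcongr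
        have h10 : ‖e‖ * (R + offsetBound n β η + 1) ≤ 4 * β * T * (R + offsetBound n β η + 1) := by
          gcongr
        push_cast
        linarith
  obtain ⟨y, hy, hyA⟩ := key k le_rfl
  rw [hkd] at hy hyA
  exact ⟨y, hy, hyA⟩

/-- The order of choice matters: k first, so that the block errors 16β²t²/k are below δ²t²/2; then
δ' small relative to k; then B, which depends on δ'; finally T, beyond which the terms linear in t
are negligible. -/
theorem reachApproximates (h : IsCoerciveField a b α β η K) (hper : IsLatticePeriodic a b)
    (hH : ∀ p, HasAsymptoticSpeed a b p (H p)) : ReachApproximates a b (supportedSet H) := by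
  intro δ hδ
  have hβ := h.beta_pos
  have hC := h.offsetBound_nonneg
  obtain ⟨k, hk⟩ := exists_nat_gt (16 * β ^ 2 / (δ ^ 2 / 2))
  have hkr : (0 : ℝ) < k := lt_of_le_of_lt (by positivity) hk
  have hk0 : 0 < k := by exact_mod_cast hkr
  rw [div_lt_iff₀ (by positivity)] at hk
  set δ' := min (δ / 2) (δ ^ 2 / (64 * β * k)) with hδ'
  have hδ'0 : 0 < δ' := by positivity
  have hδ'1 : δ' ≤ δ / 2 := min_le_left _ _
  have hδ'2 : 64 * β * k * δ' ≤ δ ^ 2 := by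
    have := min_le_right (δ / 2) (δ ^ 2 / (64 * β * k))
    rwa [← hδ', le_div_iff₀' (by positivity)] at this
  obtain ⟨B, hB0, hB⟩ := h.exists_abs_maxDisplacement_sub_le hper hH hδ'0
  set B' := 2 * B + 2 * offsetBound n β η + 1 with hB'
  have hB'0 : 0 < B' := by positivity
  refine ⟨max (2 * B / δ) (32 * β * k * B' / δ ^ 2) + 1, by positivity, fun t ht x => ⟨?_, ?_⟩⟩
  · intro y hr
    have ht1 : 2 * B / δ ≤ t := by linarith [le_max_left (2 * B / δ) (32 * β * k * B' / δ ^ 2)]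
    have ht0 : 0 < t := by
      have : 0 ≤ max (2 * B / δ) (32 * β * k * B' / δ ^ 2) := by positivity
      linarith
    rw [div_le_iff₀ hδ] at ht1
    obtain ⟨q, hq, hqd⟩ := h.exists_mem_norm_sub_le_of_reach hH hδ'0.le hB0 ht0
      (fun p hp => hB p hp t ht0.le) hr
    refine ⟨q, hq, hqd.trans ?_⟩
    have := mul_le_mul_of_nonneg_right hδ'1 ht0.le
    linarith
  · intro q hq
    have ht1 : 32 * β * k * B' / δ ^ 2 ≤ t := by
      linarith [le_max_right (2 * B / δ) (32 * β * k * B' / δ ^ 2)]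
    have ht0 : 0 < t := by
      have : 0 ≤ max (2 * B / δ) (32 * β * k * B' / δ ^ 2) := by positivity
      linarith
    rw [div_le_iff₀ (by positivity)] at ht1
    -- Subadditivity bounds the displacement on [s,r] from below by the difference of those on [0,r]
    -- and [0,s], both known up to δ't + B.
    obtain ⟨y, hy, hyA⟩ := h.exists_reach_sq_norm_le hper hH ht0.le
      (R := 2 * (δ' * t + B) + offsetBound n β η) (by positivity) (fun p hp s r hs hsr hrt => by
        have h1 := (abs_le.1 (hB p hp s hs)).2
        have h2 := (abs_le.1 (hB p hp r (hs.trans hsr))).1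
        have h3 := h.maxDisplacement_le_add hs hsr p
        have h4 := mul_le_mul_of_nonneg_left hrt hδ'0.le
        have h5 := mul_le_mul_of_nonneg_left (hsr.trans hrt) hδ'0.le
        linarith) hk0 x hq
    refine ⟨y, hy, ?_⟩
    refine le_of_sq_le_sq (hyA.trans ?_) (by positivity)
    have e1 : k * (8 * β * t * (2 * (δ' * t + B) + offsetBound n β η + offsetBound n β η + 1)
        + (4 * β * (t / k)) ^ 2) = (64 * β * k * δ') * t ^ 2 / 4 + (32 * β * k * B') * t / 4
          + (16 * β ^ 2 / k) * t ^ 2 := by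
      rw [hB']; field_simp; ring
    rw [e1]
    have f1 := mul_le_mul_of_nonneg_right hδ'2 (sq_nonneg t)
    have f2 := mul_le_mul_of_nonneg_right ht1 ht0.le
    have f3 : 16 * β ^ 2 / k ≤ δ ^ 2 / 2 := by rw [div_le_iff₀ hkr]; linarith
    have f4 := mul_le_mul_of_nonneg_right f3 (sq_nonneg t)
    have e2 : (δ * t) ^ 2 = δ ^ 2 * t ^ 2 := by ring
    have e3 : t * δ ^ 2 * t = δ ^ 2 * t ^ 2 := by ring
    rw [e2]
    linarith

end IsCoerciveField

end EffectiveSet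

/-! ### The random environment: stationarity, measurability and deterministic speeds. -/

section RandomField

variable {n : ℕ} {Ω : Type*} [MeasurableSpace Ω] {P : Measure Ω} {τ : ℤ → Ω → Ω}
  {a : Space n → ℝ → Ω → ℝ} {b : Space n → ℝ → Ω → Space n} {α β η : ℝ}

/-- A set invariant under `τ 1` is invariant under the whole group, because each `τ k` is an iterate
of `τ 1` or the inverse of one. -/
theorem IsErgodicGroup.ergodic_one [IsProbabilityMeasure P] (hτ : IsErgodicGroup P τ) :
    Ergodic (τ 1) P where
  toMeasurePreserving := hτ.measurePreserving 1
  aeconst_set {U} hU hinv := by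
    have hbij : ∀ k ω, τ (-k) (τ k ω) = ω ∧ τ k (τ (-k) ω) = ω := fun k ω => by
      rw [← hτ.map_add, ← hτ.map_add]; simp [hτ.map_zero]
    have hmem : ∀ ω, τ 1 ω ∈ U ↔ ω ∈ U := fun ω => by
      rw [← mem_preimage, hinv]
    have hnat : ∀ k : ℕ, ∀ ω, τ k ω ∈ U ↔ ω ∈ U := by
      intro k
      induction k with
      | zero => intro ω; simp [hτ.map_zero]
      | succ k ih =>
        intro ω
        rw [Nat.cast_add, Nat.cast_one, add_comm, hτ.map_add, hmem, ih]
    have hint : ∀ k : ℤ, ∀ ω, τ k ω ∈ U ↔ ω ∈ U := by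
      intro k ω
      obtain ⟨m, rfl | rfl⟩ := k.eq_nat_or_neg
      · exact hnat m ω
      · rw [← hnat m, (hbij m ω).2]
    have himg : ∀ k, τ k '' U = U := by
      intro k
      ext ω
      constructor
      · rintro ⟨ω', h, rfl⟩; exact (hint k ω').2 h
      · intro h; exact ⟨τ (-k) ω, (hint _ _).2 h, (hbij k ω).2⟩
    rw [Filter.eventuallyConst_set]
    rcases hτ.ergodic U hU himg with h | h
    · left; exact (prob_compl_eq_zero_iff hU).2 h
    · right; exact measure_eq_zero_iff_ae_notMem.1 h

theorem IsErgodicGroup.iterate_one (hτ : IsErgodicGroup P τ) (k : ℕ) : (τ 1)^[k] = τ k := by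
  induction k with
  | zero => ext ω; simp [hτ.map_zero]
  | succ k ih =>
    rw [Function.iterate_succ', ih]
    ext ω
    rw [Function.comp_apply, ← hτ.map_add, add_comm, Nat.cast_add, Nat.cast_one]

theorem IsPeriodicStationaryField.exists_norm_sub_le {F : Type*} [NormedAddCommGroup F]
    [MeasurableSpace F] {f : Space n → ℝ → Ω → F} (hf : IsPeriodicStationaryField τ f) (ω : Ω) :
    ∃ K : ℝ, 0 ≤ K ∧ ∀ x t y s, ‖f x t ω - f y s ω‖ ≤ K * (‖x - y‖ + |t - s|) := by
  obtain ⟨K, hK⟩ := hf.lipschitz ω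
  refine ⟨K, K.2, fun x t y s => ?_⟩
  rw [← dist_eq_norm]
  refine (hK.dist_le_mul (x, t) (y, s)).trans ?_
  gcongr
  rw [Prod.dist_eq, dist_eq_norm, Real.dist_eq]
  exact max_le_add_of_nonneg (norm_nonneg _) (abs_nonneg _)

/-- `K` varies with ω. This does no harm: the bounds for large times involve only n, β and η. -/
theorem exists_isCoerciveField (hA : AssumptionA τ a α β) (hB : AssumptionB τ b α η) (ω : Ω) :
    ∃ K, IsCoerciveField (fun x t => a x t ω) (fun x t => b x t ω) α β η K := by
  obtain ⟨K₁, h₁, hK₁⟩ := hA.field.exists_norm_sub_le ω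
  obtain ⟨K₂, h₂, hK₂⟩ := hB.field.exists_norm_sub_le ω
  refine ⟨max K₁ K₂, hB.eta_pos, fun x t => hA.lower x t ω, fun x t => hA.upper x t ω,
    fun x t => hB.small x t ω, le_max_of_le_left h₁, fun x t y s => ?_, fun x t y s => ?_⟩
  · exact (hK₁ x t y s).trans (mul_le_mul_of_nonneg_right (le_max_left _ _) (by positivity))
  · exact (hK₂ x t y s).trans (mul_le_mul_of_nonneg_right (le_max_right _ _) (by positivity))

theorem isLatticePeriodic_of_stationary (hτ : IsErgodicGroup P τ)
    (hA : AssumptionA τ a α β) (hB : AssumptionB τ b α η) (ω : Ω) :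
    IsLatticePeriodic (fun x t => a x t ω) (fun x t => b x t ω) := fun x l t => by
  have h1 := hA.field.stationary x l t 0 ω
  have h2 := hB.field.stationary x l t 0 ω
  rw [hτ.map_zero] at h1 h2
  exact ⟨by simpa using h1, by simpa using h2⟩

theorem stationary_time {F : Type*} [NormedAddCommGroup F] [MeasurableSpace F]
    {f : Space n → ℝ → Ω → F} (hf : IsPeriodicStationaryField τ f) (x : Space n) (t : ℝ) (k : ℤ)
    (ω : Ω) : f x t (τ k ω) = f x (t + k) ω := by
  have := hf.stationary x 0 t k ω
  have h0 : latticePoint (0 : Fin n → ℤ) = 0 := by ext i; simp [latticePoint]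
  rwa [h0, add_zero] at this

theorem reach_shift_iff (hA : AssumptionA τ a α β) (hB : AssumptionB τ b α η) (ω : Ω) (k : ℤ)
    {s t : ℝ} (hst : s ≤ t) (x y : Space n) :
    Reach (fun x t => a x t (τ k ω)) (fun x t => b x t (τ k ω)) s t x y ↔
      Reach (fun x t => a x t ω) (fun x t => b x t ω) (s + k) (t + k) x y := by
  constructor
  · intro h
    simpa using h.comp_affine (a' := fun x t => a x t ω) (b' := fun x t => b x t ω) (c := 1)
      (d := k) (w := 0) one_pos hst
      (fun z r => by simp [stationary_time hA.field]) (fun z r => by simp [stationary_time hB.field])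
  · intro h
    simpa using h.comp_affine (a' := fun x t => a x t (τ k ω)) (b' := fun x t => b x t (τ k ω))
      (c := 1) (d := -k) (w := 0) one_pos (by linarith)
      (fun z r => by simp [stationary_time hA.field]) (fun z r => by simp [stationary_time hB.field])

/-- This turns displacements over successive windows into values of one random variable along the
orbit of `τ 1`. -/
theorem maxDisplacement_shift (hA : AssumptionA τ a α β) (hB : AssumptionB τ b α η) (ω : Ω)
    (j N : ℕ) (p : Space n) :
    maxDisplacement (fun x t => a x t ω) (fun x t => b x t ω) j (j + N) p =
      maxDisplacement (fun x t => a x t (τ j ω)) (fun x t => b x t (τ j ω)) 0 N p := by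
  unfold maxDisplacement
  congr 1
  ext c
  simp only [mem_ofPred_eq, reach_shift_iff hA hB ω j (Nat.cast_nonneg N), zero_add,
    Int.cast_natCast]
  rw [add_comm]

/-- By the criterion with broken lines, superlevel sets are countable unions of finite intersections
of measurable events. That criterion needs a positive time, so N = 0 is treated apart. -/
theorem measurable_maxDisplacement (hA : AssumptionA τ a α β) (hB : AssumptionB τ b α η)
    (N : ℕ) (p : Space n) :
    Measurable fun ω => maxDisplacement (fun x t => a x t ω) (fun x t => b x t ω) 0 N p := by
  rcases Nat.eq_zero_or_pos N with rfl | hN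
  · have : (fun ω => maxDisplacement (fun x t => a x t ω) (fun x t => b x t ω) 0 (0 : ℕ) p) =
        fun _ => 0 := by
      ext ω
      obtain ⟨K, h⟩ := exists_isCoerciveField hA hB ω
      refine le_antisymm ?_ (h.maxDisplacement_nonneg (by simp) p)
      simpa using h.maxDisplacement_le_mul (s := 0) (t := (0 : ℕ)) (by simp) p
    rw [this]
    exact measurable_const
  · have hN : (0 : ℝ) < N := by exact_mod_cast hN
    have ha : ∀ x t, Measurable (a x t) := fun x t =>
      hA.field.measurable.comp (measurable_const (a := (x, t)) |>.prodMk measurable_id)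
    have hb : ∀ x t, Measurable (b x t) := fun x t =>
      hB.field.measurable.comp (measurable_const (a := (x, t)) |>.prodMk measurable_id)
    have hac : ∀ ω, Continuous fun z : Space n × ℝ => a z.1 z.2 ω := fun ω => by
      obtain ⟨K, hK⟩ := hA.field.lipschitz ω; exact hK.continuous
    have hbc : ∀ ω, Continuous fun z : Space n × ℝ => b z.1 z.2 ω := fun ω => by
      obtain ⟨K, hK⟩ := hB.field.lipschitz ω; exact hK.continuous
    refine measurable_of_Ioi fun c => ?_
    have : (fun ω => maxDisplacement (fun x t => a x t ω) (fun x t => b x t ω) 0 N p) ⁻¹' Ioi c =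
        ⋃ (M : ℕ), ⋃ (z : Fin (M + 1) → ℕ),
        ⋃ (_ : 0 < M ∧ c < inner ℝ p (TopologicalSpace.denseSeq (Space n) (z (Fin.last M))
          - TopologicalSpace.denseSeq (Space n) (z 0))),
        ⋂ i : Fin M, {ω | IsAdmissibleSegment (fun x t => a x t ω) (fun x t => b x t ω)
          (i * (N / M)) ((i + 1) * (N / M))
          (TopologicalSpace.denseSeq (Space n) (z i.castSucc))
          (TopologicalSpace.denseSeq (Space n) (z i.succ))} := by
      ext ω
      obtain ⟨K, h⟩ := exists_isCoerciveField hA hB ω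
      have e := h.exists_reach_lt_inner_iff hN p c
      simp only [mem_preimage, mem_Ioi, mem_iUnion, mem_iInter, mem_ofPred_eq, exists_prop]
      rw [← e]
      constructor
      · intro hc
        obtain ⟨_, ⟨x, y, hr, rfl⟩, hlt⟩ := exists_lt_of_lt_csSup
          (s := {c | ∃ x y, Reach (fun x t => a x t ω) (fun x t => b x t ω) 0 N x y ∧
            inner ℝ p (y - x) = c}) ⟨_, 0, 0, h.reach_self hN.le 0, rfl⟩ hc
        exact ⟨x, y, hr, hlt⟩
      · rintro ⟨x, y, hr, hlt⟩
        exact hlt.trans_le (h.inner_le_maxDisplacement hN.le hr p)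
    rw [this]
    refine MeasurableSet.iUnion fun M => MeasurableSet.iUnion fun z => MeasurableSet.iUnion fun _ =>
      MeasurableSet.iInter fun i => measurableSet_isAdmissibleSegment ha hb hac hbc ?_ _ _
    have : (0 : ℝ) ≤ N / M := by positivity
    linarith

theorem exists_ae_hasAsymptoticSpeed [IsProbabilityMeasure P] (hτ : IsErgodicGroup P τ)
    (hA : AssumptionA τ a α β) (hB : AssumptionB τ b α η) (p : Space n) :
    ∃ c, ∀ᵐ ω ∂P, HasAsymptoticSpeed (fun x t => a x t ω) (fun x t => b x t ω) p c := by
  set F : ℕ → Ω → ℝ := fun N ω =>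
    maxDisplacement (fun x t => a x t ω) (fun x t => b x t ω) 0 N p with hF
  set C := offsetBound n β η * ‖p‖ with hC
  -- In C + 2, the C is the defect of additivity, one unit absorbs the boundary terms of the
  -- averaging, which are at most k for large k, and one unit absorbs the error in Birkhoff's
  -- theorem.
  have hae : ∀ᵐ ω ∂P, ∀ N : ℕ, ∀ᶠ k : ℕ in atTop,
      |N * F k ω - k * ∫ ω, F N ω ∂P| ≤ (C + 2) * k := by
    refine ae_all_iff.2 fun N => ?_
    have hb : ∀ ω, |F N ω| ≤ 2 * β * N * ‖p‖ := fun ω => by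
      obtain ⟨K, h⟩ := exists_isCoerciveField hA hB ω
      rw [abs_of_nonneg (h.maxDisplacement_nonneg (Nat.cast_nonneg N) p)]
      simpa using h.maxDisplacement_le_mul (Nat.cast_nonneg N) p
    filter_upwards [ae_tendsto_birkhoffSum_div hτ.ergodic_one
      (measurable_maxDisplacement hA hB N p) hb] with ω hω
    obtain ⟨K, h⟩ := exists_isCoerciveField hA hB ω
    filter_upwards [hω 1 one_pos, tendsto_natCast_atTop_atTop.eventually_ge_atTop
      (N * (C + 4 * β * N * ‖p‖))] with k hk hk'
    have h1 := h.abs_mul_maxDisplacement_sub_sum_le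
      (isLatticePeriodic_of_stationary hτ hA hB ω) p N k
    have e : ∑ j ∈ Finset.range k,
        maxDisplacement (fun x t => a x t ω) (fun x t => b x t ω) j (j + N) p =
        birkhoffSum (τ 1) (F N) k ω := by
      refine Finset.sum_congr rfl fun j _ => ?_
      rw [hτ.iterate_one, maxDisplacement_shift hA hB]
    rw [e] at h1
    have h2 := abs_sub_le (N * F k ω) (birkhoffSum (τ 1) (F N) k ω) (k * ∫ ω, F N ω ∂P)
    linarith
  obtain ⟨ω₀, hω₀⟩ := hae.exists
  obtain ⟨H, hH⟩ := exists_forall_tendsto_div ⟨_, hω₀⟩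
  exact ⟨H, hae.mono fun ω hω => hH _ hω⟩

/-- Almost surely all directions have an asymptotic speed, which is not random. -/
theorem exists_ae_forall_hasAsymptoticSpeed [IsProbabilityMeasure P] (hτ : IsErgodicGroup P τ)
    (hA : AssumptionA τ a α β) (hB : AssumptionB τ b α η) :
    ∃ H : Space n → ℝ, ∀ᵐ ω ∂P, ∀ p,
      HasAsymptoticSpeed (fun x t => a x t ω) (fun x t => b x t ω) p (H p) := by
  choose H hH using fun p : Space n => exists_ae_hasAsymptoticSpeed hτ hA hB p
  refine ⟨H, ?_⟩
  have hlip : ∀ p q, |H p - H q| ≤ 2 * β * ‖p - q‖ := fun p q => by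
    obtain ⟨ω, h1, h2⟩ := ((hH p).and (hH q)).exists
    obtain ⟨K, h⟩ := exists_isCoerciveField hA hB ω
    exact h.abs_speed_sub_le h1 h2
  filter_upwards [ae_all_iff.2 fun i => hH (TopologicalSpace.denseSeq (Space n) i)] with ω hω
  obtain ⟨K, h⟩ := exists_isCoerciveField hA hB ω
  exact h.hasAsymptoticSpeed_of_dense (TopologicalSpace.denseRange_denseSeq _) hlip hω

end RandomField

/-! ### Comparison of viscosity solutions by doubling of variables. -/

section Comparison

variable {n : ℕ}

theorem HasDerivAt.comp_hasGradientAt {E : Type*} [NormedAddCommGroup E] [InnerProductSpace ℝ E]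
    [CompleteSpace E] {f : E → ℝ} {g : ℝ → ℝ} {g' : ℝ} {G x : E} (hg : HasDerivAt g g' (f x))
    (hf : HasGradientAt f G x) : HasGradientAt (fun y => g (f y)) (g' • G) x := by
  have := hg.comp_hasFDerivAt x hf.hasFDerivAt
  rw [hasGradientAt_iff_hasFDerivAt]
  refine HasFDerivAt.congr_fderiv (f := fun y => g (f y)) this ?_
  ext v
  simp

theorem hasGradientAt_norm_sub_sq (x y : Space n) :
    HasGradientAt (fun x => ‖x - y‖ ^ 2) ((2 : ℝ) • (x - y)) x := by
  rw [hasGradientAt_iff_hasFDerivAt]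
  have := ((hasFDerivAt_id x).sub_const y).norm_sq
  refine this.congr_fderiv ?_
  ext v
  simp

/-- A penalty that grows outside the backward light cone of `(x₀,t₀)` of speed `C`. -/
noncomputable def conePenalty (l δ A C : ℝ) (x₀ : Space n) (t₀ : ℝ) (z : Space n × ℝ) : ℝ :=
  l * z.2 + δ * Real.exp (A * (√(1 + ‖z.1 - x₀‖ ^ 2) - 1 + C * (z.2 - t₀)))

theorem contDiff_conePenalty (l δ A C : ℝ) (x₀ : Space n) (t₀ : ℝ) :
    ContDiff ℝ 1 (conePenalty l δ A C x₀ t₀) := by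
  unfold conePenalty
  have h1 : ContDiff ℝ 1 fun z : Space n × ℝ => √(1 + ‖z.1 - x₀‖ ^ 2) :=
    (contDiff_const.add ((contDiff_fst.sub contDiff_const).norm_sq ℝ)).sqrt fun z => by positivity
  fun_prop

theorem hasDerivAt_conePenalty (l δ A C : ℝ) (x₀ x : Space n) (t₀ t : ℝ) :
    HasDerivAt (fun s => conePenalty l δ A C x₀ t₀ (x, s))
      (l + C * (A * (δ * Real.exp (A * (√(1 + ‖x - x₀‖ ^ 2) - 1 + C * (t - t₀)))))) t := by
  unfold conePenalty
  have h1 : HasDerivAt (fun s => A * (√(1 + ‖x - x₀‖ ^ 2) - 1 + C * (s - t₀))) (A * (C * 1)) t :=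
    ((((hasDerivAt_id t).sub_const t₀).const_mul C).const_add _).const_mul A
  exact (((hasDerivAt_id t).const_mul l).add (h1.exp.const_mul δ)).congr_deriv (by ring)

/-- The function √(1 + |x|²) has gradient of norm at most one. With `hasDerivAt_conePenalty` this
shows ψ_t ≥ l + C|Dψ| for the penalty ψ, which is the strictness that comparison needs. -/
theorem exists_hasGradientAt_conePenalty (l C : ℝ) {δ A : ℝ} (hδ : 0 ≤ δ) (hA : 0 ≤ A)
    (x₀ x : Space n) (t₀ t : ℝ) :
    ∃ G, HasGradientAt (fun y => conePenalty l δ A C x₀ t₀ (y, t)) G x ∧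
      ‖G‖ ≤ A * (δ * Real.exp (A * (√(1 + ‖x - x₀‖ ^ 2) - 1 + C * (t - t₀)))) := by
  set r := √(1 + ‖x - x₀‖ ^ 2) with hr
  have hr0 : 0 < r := by positivity
  set E := δ * Real.exp (A * (r - 1 + C * (t - t₀))) with hE
  have hE0 : 0 ≤ E := by positivity
  have h1 : HasDerivAt (fun q : ℝ => l * t + δ * Real.exp (A * (√(1 + q) - 1 + C * (t - t₀))))
      (A * E / (2 * r)) (‖x - x₀‖ ^ 2) := by
    have e1 : HasDerivAt (fun q : ℝ => √(1 + q)) (1 / (2 * r)) (‖x - x₀‖ ^ 2) :=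
      ((hasDerivAt_id (‖x - x₀‖ ^ 2)).const_add 1).sqrt (by simp only [id]; positivity)
    have e2 := (((e1.sub_const 1).add_const (C * (t - t₀))).const_mul A).exp.const_mul δ
    exact (e2.const_add (l * t)).congr_deriv (by rw [hE, ← hr]; field_simp)
  refine ⟨_, h1.comp_hasGradientAt (f := fun y => ‖y - x₀‖ ^ 2) (hasGradientAt_norm_sub_sq x x₀), ?_⟩
  rw [smul_smul, norm_smul, Real.norm_of_nonneg (by positivity)]
  have h2 : ‖x - x₀‖ ≤ r := Real.le_sqrt_of_sq_le (by linarith)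
  calc A * E / (2 * r) * 2 * ‖x - x₀‖ ≤ A * E / (2 * r) * 2 * r := by gcongr
    _ = A * E := by field_simp

theorem IsCompact.exists_pos_forall_abs_sub_lt {X : Type*} [PseudoMetricSpace X] {S : Set X}
    (hS : IsCompact S) {f : X → ℝ} (hf : ContinuousOn f S) {κ : ℝ} (hκ : 0 < κ) :
    ∃ ρ > 0, ∀ z ∈ S, ∀ w ∈ S, dist z w < ρ → |f z - f w| < κ := by
  obtain ⟨ρ, hρ, h⟩ := Metric.uniformContinuousOn_iff.1
    (hS.uniformContinuousOn_of_continuous hf) κ hκ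
  exact ⟨ρ, hρ, fun z hz w hw hd => h z hz w hw hd⟩

/-- The quadratic coupling used for doubling the variables. -/
noncomputable def doublingTerm (N : ℝ) (z w : Space n × ℝ) : ℝ :=
  N * (‖z.1 - w.1‖ ^ 2 + (z.2 - w.2) ^ 2)

theorem contDiff_doublingTerm (N : ℝ) :
    ContDiff ℝ 1 fun zw : (Space n × ℝ) × (Space n × ℝ) => doublingTerm N zw.1 zw.2 := by
  unfold doublingTerm
  have h1 : ContDiff ℝ 1 fun zw : (Space n × ℝ) × (Space n × ℝ) => ‖zw.1.1 - zw.2.1‖ ^ 2 :=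
    ContDiff.norm_sq ℝ (by fun_prop)
  fun_prop

theorem hasDerivAt_doublingTerm (N : ℝ) (x : Space n) (t : ℝ) (w : Space n × ℝ) :
    HasDerivAt (fun r => doublingTerm N (x, r) w) (2 * N * (t - w.2)) t := by
  unfold doublingTerm
  have h1 : HasDerivAt (fun r => (r - w.2) ^ 2) (2 * (t - w.2)) t := by
    simpa using ((hasDerivAt_id' t).sub_const w.2).fun_pow 2
  exact ((h1.const_add (‖x - w.1‖ ^ 2)).const_mul N).congr_deriv (by ring)

theorem hasGradientAt_doublingTerm (N : ℝ) (x : Space n) (t : ℝ) (w : Space n × ℝ) :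
    HasGradientAt (fun y => doublingTerm N (y, t) w) ((2 * N) • (x - w.1)) x := by
  have h1 : HasDerivAt (fun q : ℝ => N * (q + (t - w.2) ^ 2)) N (‖x - w.1‖ ^ 2) := by
    simpa using ((hasDerivAt_id (‖x - w.1‖ ^ 2)).add_const ((t - w.2) ^ 2)).const_mul N
  have := h1.comp_hasGradientAt (f := fun y => ‖y - w.1‖ ^ 2) (hasGradientAt_norm_sub_sq x w.1)
  rwa [smul_smul, mul_comm N 2] at this

theorem doublingTerm_comm (N : ℝ) (z w : Space n × ℝ) :
    doublingTerm N z w = doublingTerm N w z := by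
  unfold doublingTerm
  rw [norm_sub_rev, ← neg_sub w.2, neg_sq]

/-- The comparison of the two viscosity inequalities at a maximum of the doubled functional. -/
theorem le_of_isLocalMax_doubling {H : Space n → ℝ → Space n → ℝ} {C K : ℝ} (hC0 : 0 ≤ C)
    (hC : ∀ x t p q, H x t p - H x t q ≤ C * ‖p - q‖)
    (hK : ∀ x y t s p, H x t p - H y s p ≤ K * (‖x - y‖ + |t - s|) * ‖p‖)
    {u₀ v₀ : Space n → ℝ} {u v : Space n × ℝ → ℝ}
    (hu : IsViscositySolution H u₀ u) (hv : IsViscositySolution H v₀ v)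
    {l δ A N t₀ : ℝ} {x₀ : Space n} (hδ : 0 ≤ δ) (hA : 0 ≤ A) (hN : 0 ≤ N) (hK0 : 0 ≤ K)
    {z w : Space n × ℝ} (hz : 0 < z.2) (hw : 0 < w.2)
    (hmax : IsLocalMax (fun z' => u z' - (conePenalty l δ A C x₀ t₀ z' + doublingTerm N z' w)) z)
    (hmin : IsLocalMin (fun w' => v w' - -doublingTerm N w' z) w) :
    l ≤ 4 * K * doublingTerm N z w := by
  obtain ⟨x, t⟩ := z
  obtain ⟨y, s⟩ := w
  obtain ⟨G, hG, hGn⟩ := exists_hasGradientAt_conePenalty l C hδ hA x₀ x t₀ t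
  have hdt := (hasDerivAt_conePenalty l δ A C x₀ x t₀ t).add (hasDerivAt_doublingTerm N x t (y, s))
  have hdx : HasGradientAt (fun x' => conePenalty l δ A C x₀ t₀ (x', t) +
      doublingTerm N (x', t) (y, s)) (G + (2 * N) • (x - y)) x := by
    have := hG.hasFDerivAt.add (hasGradientAt_doublingTerm N x t (y, s)).hasFDerivAt
    rw [hasGradientAt_iff_hasFDerivAt, map_add]
    exact this
  have hds := (hasDerivAt_doublingTerm N y s (x, t)).neg
  have hdy : HasGradientAt (fun y' => -doublingTerm N (y', s) (x, t)) ((2 * N) • (x - y)) y := by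
    have := (hasGradientAt_doublingTerm N y s (x, t)).hasFDerivAt.neg
    rw [hasGradientAt_iff_hasFDerivAt]
    refine this.congr_fderiv ?_
    rw [← map_neg, ← smul_neg, neg_sub]
  have h1 := hu.subsolution (fun z' => conePenalty l δ A C x₀ t₀ z' + doublingTerm N z' (y, s)) x t hz
    ((contDiff_conePenalty l δ A C x₀ t₀).add ((contDiff_doublingTerm N).comp
      (contDiff_id.prodMk contDiff_const))).contDiffAt hmax
  have h2 := hv.supersolution (fun w' => -doublingTerm N w' (x, t)) y s hw
    ((contDiff_doublingTerm N).comp (contDiff_id.prodMk contDiff_const)).neg.contDiffAt hmin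
  rw [hdx.gradient] at h1
  rw [hdy.gradient] at h2
  have e1 := hdt.deriv
  have e2 := hds.deriv
  simp only [Pi.add_def, Pi.neg_def] at e1 e2
  rw [e1] at h1
  rw [e2] at h2
  set p := (2 * N) • (x - y) with hp
  -- On subtracting the two inequalities the time derivatives 2N(t-s) cancel, and C‖G‖ is paid for
  -- by the time derivative of the penalty. What is left is l ≤ K(|x-y| + |t-s|)|p| with |p| =
  -- 2N|x-y|.
  have h3 := hK y x s t p
  have h4 := hC x t p (G + p)
  have h5 : ‖p - (G + p)‖ = ‖G‖ := by rw [sub_add_cancel_right, norm_neg]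
  rw [h5] at h4
  have h6 := mul_le_mul_of_nonneg_left hGn hC0
  have h7 : ‖p‖ = 2 * N * ‖x - y‖ := by
    rw [hp, norm_smul, Real.norm_of_nonneg (by positivity)]
  rw [h7, norm_sub_rev y x, abs_sub_comm s t] at h3
  have h8 : K * (‖x - y‖ + |t - s|) * (2 * N * ‖x - y‖) ≤ 4 * K * doublingTerm N (x, t) (y, s) := by
    have e : (‖x - y‖ + |t - s|) * (2 * ‖x - y‖) ≤ 4 * (‖x - y‖ ^ 2 + (t - s) ^ 2) := by
      rw [← sq_abs (t - s)]
      nlinarith [sq_nonneg (‖x - y‖ - |t - s|), sq_nonneg ‖x - y‖, sq_nonneg |t - s|]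
    have := mul_le_mul_of_nonneg_left e (mul_nonneg hK0 hN)
    unfold doublingTerm
    calc _ = K * N * ((‖x - y‖ + |t - s|) * (2 * ‖x - y‖)) := by ring
      _ ≤ _ := this
      _ = _ := by ring
  linarith

set_option maxHeartbeats 1000000 in
/-- Comparison of continuous viscosity solutions, with no assumption on their growth. -/
theorem IsViscositySolution.le {H : Space n → ℝ → Space n → ℝ} {C K : ℝ} (hC0 : 0 < C)
    (hC : ∀ x t p q, H x t p - H x t q ≤ C * ‖p - q‖) (hK0 : 0 ≤ K)
    (hK : ∀ x y t s p, H x t p - H y s p ≤ K * (‖x - y‖ + |t - s|) * ‖p‖)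
    {u₀ : Space n → ℝ} {u v : Space n × ℝ → ℝ}
    (hu : IsViscositySolution H u₀ u) (hv : IsViscositySolution H u₀ v) {x₀ : Space n} {t₀ : ℝ}
    (ht₀ : 0 ≤ t₀) : u (x₀, t₀) ≤ v (x₀, t₀) := by
  by_contra hcon
  push Not at hcon
  have ht₀' : 0 < t₀ := by
    rcases ht₀.eq_or_lt with rfl | h
    · rw [hu.initial, hv.initial] at hcon
      exact absurd hcon (lt_irrefl _)
    · exact h
  obtain ⟨m, hm⟩ : ∃ m, m = u (x₀, t₀) - v (x₀, t₀) := ⟨_, rfl⟩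
  have hm0 : 0 < m := by rw [hm]; linarith
  -- S exceeds by a margin of 1 the region where the penalty allows z to lie. As dist z w < 1, both
  -- maximum points avoid the lateral and upper boundary.
  set S : Set (Space n × ℝ) := Metric.closedBall x₀ (3 + C * t₀) ×ˢ Icc 0 (t₀ + 1 / C + 1) with hS
  have hSc : IsCompact S := (isCompact_closedBall _ _).prod isCompact_Icc
  have hSsub : S ⊆ univ ×ˢ Ici 0 := fun z hz => ⟨mem_univ _, hz.2.1⟩
  have huc := hu.continuousOn.mono hSsub
  have hvc := hv.continuousOn.mono hSsub
  have hz₀ : (x₀, t₀) ∈ S := by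
    refine ⟨Metric.mem_closedBall_self (by positivity), ht₀, ?_⟩
    have : 0 < 1 / C := by positivity
    simp only; linarith
  obtain ⟨M, hM⟩ : ∃ M, ∀ z ∈ S, |u z| ≤ M ∧ |v z| ≤ M := by
    obtain ⟨M₁, h₁⟩ := hSc.exists_bound_of_continuousOn huc
    obtain ⟨M₂, h₂⟩ := hSc.exists_bound_of_continuousOn hvc
    exact ⟨max M₁ M₂, fun z hz => ⟨(h₁ z hz).trans (le_max_left _ _),
      (h₂ z hz).trans (le_max_right _ _)⟩⟩
  have hM0 : 0 ≤ M := (abs_nonneg _).trans (hM _ hz₀).1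
  -- The penalty at (x₀,t₀) is l t₀ + δ = m/2, so the doubled functional is at least m/2 at its
  -- maximum.
  set l := m / (4 * t₀) with hl
  have hl0 : 0 < l := by positivity
  set δ := m / 4 with hδ
  have hδ0 : 0 < δ := by positivity
  -- Where the bracket in the exponent is at least 1, the penalty exceeds 2M ≥ u - v; the maximum
  -- cannot lie there.
  obtain ⟨A, hA0, hA⟩ : ∃ A : ℝ, 0 < A ∧ 2 * M < δ * Real.exp A := by
    refine ⟨2 * M / δ + 1, by positivity, ?_⟩
    have := Real.add_one_le_exp (2 * M / δ + 1)
    rw [← div_lt_iff₀' hδ0]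
    linarith
  set ψ := conePenalty l δ A C x₀ t₀ with hψ
  have hψc : Continuous ψ := (contDiff_conePenalty l δ A C x₀ t₀).continuous
  have hψ₀ : ψ (x₀, t₀) = m / 2 := by
    simp only [hψ, conePenalty, hl, hδ]
    simp
    field_simp
    norm_num
  have hψpos : ∀ z ∈ S, δ * Real.exp (A * (√(1 + ‖z.1 - x₀‖ ^ 2) - 1 + C * (z.2 - t₀))) ≤ ψ z :=
    fun z hz => by
      simp only [hψ, conePenalty]
      have := mul_nonneg hl0.le hz.2.1
      linarith
  -- The bound m/4 rules out maximum points at time zero, where u = v; the other bound contradicts l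
  -- ≤ 4K * `doublingTerm` at the end.
  set κ := min (m / 4) (l / (8 * (K + 1))) with hκ
  have hκ0 : 0 < κ := by positivity
  obtain ⟨ρ₁, hρ₁, hu1⟩ := hSc.exists_pos_forall_abs_sub_lt huc hκ0
  obtain ⟨ρ₂, hρ₂, hv1⟩ := hSc.exists_pos_forall_abs_sub_lt hvc hκ0
  obtain ⟨ρ₃, hρ₃, hw1⟩ := hSc.exists_pos_forall_abs_sub_lt (huc.sub hψc.continuousOn) hκ0
  set ρ := min 1 (min ρ₁ (min ρ₂ ρ₃)) with hρ
  have hρ0 : 0 < ρ := by positivity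
  -- At the maximum the coupling is at most 2M, hence less than Nρ², which forces dist z w < ρ.
  set N := (2 * M + 1) / ρ ^ 2 with hN
  have hN0 : 0 < N := by positivity
  have hNρ : N * ρ ^ 2 = 2 * M + 1 := by rw [hN]; field_simp
  obtain ⟨⟨z, w⟩, ⟨hzS, hwS⟩, hmaxon⟩ := (hSc.prod hSc).exists_isMaxOn ⟨((x₀, t₀), (x₀, t₀)), hz₀, hz₀⟩
    (f := fun zw => u zw.1 - v zw.2 - ψ zw.1 - doublingTerm N zw.1 zw.2) (by
      refine ((ContinuousOn.sub ?_ ?_).sub (hψc.comp continuous_fst).continuousOn).sub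
        (contDiff_doublingTerm N).continuous.continuousOn
      · exact huc.comp continuousOn_fst fun zw h => h.1
      · exact hvc.comp continuousOn_snd fun zw h => h.2)
  have hmx : ∀ z' ∈ S, ∀ w' ∈ S, u z' - v w' - ψ z' - doublingTerm N z' w' ≤
      u z - v w - ψ z - doublingTerm N z w := fun z' hz' w' hw' => hmaxon (a := (z', w')) ⟨hz', hw'⟩
  have hdself : ∀ z : Space n × ℝ, doublingTerm N z z = 0 := fun z => by simp [doublingTerm]
  have hdnn : 0 ≤ doublingTerm N z w := by unfold doublingTerm; positivity
  have hval := hmx _ hz₀ _ hz₀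
  rw [hdself, hψ₀, ← hm] at hval
  have hψz := hψpos z hzS
  have hψz0 : 0 < δ * Real.exp (A * (√(1 + ‖z.1 - x₀‖ ^ 2) - 1 + C * (z.2 - t₀))) := by positivity
  have hMz := abs_le.1 (hM z hzS).1
  have hMw := abs_le.1 (hM w hwS).2
  have hcone : √(1 + ‖z.1 - x₀‖ ^ 2) - 1 + C * (z.2 - t₀) < 1 := by
    have h1 : δ * Real.exp (A * (√(1 + ‖z.1 - x₀‖ ^ 2) - 1 + C * (z.2 - t₀))) < δ * Real.exp A := by
      linarith [hMz.2, hMw.1]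
    have h2 := Real.exp_lt_exp.1 (lt_of_mul_lt_mul_left h1 hδ0.le)
    by_contra hc
    push Not at hc
    have := mul_le_mul_of_nonneg_left hc hA0.le
    linarith
  have hzt0 := hzS.2.1
  have hsq1 : ‖z.1 - x₀‖ ≤ √(1 + ‖z.1 - x₀‖ ^ 2) := Real.le_sqrt_of_sq_le (by linarith)
  have hsq2 : 1 ≤ √(1 + ‖z.1 - x₀‖ ^ 2) := Real.one_le_sqrt.2 (by nlinarith [norm_nonneg (z.1 - x₀)])
  have hzx : ‖z.1 - x₀‖ < 2 + C * t₀ := by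
    have := mul_nonneg hC0.le hzt0
    linarith
  have hzt : z.2 < t₀ + 1 / C := by
    have h1 : C * (z.2 - t₀) < 1 := by linarith
    have h2 : z.2 - t₀ < 1 / C := by rw [lt_div_iff₀ hC0]; linarith
    linarith
  have hdist : dist z w < ρ := by
    have h1 : doublingTerm N z w < N * ρ ^ 2 := by rw [hNρ]; linarith [hMz.2, hMw.1]
    have h2 := lt_of_mul_lt_mul_left h1 hN0.le
    rw [Prod.dist_eq, dist_eq_norm, Real.dist_eq, max_lt_iff]
    constructor
    · exact lt_of_pow_lt_pow_left₀ 2 hρ0.le (by nlinarith [sq_nonneg (z.2 - w.2)])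
    · refine lt_of_pow_lt_pow_left₀ 2 hρ0.le ?_
      rw [sq_abs]
      nlinarith [sq_nonneg ‖z.1 - w.1‖]
  have hd1 : dist z w < 1 := hdist.trans_le (min_le_left _ _)
  have hdu := hu1 z hzS w hwS (hdist.trans_le ((min_le_right _ _).trans (min_le_left _ _)))
  have hdv := hv1 z hzS w hwS (hdist.trans_le
    ((min_le_right _ _).trans ((min_le_right _ _).trans (min_le_left _ _))))
  have hdw := hw1 z hzS w hwS (hdist.trans_le
    ((min_le_right _ _).trans ((min_le_right _ _).trans (min_le_right _ _))))
  have hκm : κ ≤ m / 4 := min_le_left _ _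
  have hzpos : 0 < z.2 := by
    rcases hzt0.eq_or_lt with h0 | h0
    · exfalso
      have e : z = (z.1, 0) := by rw [h0]
      have e' : u z = v z := by rw [e, hu.initial, hv.initial]
      have := (abs_lt.1 hdv).2
      linarith
    · exact h0
  have hwpos : 0 < w.2 := by
    rcases hwS.2.1.eq_or_lt with h0 | h0
    · exfalso
      have e : w = (w.1, 0) := by rw [h0]
      have e' : u w = v w := by rw [e, hu.initial, hv.initial]
      have := (abs_lt.1 hdu).2
      linarith
    · exact h0
  rw [Prod.dist_eq, dist_eq_norm, Real.dist_eq, max_lt_iff] at hd1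
  have hopen : ∀ z' : Space n × ℝ, 0 < z'.2 → ‖z'.1 - x₀‖ < 3 + C * t₀ → z'.2 < t₀ + 1 / C + 1 →
      S ∈ 𝓝 z' := fun z' h1 h2 h3 => by
    refine prod_mem_nhds (Metric.closedBall_mem_nhds_of_mem ?_) (Icc_mem_nhds h1 h3)
    rwa [Metric.mem_ball, dist_eq_norm]
  have hzn : S ∈ 𝓝 z := hopen z hzpos (by linarith) (by linarith)
  have hwn : S ∈ 𝓝 w := by
    refine hopen w hwpos ?_ ?_
    · have := norm_sub_le_norm_sub_add_norm_sub w.1 z.1 x₀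
      rw [norm_sub_rev w.1 z.1] at this
      linarith [hd1.1]
    · linarith [(abs_lt.1 hd1.2).1]
  have key := le_of_isLocalMax_doubling (l := l) (δ := δ) (A := A) (N := N) (t₀ := t₀) (x₀ := x₀)
    hC0.le hC hK hu hv hδ0.le hA0.le hN0.le hK0 hzpos hwpos
    (by
      filter_upwards [hzn] with z' hz'
      have := hmx z' hz' w hwS
      simp only [← hψ]
      linarith)
    (by
      filter_upwards [hwn] with w' hw'
      have := hmx z hzS w' hw'
      rw [doublingTerm_comm N w z, doublingTerm_comm N w' z]
      linarith)
  -- Comparing with the pair (w,w) improves the bound on the coupling from 2M to the oscillation of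
  -- u - ψ between z and w.
  have h1 := hmx w hwS w hwS
  rw [hdself] at h1
  have h2 := (abs_lt.1 hdw).2
  simp only [Pi.sub_apply] at h2
  have h3 : doublingTerm N z w ≤ κ := by linarith
  have h4 : κ ≤ l / (8 * (K + 1)) := min_le_right _ _
  rw [le_div_iff₀ (by positivity)] at h4
  have h5 := mul_le_mul_of_nonneg_left h3 (by positivity : 0 ≤ 4 * K)
  have h6 := mul_nonneg hK0 hκ0.le
  linarith

theorem IsViscositySolution.eqOn {H : Space n → ℝ → Space n → ℝ} {C K : ℝ} (hC0 : 0 < C)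
    (hC : ∀ x t p q, H x t p - H x t q ≤ C * ‖p - q‖) (hK0 : 0 ≤ K)
    (hK : ∀ x y t s p, H x t p - H y s p ≤ K * (‖x - y‖ + |t - s|) * ‖p‖)
    {u₀ : Space n → ℝ} {u v : Space n × ℝ → ℝ}
    (hu : IsViscositySolution H u₀ u) (hv : IsViscositySolution H u₀ v) :
    EqOn u v (univ ×ˢ Ici 0) := fun ⟨_, _⟩ hz =>
  le_antisymm (hu.le hC0 hC hK0 hK hv hz.2) (hv.le hC0 hC hK0 hK hu hz.2)

end Comparison

/-! ### Value functions as viscosity solutions. -/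

section ValueFunction

variable {n : ℕ}

/-- A family of transition relations `R s t y x` (from `y` at time `s` to `x` at time `t`) whose
infinitesimal speed in direction `p` is `H(x,t,p)`. -/
structure IsReachSystem (H : Space n → ℝ → Space n → ℝ)
    (R : ℝ → ℝ → Space n → Space n → Prop) (C K : ℝ) : Prop where
  C_nonneg : 0 ≤ C
  K_nonneg : 0 ≤ K
  exists_reach : ∀ t x, 0 ≤ t → ∃ y, R 0 t y x
  trans : ∀ s m t x y z, 0 ≤ s → s ≤ m → m ≤ t → R s m x y → R m t y z → R s t x z
  split : ∀ s m t x z, 0 ≤ s → s ≤ m → m ≤ t → R s t x z → ∃ y, R s m x y ∧ R m t y z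
  speed : ∀ s t y x, 0 ≤ s → s ≤ t → R s t y x → ‖x - y‖ ≤ C * (t - s)
  inner_le : ∀ s t y x p, 0 ≤ s → s ≤ t → R s t y x →
    inner ℝ p (x - y) ≤ (t - s) * (H x t p + K * (t - s) * ‖p‖)
  exists_velocity : ∀ x t p θ, 0 < θ → ∃ v : Space n, H x t p - θ ≤ inner ℝ p v ∧
    ∃ h₀ > 0, ∀ d, 0 ≤ d → d ≤ h₀ → R (t - d) t (x - d • v) x
  perturb : ∀ T δ, 0 < δ → ∃ ρ > 0, ∀ t t' x x' y, 0 ≤ t → t ≤ T → 0 ≤ t' → t' ≤ T →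
    |t - t'| ≤ ρ → ‖x - x'‖ ≤ ρ → R 0 t y x → ∃ y', ‖y' - y‖ ≤ δ ∧ R 0 t' y' x'

/-- The value function: the least initial value from which `(x,t)` can be reached. -/
noncomputable def valueFunction (R : ℝ → ℝ → Space n → Space n → Prop) (u₀ : Space n → ℝ)
    (z : Space n × ℝ) : ℝ :=
  sInf {c | ∃ y, R 0 z.2 y z.1 ∧ u₀ y = c}

theorem exists_hasFDerivAt_prod {φ : Space n × ℝ → ℝ} {x : Space n} {t : ℝ}
    (hφ : ContDiffAt ℝ 1 φ (x, t)) :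
    ∃ L : Space n × ℝ →L[ℝ] ℝ, HasFDerivAt φ L (x, t) ∧ ∀ v r, L (v, r) =
      inner ℝ (gradient (fun y => φ (y, t)) x) v + r * deriv (fun s => φ (x, s)) t := by
  have hL := (hφ.differentiableAt one_ne_zero).hasFDerivAt
  refine ⟨_, hL, fun v r => ?_⟩
  set L := fderiv ℝ φ (x, t)
  have h1 : HasFDerivAt (fun y => φ (y, t)) (L.comp (ContinuousLinearMap.inl ℝ (Space n) ℝ)) x :=
    HasFDerivAt.comp x (g := φ) (f := fun y => (y, t)) hL (hasFDerivAt_prodMk_left x t)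
  have h2 : HasFDerivAt (fun s => φ (x, s)) (L.comp (ContinuousLinearMap.inr ℝ (Space n) ℝ)) t :=
    HasFDerivAt.comp t (g := φ) (f := fun s => (x, s)) hL (hasFDerivAt_prodMk_right x t)
  have e1 : inner ℝ (gradient (fun y => φ (y, t)) x) v = L (v, 0) := by
    rw [gradient, InnerProductSpace.toDual_symm_apply, h1.fderiv]; simp
  have e2 : deriv (fun s => φ (x, s)) t = L (0, 1) := by
    rw [h2.hasDerivAt.deriv]; simp
  rw [e1, e2, ← smul_eq_mul, ← map_smul, ← map_add]
  simp

namespace IsReachSystem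

variable {H : Space n → ℝ → Space n → ℝ} {R : ℝ → ℝ → Space n → Space n → Prop} {C K : ℝ}
  {u₀ : Space n → ℝ}

theorem valueFunction_le (h : IsReachSystem H R C K) (hu₀ : Continuous u₀) {t : ℝ} (ht : 0 ≤ t)
    {x y : Space n} (hr : R 0 t y x) : valueFunction R u₀ (x, t) ≤ u₀ y := by
  refine csInf_le ?_ ⟨y, hr, rfl⟩
  obtain ⟨M, hM⟩ := (isCompact_closedBall x (C * t)).exists_bound_of_continuousOn hu₀.continuousOn
  refine ⟨-M, ?_⟩
  rintro _ ⟨y, hy, rfl⟩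
  have h1 := h.speed 0 t y x le_rfl ht hy
  rw [sub_zero, norm_sub_rev] at h1
  exact (abs_le.1 (hM y (by rwa [Metric.mem_closedBall, dist_eq_norm]))).1

theorem exists_lt_valueFunction (h : IsReachSystem H R C K) {t : ℝ} (ht : 0 ≤ t) (x : Space n)
    {κ : ℝ} (hκ : 0 < κ) : ∃ y, R 0 t y x ∧ u₀ y < valueFunction R u₀ (x, t) + κ := by
  obtain ⟨y, hy⟩ := h.exists_reach t x ht
  obtain ⟨_, ⟨z, hz, rfl⟩, hlt⟩ := exists_lt_of_csInf_lt
    (s := {c | ∃ y, R 0 t y x ∧ u₀ y = c}) ⟨_, y, hy, rfl⟩ (lt_add_of_pos_right _ hκ)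
  exact ⟨z, hz, hlt⟩

/-- One half of the dynamic programming principle; the other half, `exists_reach_valueFunction_lt`,
holds up to κ since the infimum need not be attained. -/
theorem valueFunction_le_of_reach (h : IsReachSystem H R C K) (hu₀ : Continuous u₀) {s t : ℝ}
    (hs : 0 ≤ s) (hst : s ≤ t) {x y : Space n} (hr : R s t y x) :
    valueFunction R u₀ (x, t) ≤ valueFunction R u₀ (y, s) := by
  refine le_of_forall_pos_le_add fun κ hκ => ?_
  obtain ⟨z, hz, hlt⟩ := h.exists_lt_valueFunction (u₀ := u₀) hs y hκ
  exact (h.valueFunction_le hu₀ (hs.trans hst) (h.trans 0 s t z y x le_rfl hs hst hz hr)).trans hlt.le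

theorem exists_reach_valueFunction_lt (h : IsReachSystem H R C K) (hu₀ : Continuous u₀) {s t : ℝ}
    (hs : 0 ≤ s) (hst : s ≤ t) (x : Space n) {κ : ℝ} (hκ : 0 < κ) :
    ∃ z, R s t z x ∧ valueFunction R u₀ (z, s) < valueFunction R u₀ (x, t) + κ := by
  obtain ⟨y, hy, hlt⟩ := h.exists_lt_valueFunction (u₀ := u₀) (hs.trans hst) x hκ
  obtain ⟨z, h1, h2⟩ := h.split 0 s t y x le_rfl hs hst hy
  exact ⟨z, h2, (h.valueFunction_le hu₀ hs h1).trans_lt hlt⟩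

theorem continuousOn_valueFunction (h : IsReachSystem H R C K) (hu₀ : UniformContinuous u₀) :
    ContinuousOn (valueFunction R u₀) (univ ×ˢ Ici 0) := by
  rintro ⟨x, t⟩ ⟨-, ht⟩
  rw [Metric.continuousWithinAt_iff]
  intro κ hκ
  obtain ⟨δ, hδ, hmod⟩ := Metric.uniformContinuous_iff.1 hu₀ (κ / 4) (by positivity)
  obtain ⟨ρ, hρ, hpert⟩ := h.perturb (t + 1) (δ / 2) (by positivity)
  have key : ∀ s t' x x', 0 ≤ s → s ≤ t + 1 → 0 ≤ t' → t' ≤ t + 1 → |s - t'| ≤ ρ → ‖x - x'‖ ≤ ρ →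
      valueFunction R u₀ (x', t') ≤ valueFunction R u₀ (x, s) + κ / 2 := by
    intro s t' x x' h1 h2 h3 h4 h5 h6
    obtain ⟨y, hy, hlt⟩ := h.exists_lt_valueFunction (u₀ := u₀) h1 x (by positivity : 0 < κ / 4)
    obtain ⟨y', hy', hr⟩ := hpert s t' x x' y h1 h2 h3 h4 h5 h6 hy
    have e1 := h.valueFunction_le hu₀.continuous h3 hr
    have e2 := hmod (a := y') (b := y) (by rw [dist_eq_norm]; linarith)
    rw [Real.dist_eq] at e2
    linarith [(abs_lt.1 e2).2]
  refine ⟨min ρ 1, by positivity, ?_⟩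
  rintro ⟨x', t'⟩ ⟨-, ht'⟩ hd
  rw [Prod.dist_eq, max_lt_iff, dist_eq_norm, Real.dist_eq] at hd
  simp only at hd
  have hd1 := hd.1.le.trans (min_le_left _ _)
  have hd2 := hd.2.le.trans (min_le_left _ _)
  have hd3 := hd.2.le.trans (min_le_right _ _)
  have ht1 : t ≤ t + 1 := by linarith
  have ht2 : t' ≤ t + 1 := by linarith [(abs_le.1 hd3).2]
  have e1 := key t' t x' x ht' ht2 ht ht1 hd2 hd1
  have e2 := key t t' x x' ht ht1 ht' ht2 (by rwa [abs_sub_comm]) (by rwa [norm_sub_rev])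
  rw [Real.dist_eq, abs_lt]
  constructor <;> linarith

theorem isViscositySolution_valueFunction (h : IsReachSystem H R C K)
    (hu₀ : UniformContinuous u₀) : IsViscositySolution H u₀ (valueFunction R u₀) where
  continuousOn := h.continuousOn_valueFunction hu₀
  initial x := by
    have heq : ∀ y, R 0 0 y x → y = x := fun y hy => by
      have := h.speed 0 0 y x le_rfl le_rfl hy
      rw [sub_self, mul_zero, norm_le_zero_iff, sub_eq_zero] at this
      exact this.symm
    obtain ⟨y, hy⟩ := h.exists_reach 0 x le_rfl
    obtain rfl := heq y hy
    refine le_antisymm (h.valueFunction_le hu₀.continuous le_rfl hy) ?_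
    refine le_csInf ⟨_, y, hy, rfl⟩ ?_
    rintro _ ⟨z, hz, rfl⟩
    rw [heq z hz]
  subsolution φ x t ht hφ hmax := by
    obtain ⟨L, hL, hLe⟩ := exists_hasFDerivAt_prod hφ
    set p := gradient (fun y => φ (y, t)) x
    set c := deriv (fun s => φ (x, s)) t
    refine le_of_forall_pos_le_add fun θ hθ => ?_
    -- The value does not increase along the segment of velocity v ending at (x,t). With the local
    -- maximum, φ has a nonnegative slope when this segment is followed backwards.
    obtain ⟨v, hv, h₀, hh₀, hr⟩ := h.exists_velocity x t p θ hθ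
    have hline : HasDerivAt (fun d : ℝ => ((x - d • v, t - d) : Space n × ℝ)) (-v, -1) 0 := by
      have h1 : HasDerivAt (fun d : ℝ => x - d • v) (-v) 0 := by
        simpa using ((hasDerivAt_id (0 : ℝ)).smul_const v).const_sub x
      exact h1.prodMk ((hasDerivAt_id (0 : ℝ)).const_sub t)
    have hg : HasDerivAt (fun d : ℝ => φ (x - d • v, t - d)) (L (-v, -1)) 0 := by
      refine HasFDerivAt.comp_hasDerivAt (l := φ) 0 ?_ hline
      simpa using hL
    have hslope := (hasDerivWithinAt_iff_tendsto_slope' (s := Ioi 0) (by simp)).1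
      hg.hasDerivWithinAt
    have hge : 0 ≤ L (-v, -1) := by
      refine ge_of_tendsto hslope ?_
      have hmax' : ∀ᶠ d in 𝓝 (0 : ℝ), valueFunction R u₀ (x - d • v, t - d) - φ (x - d • v, t - d)
          ≤ valueFunction R u₀ (x, t) - φ (x, t) := by
        have : Tendsto (fun d : ℝ => ((x - d • v, t - d) : Space n × ℝ)) (𝓝 0) (𝓝 (x, t)) := by
          simpa using hline.continuousAt.tendsto
        exact this.eventually hmax
      filter_upwards [self_mem_nhdsWithin, nhdsWithin_le_nhds hmax',
        nhdsWithin_le_nhds (Iio_mem_nhds hh₀), nhdsWithin_le_nhds (Iio_mem_nhds ht)]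
        with d hd hm hd1 hd2
      have hd : 0 < d := hd
      have h1 := h.valueFunction_le_of_reach hu₀.continuous (sub_nonneg.2 (le_of_lt hd2))
        (by linarith) (hr d hd.le (le_of_lt hd1))
      rw [slope_def_field]
      simp only [zero_smul, sub_zero]
      exact div_nonneg (by linarith) hd.le
    rw [hLe, inner_neg_right] at hge
    linarith
  supersolution φ x t ht hφ hmin := by
    obtain ⟨L, hL, hLe⟩ := exists_hasFDerivAt_prod hφ
    set p := gradient (fun y => φ (y, t)) x
    set c := deriv (fun s => φ (x, s)) t
    have hC := h.C_nonneg
    have hK := h.K_nonneg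
    refine le_of_forall_pos_le_add fun θ hθ => ?_
    have hlo := hL.isLittleO.bound (c := θ / (2 * (C + 1))) (by positivity)
    obtain ⟨r, hr, hball⟩ := Metric.eventually_nhds_iff.1 (hlo.and hmin)
    -- The step d keeps the earlier point in the ball where φ is nearly linear, and makes d²(1 +
    -- K‖p‖), from the near-optimality error d² and the speed bound, at most θd/2. The linearization
    -- error takes the other θd/2.
    set d := min (t / 2) (min (r / (2 * (C + 1))) (θ / (2 * (1 + K * ‖p‖)))) with hd
    have hd0 : 0 < d := by positivity
    have hdt : d ≤ t := (min_le_left _ _).trans (by linarith)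
    have hdr : d * (2 * (C + 1)) ≤ r := by
      rw [← le_div_iff₀ (by positivity)]
      exact (min_le_right _ _).trans (min_le_left _ _)
    have hdθ : d * (2 * (1 + K * ‖p‖)) ≤ θ := by
      rw [← le_div_iff₀ (by positivity)]
      exact (min_le_right _ _).trans (min_le_right _ _)
    obtain ⟨z, hz, hlt⟩ := h.exists_reach_valueFunction_lt hu₀.continuous (sub_nonneg.2 hdt)
      (sub_le_self t hd0.le) x (pow_pos hd0 2)
    have h1 := h.speed _ _ _ _ (sub_nonneg.2 hdt) (sub_le_self t hd0.le) hz
    have h2 := h.inner_le _ _ _ _ p (sub_nonneg.2 hdt) (sub_le_self t hd0.le) hz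
    rw [sub_sub_cancel] at h1 h2
    have hnorm : ‖((z, t - d) : Space n × ℝ) - (x, t)‖ ≤ (C + 1) * d := by
      rw [Prod.norm_def, Prod.fst_sub, Prod.snd_sub]
      refine max_le ?_ ?_
      · rw [norm_sub_rev]; simp only; linarith
      · simp only [sub_sub_cancel_left, norm_neg, Real.norm_of_nonneg hd0.le]
        nlinarith
    obtain ⟨h3, h4⟩ := hball (y := (z, t - d)) (by
      rw [dist_eq_norm]
      refine hnorm.trans_lt ?_
      have : 0 < (C + 1) * d := by positivity
      linarith)
    have h5 : ‖φ (z, t - d) - φ (x, t) - L ((z, t - d) - (x, t))‖ ≤ θ / 2 * d := by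
      refine h3.trans ?_
      calc _ ≤ θ / (2 * (C + 1)) * ((C + 1) * d) := by gcongr
        _ = θ / 2 * d := by field_simp
    have h6 : L ((z, t - d) - (x, t)) = -inner ℝ p (x - z) - d * c := by
      rw [Prod.mk_sub_mk, hLe, ← neg_sub x z, inner_neg_right]; ring
    rw [h6, Real.norm_eq_abs] at h5
    have h7 := (abs_le.1 h5).1
    simp only at h4
    have h8 : 0 ≤ d * (c + H x t p + θ) := by
      have e1 := mul_le_mul_of_nonneg_left hdθ hd0.le
      nlinarith
    exact nonneg_of_mul_nonneg_right h8 hd0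

end IsReachSystem

theorem IsCoerciveField.isReachSystem {a : Space n → ℝ → ℝ} {b : Space n → ℝ → Space n}
    {α β η K : ℝ} (h : IsCoerciveField a b α β η K) :
    IsReachSystem (controlHamiltonian a b) (Reach a b) (2 * β) (2 * K * (2 * β + 1)) where
  C_nonneg := by have := h.beta_pos; positivity
  K_nonneg := by have := h.beta_pos; have := h.K_nonneg; positivity
  exists_reach t x ht := ⟨x, h.reach_self ht x⟩
  trans s m t x y z _ hsm hmt h1 h2 := h.reach_trans hsm hmt h1 h2
  split s m t x z _ hsm hmt hr := hr.split hsm hmt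
  speed s t y x _ hst hr := h.norm_sub_le_of_reach hst hr
  inner_le s t y x p _ hst hr := h.inner_sub_le_of_reach hst hr p
  exists_velocity x t p θ hθ := h.exists_reach_of_segment x t p hθ
  perturb T δ hδ := by
    have hβ := h.beta_pos
    obtain ⟨ρ, hρ, hp⟩ := h.exists_reach_of_norm_sub_le T hδ
    refine ⟨ρ / (1 + 2 * β), by positivity, fun t t' x x' y ht htT ht' htT' htt hxx hr => ?_⟩
    rw [le_div_iff₀ (by positivity)] at htt hxx
    -- A later time t' is met by standing still at x'. For an earlier one the path is cut at t',
    -- where it is within 2β(t - t') of x.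
    rcases le_total t t' with hle | hle
    · obtain ⟨y', hy', hr'⟩ := hp 0 t ht (by linarith) x y x' hr (by
        rw [norm_sub_rev]; nlinarith [norm_nonneg (x - x')])
      exact ⟨y', hy', h.reach_trans ht hle hr' (h.reach_self hle x')⟩
    · obtain ⟨z, h1, h2⟩ := hr.split ht' hle
      have h3 := h.norm_sub_le_of_reach hle h2
      rw [abs_of_nonneg (sub_nonneg.2 hle)] at htt
      exact hp 0 t' ht' (by linarith) z y x' h1 (by
        have e : x' - z = (x - z) - (x - x') := by abel
        rw [e]
        have := norm_sub_le (x - z) (x - x')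
        have hρ2 : 2 * β * (t - t') + ‖x - x'‖ ≤ ρ := by
          have e1 : (t - t') ≤ ρ / (1 + 2 * β) := by rw [le_div_iff₀ (by positivity)]; exact htt
          have e2 : ‖x - x'‖ ≤ ρ / (1 + 2 * β) := by rw [le_div_iff₀ (by positivity)]; exact hxx
          have e3 := mul_le_mul_of_nonneg_left e1 (mul_pos two_pos hβ).le
          have e4 : 2 * β * (ρ / (1 + 2 * β)) + ρ / (1 + 2 * β) = ρ := by field_simp; ring
          linarith
        linarith)

/-- Motion with a velocity from `D`. -/
def DriftReach (D : Set (Space n)) (s t : ℝ) (y x : Space n) : Prop :=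
  ∃ q ∈ D, x = y + (t - s) • q

theorem inner_le_effectiveHamiltonian {D : Set (Space n)} (hD : IsCompact D) (p : Space n)
    {q : Space n} (hq : q ∈ D) : inner ℝ p q ≤ effectiveHamiltonian D p :=
  le_csSup (hD.image (by fun_prop)).bddAbove (mem_image_of_mem _ hq)

theorem exists_inner_eq_effectiveHamiltonian {D : Set (Space n)} (hD : IsCompact D)
    (hne : D.Nonempty) (p : Space n) : ∃ q ∈ D, inner ℝ p q = effectiveHamiltonian D p := by
  obtain ⟨q, hq, he⟩ := (hD.image (f := fun q => inner ℝ p q) (by fun_prop)).sSup_mem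
    (hne.image _)
  exact ⟨q, hq, he⟩

theorem effectiveHamiltonian_sub_le {D : Set (Space n)} (hD : IsCompact D) (hne : D.Nonempty)
    {C : ℝ} (hC : ∀ q ∈ D, ‖q‖ ≤ C) (p p' : Space n) :
    effectiveHamiltonian D p - effectiveHamiltonian D p' ≤ C * ‖p - p'‖ := by
  obtain ⟨q, hq, he⟩ := exists_inner_eq_effectiveHamiltonian hD hne p
  have h1 := inner_le_effectiveHamiltonian hD p' hq
  have h2 := real_inner_le_norm (p - p') q
  rw [inner_sub_left] at h2
  have h3 := mul_le_mul_of_nonneg_left (hC q hq) (norm_nonneg (p - p'))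
  linarith

/-- Convexity of D is what makes the relation transitive: two successive constant velocities are
replaced by their time average. -/
theorem isReachSystem_driftReach {D : Set (Space n)} (hD : IsCompact D) (hconv : Convex ℝ D)
    (hne : D.Nonempty) {C : ℝ} (hC0 : 0 ≤ C) (hC : ∀ q ∈ D, ‖q‖ ≤ C) :
    IsReachSystem (fun _ _ p => effectiveHamiltonian D p) (DriftReach D) C 0 where
  C_nonneg := hC0
  K_nonneg := le_rfl
  exists_reach t x _ := by
    obtain ⟨q, hq⟩ := hne
    exact ⟨x - (t - 0) • q, q, hq, by abel⟩
  trans s m t x y z _ hsm hmt := by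
    rintro ⟨q₁, h₁, rfl⟩ ⟨q₂, h₂, rfl⟩
    rcases (hsm.trans hmt).eq_or_lt with h | h
    · obtain rfl : s = m := by linarith
      obtain rfl : s = t := h
      exact ⟨q₁, h₁, by simp⟩
    · have hp : 0 < t - s := sub_pos.2 h
      refine ⟨((m - s) / (t - s)) • q₁ + ((t - m) / (t - s)) • q₂, hconv h₁ h₂
        (div_nonneg (sub_nonneg.2 hsm) hp.le) (div_nonneg (sub_nonneg.2 hmt) hp.le)
        (by field_simp; ring), ?_⟩
      rw [smul_add, smul_smul, smul_smul, mul_div_cancel₀ _ hp.ne', mul_div_cancel₀ _ hp.ne',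
        add_assoc]
  split s m t x z _ _ _ := by
    rintro ⟨q, hq, rfl⟩
    exact ⟨_, ⟨q, hq, rfl⟩, q, hq, by module⟩
  speed s t y x _ hst := by
    rintro ⟨q, hq, rfl⟩
    rw [add_sub_cancel_left, norm_smul, Real.norm_of_nonneg (sub_nonneg.2 hst), mul_comm]
    exact mul_le_mul_of_nonneg_right (hC q hq) (sub_nonneg.2 hst)
  inner_le s t y x p _ hst := by
    rintro ⟨q, hq, rfl⟩
    rw [add_sub_cancel_left, inner_smul_right, zero_mul, zero_mul, add_zero]
    exact mul_le_mul_of_nonneg_left (inner_le_effectiveHamiltonian hD p hq) (sub_nonneg.2 hst)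
  exists_velocity x t p θ hθ := by
    obtain ⟨q, hq, he⟩ := exists_inner_eq_effectiveHamiltonian hD hne p
    exact ⟨q, by linarith, 1, one_pos, fun d _ _ => ⟨q, hq, by simp⟩⟩
  perturb T δ hδ := by
    refine ⟨δ / (1 + C), by positivity, fun t t' x x' y _ _ _ _ htt hxx => ?_⟩
    rintro ⟨q, hq, rfl⟩
    refine ⟨x' - (t' - 0) • q, ?_, q, hq, by abel⟩
    have e : x' - (t' - 0) • q - y = (t - t') • q - (y + (t - 0) • q - x') := by module
    rw [e]
    have h1 := norm_sub_le ((t - t') • q) (y + (t - 0) • q - x')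
    rw [norm_smul, Real.norm_eq_abs] at h1
    have h2 := mul_le_mul htt (hC q hq) (norm_nonneg _) (by positivity)
    have h3 : δ / (1 + C) * C + δ / (1 + C) = δ := by field_simp; ring
    linarith

end ValueFunction

/-! ### Scaling and the passage to the limit. -/

section Homogenization

variable {n : ℕ} {a : Space n → ℝ → ℝ} {b : Space n → ℝ → Space n} {α β η K : ℝ}

theorem IsReachSystem.valueFunction_le_add {H H' : Space n → ℝ → Space n → ℝ}
    {R R' : ℝ → ℝ → Space n → Space n → Prop} {C K C' K' : ℝ} (h : IsReachSystem H R C K)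
    (h' : IsReachSystem H' R' C' K') {u₀ : Space n → ℝ} (hu₀ : Continuous u₀) {δ κ : ℝ}
    (hmod : ∀ y y', ‖y - y'‖ ≤ δ → |u₀ y - u₀ y'| ≤ κ) {x : Space n} {t : ℝ} (ht : 0 ≤ t)
    (hR : ∀ y, R 0 t y x → ∃ y', R' 0 t y' x ∧ ‖y - y'‖ ≤ δ) :
    valueFunction R' u₀ (x, t) ≤ valueFunction R u₀ (x, t) + κ := by
  refine le_of_forall_pos_le_add fun ε hε => ?_
  obtain ⟨y, hy, hlt⟩ := h.exists_lt_valueFunction (u₀ := u₀) ht x hε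
  obtain ⟨y', hy', hd⟩ := hR y hy
  have h1 := h'.valueFunction_le hu₀ ht hy'
  have h2 := (abs_le.1 (hmod y y' hd)).1
  linarith

/-- The field with oscillations on the scale `ε`. -/
noncomputable def rescale {F : Type*} (ε : ℝ) (f : Space n → ℝ → F) (x : Space n) (t : ℝ) : F :=
  f (ε⁻¹ • x) (t / ε)

theorem rescale_dist_le {ε : ℝ} (hε : 0 < ε) (x y : Space n) (t s : ℝ) :
    K * (‖ε⁻¹ • x - ε⁻¹ • y‖ + |t / ε - s / ε|) = K / ε * (‖x - y‖ + |t - s|) := by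
  rw [← smul_sub, norm_smul, ← sub_div, abs_div, norm_inv, Real.norm_of_nonneg hε.le,
    abs_of_pos hε]
  field_simp

theorem IsCoerciveField.rescale (h : IsCoerciveField a b α β η K) {ε : ℝ} (hε : 0 < ε) :
    IsCoerciveField (rescale ε a) (rescale ε b) α β η (K / ε) where
  eta_pos := h.eta_pos
  lower x t := h.lower _ _
  upper x t := h.upper _ _
  small x t := h.small _ _
  K_nonneg := div_nonneg h.K_nonneg hε.le
  lip_a x t y s := by rw [← rescale_dist_le hε]; exact h.lip_a _ _ _ _
  lip_b x t y s := by rw [← rescale_dist_le hε]; exact h.lip_b _ _ _ _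

theorem reach_rescale_iff {ε : ℝ} (hε : 0 < ε) {t : ℝ} (ht : 0 ≤ t) (x y : Space n) :
    Reach (rescale ε a) (rescale ε b) 0 t x y ↔ Reach a b 0 (t / ε) (ε⁻¹ • x) (ε⁻¹ • y) := by
  constructor
  · intro h
    simpa [div_eq_inv_mul] using h.comp_affine (a' := a) (b' := b) (c := ε⁻¹) (d := 0) (w := 0)
      (inv_pos.2 hε) ht (fun z r => by simp [rescale, div_eq_inv_mul])
      (fun z r => by simp [rescale, div_eq_inv_mul])
  · intro h
    have := h.comp_affine (a' := rescale ε a) (b' := rescale ε b) (c := ε) (d := 0) (w := 0)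
      hε (by positivity) (fun z r => by simp [rescale, hε.ne'])
      (fun z r => by simp [rescale, hε.ne'])
    simpa [hε.ne', mul_div_cancel₀] using this

theorem IsCoerciveField.isWellPosed_controlHamiltonian (h : IsCoerciveField a b α β η K)
    {u₀ : Space n → ℝ} (hu₀ : UniformContinuous u₀) : IsWellPosed (controlHamiltonian a b) u₀ :=
  ⟨⟨_, h.isReachSystem.isViscositySolution_valueFunction hu₀⟩, fun _ _ hu hv =>
    hu.eqOn (C := 2 * β) (K := 2 * K) (by have := h.beta_pos; positivity)
      h.controlHamiltonian_sub_le (by have := h.K_nonneg; positivity)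
      h.controlHamiltonian_sub_le' hv⟩

theorem isWellPosed_effectiveHamiltonian {D : Set (Space n)} (hD : IsCompact D)
    (hconv : Convex ℝ D) (hne : D.Nonempty) {C : ℝ} (hC0 : 0 < C) (hC : ∀ q ∈ D, ‖q‖ ≤ C)
    {u₀ : Space n → ℝ} (hu₀ : UniformContinuous u₀) :
    IsWellPosed (fun _ _ p => effectiveHamiltonian D p) u₀ :=
  ⟨⟨_, (isReachSystem_driftReach hD hconv hne hC0.le hC).isViscositySolution_valueFunction hu₀⟩,
    fun _ _ hu hv => hu.eqOn (C := C) (K := 0) hC0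
      (fun _ _ p q => effectiveHamiltonian_sub_le hD hne hC p q) le_rfl (by simp) hv⟩

/-- The backward reachable sets on the scale `ε` converge to those of the effective motion. -/
theorem ReachApproximates.exists_forall_rescale {D : Set (Space n)} (hD : ReachApproximates a b D)
    (h : IsCoerciveField a b α β η K) (hDb : ∀ q ∈ D, ‖q‖ ≤ 2 * β) {T δ₁ : ℝ} (hT : 0 < T)
    (hδ₁ : 0 < δ₁) :
    ∃ ε₀ > 0, ∀ ε, 0 < ε → ε < ε₀ → ∀ (x : Space n) (t : ℝ), 0 ≤ t → t ≤ T → D.Nonempty →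
      (∀ y, Reach (rescale ε a) (rescale ε b) 0 t y x → ∃ q ∈ D, ‖x - y - t • q‖ ≤ δ₁) ∧
      ∀ q ∈ D, ∃ y, Reach (rescale ε a) (rescale ε b) 0 t y x ∧ ‖x - y - t • q‖ ≤ δ₁ := by
  have hη := h.eta_pos
  have hβ := h.beta_pos
  set δ := min (η / 2) (min (δ₁ / T) (δ₁ * η / (2 * β * T))) with hδ
  have hδ0 : 0 < δ := by positivity
  have hδ1 : δ ≤ η / 2 := min_le_left _ _
  have hδ2 : δ * T ≤ δ₁ := by
    rw [← le_div_iff₀ hT]; exact (min_le_right _ _).trans (min_le_left _ _)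
  have hδ3 : δ * (2 * β * T) ≤ δ₁ * η := by
    rw [← le_div_iff₀ (by positivity)]; exact (min_le_right _ _).trans (min_le_right _ _)
  obtain ⟨T', hT', happ⟩ := hD δ hδ0
  refine ⟨δ₁ / (8 * β * T'), by positivity, fun ε hε hεlt x t ht htT hne => ?_⟩
  have hε' := h.rescale hε
  rw [lt_div_iff₀ (by positivity)] at hεlt
  -- For such short times both motions stay within δ₁ of each other by the speed bound. Otherwise
  -- the microscopic time s is at least 2T', so that T' still remains after a final correction phase
  -- is set aside.
  rcases le_total t (2 * T' * ε) with hsmall | hlarge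
  · have hts : 2 * β * t + t * (2 * β) ≤ δ₁ := by
      have := mul_le_mul_of_nonneg_left hsmall (by positivity : 0 ≤ 4 * β)
      linarith
    have hq : ∀ q ∈ D, ∀ y, Reach (_root_.rescale ε a) (_root_.rescale ε b) 0 t y x →
        ‖x - y - t • q‖ ≤ δ₁ := by
      intro q hq y hy
      have h1 := hε'.norm_sub_le_of_reach ht hy
      have h2 := norm_sub_le (x - y) (t • q)
      rw [norm_smul, Real.norm_of_nonneg ht] at h2
      have h3 := mul_le_mul_of_nonneg_left (hDb q hq) ht
      linarith
    obtain ⟨q₀, hq₀⟩ := hne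
    exact ⟨fun y hy => ⟨q₀, hq₀, hq q₀ hq₀ y hy⟩, fun q hqD =>
      ⟨x, hε'.reach_self ht x, hq q hqD x (hε'.reach_self ht x)⟩⟩
  · set s := t / ε with hs
    have hεs : ε * s = t := by rw [hs]; field_simp
    have hsT : 2 * T' ≤ s := by rw [hs, le_div_iff₀ hε]; exact hlarge
    have hs0 : 0 < s := by linarith
    have hscale : ∀ y q, ‖x - y - t • q‖ = ε * ‖ε⁻¹ • x - ε⁻¹ • y - s • q‖ := by
      intro y q
      rw [← Real.norm_of_nonneg hε.le, ← norm_smul, Real.norm_of_nonneg hε.le, smul_sub, smul_sub,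
        smul_inv_smul₀ hε.ne', smul_inv_smul₀ hε.ne', smul_smul, hεs]
    constructor
    · intro y hy
      rw [reach_rescale_iff hε ht] at hy
      obtain ⟨q, hq, hqd⟩ := (happ s (by linarith) _).1 _ hy
      refine ⟨q, hq, ?_⟩
      rw [hscale]
      have h1 := mul_le_mul_of_nonneg_left hqd hε.le
      have h2 := mul_le_mul_of_nonneg_left htT hδ0.le
      have e : ε * (δ * s) = δ * t := by rw [← hεs]; ring
      linarith
    · intro q hq
      -- The approximation fixes the starting point, whereas here the end point is prescribed. The
      -- path therefore starts from Y, misses the target by at most δs = ηr, and closes the gap in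
      -- the last time r by controllability.
      set r := s * (δ / η) with hr
      have hr0 : 0 ≤ r := by positivity
      have hηr : η * r = δ * s := by rw [hr]; field_simp
      have hrs : r ≤ s / 2 := by
        have : δ / η ≤ 1 / 2 := by rw [div_le_iff₀ hη]; linarith
        rw [hr]; nlinarith
      set Y := ε⁻¹ • x - (s - r) • q with hY
      obtain ⟨z, hz, hzd⟩ := (happ (s - r) (by linarith) Y).2 q hq
      have h1 : Reach a b (s - r) s z (ε⁻¹ • x) := by
        refine h.reach_of_norm_sub_le (by linarith) ?_
        rw [sub_sub_cancel, hηr, norm_sub_rev]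
        have e : z - ε⁻¹ • x = z - Y - (s - r) • q := by rw [hY]; abel
        rw [e]
        refine hzd.trans ?_
        gcongr
        linarith
      have h2 := h.reach_trans (by linarith) (by linarith) hz h1
      refine ⟨ε • Y, ?_, ?_⟩
      · rw [reach_rescale_iff hε ht, inv_smul_smul₀ hε.ne']
        exact h2
      · rw [hscale, inv_smul_smul₀ hε.ne']
        have e : ε⁻¹ • x - Y - s • q = -(r • q) := by rw [hY]; module
        rw [e, norm_neg, norm_smul, Real.norm_of_nonneg hr0]
        have h3 : ε * (r * ‖q‖) ≤ ε * (r * (2 * β)) := by gcongr; exact hDb q hq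
        refine h3.trans ?_
        have e2 : ε * (r * (2 * β)) = δ * (2 * β * t) / η := by rw [hr, ← hεs]; field_simp
        rw [e2, div_le_iff₀ hη]
        refine le_trans ?_ hδ3
        gcongr

theorem ReachApproximates.tendstoLocallyUniformlyOn {D : Set (Space n)}
    (hD : ReachApproximates a b D) (h : IsCoerciveField a b α β η K) (hDc : IsCompact D)
    (hconv : Convex ℝ D) (hne : D.Nonempty) (hDb : ∀ q ∈ D, ‖q‖ ≤ 2 * β) {u₀ : Space n → ℝ}
    (hu₀ : UniformContinuous u₀) {u : ℝ → Space n × ℝ → ℝ} {ubar : Space n × ℝ → ℝ}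
    (hu : ∀ ε, 0 < ε → IsViscositySolution (driftHamiltonian a b ε) u₀ (u ε))
    (hubar : IsViscositySolution (fun _ _ p => effectiveHamiltonian D p) u₀ ubar) :
    TendstoLocallyUniformlyOn u ubar (𝓝[>] 0) (univ ×ˢ Ici 0) := by
  have hβ := h.beta_pos
  have hsys' := isReachSystem_driftReach hDc hconv hne (by positivity) hDb
  rw [Metric.tendstoLocallyUniformlyOn_iff]
  rintro κ hκ ⟨x₀, t₀⟩ ⟨-, ht₀⟩
  have ht₀ : 0 ≤ t₀ := ht₀
  obtain ⟨δ, hδ, hmod⟩ := Metric.uniformContinuous_iff.1 hu₀ (κ / 2) (half_pos hκ)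
  have hmod' : ∀ y y', ‖y - y'‖ ≤ δ / 2 → |u₀ y - u₀ y'| ≤ κ / 2 := fun y y' hy => by
    have := hmod (a := y) (b := y') (by rw [dist_eq_norm]; linarith)
    exact this.le
  obtain ⟨ε₀, hε₀, hclose⟩ := hD.exists_forall_rescale h hDb (T := t₀ + 1) (by linarith)
    (half_pos hδ)
  refine ⟨{z | z.2 < t₀ + 1} ∩ univ ×ˢ Ici 0, inter_mem (mem_nhdsWithin_of_mem_nhds
    ((isOpen_lt continuous_snd continuous_const).mem_nhds (by simp))) self_mem_nhdsWithin, ?_⟩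
  filter_upwards [Ioo_mem_nhdsGT hε₀] with ε hε
  rintro ⟨x, t⟩ ⟨htT, hz⟩
  have ht : 0 ≤ t := hz.2
  have htT : t < t₀ + 1 := htT
  have hε' := h.rescale hε.1
  have hsys := hε'.isReachSystem
  obtain ⟨h1, h2⟩ := hclose ε hε.1 hε.2 x t ht htT.le hne
  -- Uniqueness replaces arbitrary solutions by value functions.
  have eu : u ε (x, t) = valueFunction (Reach (rescale ε a) (rescale ε b)) u₀ (x, t) :=
    (hε'.isWellPosed_controlHamiltonian hu₀).2 _ _ (hu ε hε.1)
      (hsys.isViscositySolution_valueFunction hu₀) hz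
  have eubar : ubar (x, t) = valueFunction (DriftReach D) u₀ (x, t) :=
    (isWellPosed_effectiveHamiltonian hDc hconv hne (by positivity) hDb hu₀).2 _ _ hubar
      (hsys'.isViscositySolution_valueFunction hu₀) hz
  have f1 := hsys.valueFunction_le_add hsys' hu₀.continuous hmod' ht (x := x) (fun y hy => by
    obtain ⟨q, hq, hqd⟩ := h1 y hy
    refine ⟨x - t • q, ⟨q, hq, by simp⟩, ?_⟩
    have e : y - (x - t • q) = -(x - y - t • q) := by abel
    rwa [e, norm_neg])
  have f2 := hsys'.valueFunction_le_add hsys hu₀.continuous hmod' ht (x := x) (by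
    rintro y ⟨q, hq, hx⟩
    obtain ⟨y', hy', hyd⟩ := h2 q hq
    refine ⟨y', hy', ?_⟩
    have e : y - y' = x - y' - t • q := by
      rw [hx, sub_zero]; abel
    rwa [e])
  rw [eu, eubar, Real.dist_eq]
  refine lt_of_le_of_lt (abs_le.2 ⟨?_, ?_⟩) (half_lt_self hκ) <;> linarith

theorem norm_le_of_mem_unitCell {x : Space n} (hx : x ∈ unitCell n) : ‖x‖ ≤ √n := by
  rw [EuclideanSpace.norm_eq]
  refine Real.sqrt_le_sqrt ?_
  have : ∀ i : Fin n, ‖x i‖ ^ 2 ≤ 1 := fun i => by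
    rw [Real.norm_of_nonneg (hx i).1]
    exact pow_le_one₀ (hx i).1 (hx i).2
  simpa using Finset.sum_le_sum fun i (_ : i ∈ Finset.univ) => this i

theorem ReachApproximates.tendsto_iSup_hausdorffEDist {D : Set (Space n)}
    (hD : ReachApproximates a b D) :
    Tendsto (fun t : ℝ => ⨆ x ∈ unitCell n,
      Metric.hausdorffEDist (t⁻¹ • reachableSet a b t x) D) atTop (𝓝 0) := by
  rw [ENNReal.tendsto_nhds_zero]
  intro ε hε
  obtain ⟨δ, hδ0, hδε⟩ := ENNReal.lt_iff_exists_nnreal_btwn.1 hε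
  have hδ : (0 : ℝ) < δ := by exact_mod_cast hδ0
  obtain ⟨T, hT, happ⟩ := hD (δ / 2) (half_pos hδ)
  filter_upwards [eventually_ge_atTop T, eventually_ge_atTop (√n / (δ / 2))] with t ht ht'
  have ht0 : 0 < t := hT.trans_le ht
  rw [div_le_iff₀ (half_pos hδ)] at ht'
  refine iSup₂_le fun x hx => le_trans ?_ hδε.le
  have hxn := norm_le_of_mem_unitCell hx
  -- The starting point has norm at most √n, which is negligible after division by t.
  have hedist : ∀ y q : Space n, ‖y - x - t • q‖ ≤ δ / 2 * t → edist (t⁻¹ • y) q ≤ δ := by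
    intro y q hyq
    rw [edist_nndist, ENNReal.coe_le_coe, ← NNReal.coe_le_coe, coe_nndist, dist_eq_norm]
    have e : t⁻¹ • y - q = t⁻¹ • ((y - x - t • q) + x) := by
      rw [sub_right_comm, sub_add_cancel, smul_sub, inv_smul_smul₀ ht0.ne']
    rw [e, norm_smul, norm_inv, Real.norm_of_nonneg ht0.le, inv_mul_le_iff₀ ht0]
    have := norm_add_le (y - x - t • q) x
    linarith
  refine Metric.hausdorffEDist_le_of_mem_edist ?_ ?_
  · rintro _ ⟨y, hy, rfl⟩
    obtain ⟨q, hq, hyq⟩ := (happ t ht x).1 y hy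
    exact ⟨q, hq, hedist y q hyq⟩
  · intro q hq
    obtain ⟨y, hy, hyq⟩ := (happ t ht x).2 q hq
    refine ⟨t⁻¹ • y, smul_mem_smul_set hy, ?_⟩
    rw [edist_comm]
    exact hedist y q hyq

end Homogenization

/-! ### Assembly. -/

theorem mainTheorem5 {n : ℕ} {Ω : Type*} [MeasurableSpace Ω] (P : Measure Ω)
    [IsProbabilityMeasure P] (τ : ℤ → Ω → Ω) (hτ : IsErgodicGroup P τ)
    (a : Space n → ℝ → Ω → ℝ) (b : Space n → ℝ → Ω → Space n) (α β η : ℝ)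
    (hA : AssumptionA τ a α β) (hB : AssumptionB τ b α η) :
    ∃ D : Set (Space n), IsCompact D ∧ Convex ℝ D ∧ D.Nonempty ∧
      ∃ Ω' : Set Ω, MeasurableSet Ω' ∧ P Ω' = 1 ∧ ∀ ω ∈ Ω',
        Tendsto (fun t : ℝ => ⨆ x ∈ unitCell n,
            Metric.hausdorffEDist
              (t⁻¹ • reachableSet (fun y r => a y r ω) (fun y r => b y r ω) t x) D)
          atTop (𝓝 0) ∧
        ∀ u₀ : Space n → ℝ, UniformContinuous u₀ →
          (∀ ε : ℝ, 0 < ε →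
            IsWellPosed (driftHamiltonian (fun y r => a y r ω) (fun y r => b y r ω) ε) u₀) ∧
          IsWellPosed (fun _ _ p => effectiveHamiltonian D p) u₀ ∧
          ∀ (u : ℝ → Space n × ℝ → ℝ) (ubar : Space n × ℝ → ℝ),
            (∀ ε : ℝ, 0 < ε → IsViscositySolution
              (driftHamiltonian (fun y r => a y r ω) (fun y r => b y r ω) ε) u₀ (u ε)) →
            IsViscositySolution (fun _ _ p => effectiveHamiltonian D p) u₀ ubar →
            TendstoLocallyUniformlyOn u ubar (𝓝[>] 0) (univ ×ˢ Ici 0) := by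
  obtain ⟨H, hH⟩ := exists_ae_forall_hasAsymptoticSpeed hτ hA hB
  -- `H` is not random, so its bounds can be read off from a single environment.
  obtain ⟨ω₀, hω₀⟩ := hH.exists
  obtain ⟨K₀, h₀⟩ := exists_isCoerciveField hA hB ω₀
  have hβ := h₀.beta_pos
  have hHle : ∀ p, H p ≤ 2 * β * ‖p‖ := fun p => h₀.speed_le_mul (hω₀ p)
  have hDc := isCompact_supportedSet (by positivity) hHle
  have hDb : ∀ q ∈ supportedSet H, ‖q‖ ≤ 2 * β := fun q hq =>
    norm_le_of_mem_supportedSet (by positivity) hHle hq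
  have hconv := convex_supportedSet H
  have hne : (supportedSet H).Nonempty :=
    -- D contains 0 because standing still is admissible, so that no speed is negative.
    ⟨0, fun p => by rw [inner_zero_right]; exact h₀.speed_nonneg (hω₀ p)⟩
  obtain ⟨Ω', hΩ', hm, hall⟩ := hH.exists_measurable_mem
  refine ⟨supportedSet H, hDc, hconv, hne, Ω', hm, (mem_ae_iff_prob_eq_one hm).1 hΩ',
    fun ω hω => ?_⟩
  obtain ⟨K, h⟩ := exists_isCoerciveField hA hB ω
  have happ := h.reachApproximates (isLatticePeriodic_of_stationary hτ hA hB ω) (hall ω hω)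
  exact ⟨happ.tendsto_iSup_hausdorffEDist, fun u₀ hu₀ =>
    -- `driftHamiltonian` unfolds to `controlHamiltonian` of the rescaled fields.
    ⟨fun ε hε => (h.rescale hε).isWellPosed_controlHamiltonian hu₀,
      isWellPosed_effectiveHamiltonian hDc hconv hne (by positivity) hDb hu₀,
      fun u ubar hu hubar => happ.tendstoLocallyUniformlyOn h hDc hconv hne hDb hu₀ hu hubar⟩⟩
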